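/- All graphs are finite and simple. For integers $t,\Delta\ge 0$, a \emph{$(t,\Delta)$-tree} is a tree with maximum degree at most $\Delta$ and at most $t$ vertices of degree at least $3$. A bipartite graph $G=(A,B,E)$ is \emph{$(t,\Delta)$-tree convex} if there is a $(t,\Delta)$-tree $H$ with $V(H)=A$ such that for each $b\in B$ the set of neighbours of $b$ induces a connected (possibly empty) subgraph of $H$. A \emph{branch decomposition} of $G$ is a pair $(T,\delta)$, where $T$ is a tree of maximum degree at most $3$ and $\delta$ is a bijection from $V(G)$ to the leaves of $T$ (the vertex of a one-vertex tree counts as a leaf); it is \emph{linear} if $T$ is a caterpillar, that is, if $T$ contains a path such that every vertex not on it has a neighbour on it. Each edge $e$ of $T$ yields a partition $(A_e,\overline{A_e})$ of $V(G)$ into the vertices mapped by $\delta$ to the one and to the other component of $T-e$. The \emph{mim-width} of $(T,\delta)$ is the maximum, over all $e\in E(T)$, of the size of a maximum induced matching in the bipartite graph $G[A_e,\overline{A_e}]$ formed by the edges of $G$ between $A_e$ and $\overline{A_e}$ (and it is $0$ if $T$ has no edge). The \emph{mim-width} (respectively, \emph{linear mim-width}) of $G$ is the minimum mim-width of a branch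 decomposition (respectively, linear branch decomposition) of $G$. \textbf{Corollary.} For every $t,\Delta\in\mathbb{N}$ with $t\ge 1$ and $\Delta\ge 3$, every $(t,\Delta)$-tree convex graph has linear mim-width, and hence also mim-width, at most $2+t(\Delta-2)$. Moreover, for all such fixed $t,\Delta$ there is a polynomial-time algorithm that, given a $(t,\Delta)$-tree convex graph $G=(A,B,E)$ with its bipartition, computes a linear branch decomposition $(T,\delta)$ of $G$ with mim-width at most $2+t(\Delta-2)$. -/

import Mathlib

namespace LinMim

/-! ### Tree convex graphs -/

/-- A `(t, Δ)`-tree: a tree of maximum degree at most `Δ` in which at most `t` vertices have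
degree at least `3`. -/
structure IsTDTree {W : Type*} (t Δ : ℕ) (H : SimpleGraph W) : Prop where
  isTree : H.IsTree
  degree_le : ∀ w, (H.neighborSet w).encard ≤ Δ
  branch_le : {w | 3 ≤ (H.neighborSet w).encard}.encard ≤ t

/-- The graph `G`, bipartite with partition classes `A` and `B = Aᶜ`, is `(t, Δ)`-tree convex:
there is a `(t, Δ)`-tree `H` with vertex set `A` such that the neighbourhood of every `b ∈ B`
induces a connected (possibly empty) subgraph of `H`. -/
def IsTDTreeConvex {V : Type*} (t Δ : ℕ) (G : SimpleGraph V) (A : Set V) : Prop :=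
  G.IsBipartiteWith A Aᶜ ∧
    ∃ H : SimpleGraph A, IsTDTree t Δ H ∧
      ∀ b ∈ Aᶜ, (H.induce {a : A | G.Adj b a}).Preconnected

/-! ### Branch decompositions and (linear) mim-width -/

/-- `M` is an induced matching of `G`: distinct edges of `M` share no endpoint and are not joined
by an edge of `G`. -/
def IsInducedMatching {V : Type*} (G : SimpleGraph V) (M : Set (Sym2 V)) : Prop :=
  M ⊆ G.edgeSet ∧
    ∀ e ∈ M, ∀ f ∈ M, e ≠ f → ∀ u ∈ e, ∀ v ∈ f, u ≠ v ∧ ¬ G.Adj u v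

/-- The maximum size of an induced matching of the bipartite graph `G[X, Xᶜ]`. -/
noncomputable def cutmim {V : Type*} (G : SimpleGraph V) (X : Set V) : ℕ∞ :=
  ⨆ (M : Set (Sym2 V)) (_ : IsInducedMatching (G.between X Xᶜ) M), M.encard

/-- `(T, δ)` is a branch decomposition of a graph with vertex set `V`: `T` is a subcubic tree and
`δ` is a bijection from `V` to the leaves of `T`. A leaf is a vertex of degree at most `1`, so
that the vertex of a one-vertex tree is a leaf. -/
structure IsBranchDecomposition {V W : Type*} (T : SimpleGraph W) (δ : V → W) : Prop where
  isTree : T.IsTree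
  subcubic : ∀ w, (T.neighborSet w).encard ≤ 3
  bijOn : Set.BijOn δ Set.univ {w | (T.neighborSet w).encard ≤ 1}

/-- A caterpillar: a tree with a path (the backbone) such that every vertex outside the path has a
neighbour on it. -/
def IsCaterpillar {W : Type*} (T : SimpleGraph W) : Prop :=
  T.IsTree ∧ ∃ (x y : W) (p : T.Walk x y), p.IsPath ∧
    ∀ w, w ∉ p.support → ∃ z ∈ p.support, T.Adj w z

/-- A linear branch decomposition: a branch decomposition whose tree is a caterpillar. -/
structure IsLinearBranchDecomposition {V W : Type*} (T : SimpleGraph W) (δ : V → W) : Prop where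
  isBranchDecomposition : IsBranchDecomposition T δ
  isCaterpillar : IsCaterpillar T

/-- For an edge `xy` of the tree `T`, the vertices of `G` that `δ` maps to the component of
`T - xy` containing `x`. -/
def side {V W : Type*} (T : SimpleGraph W) (δ : V → W) (x y : W) : Set V :=
  {v | (T.deleteEdges {s(x, y)}).Reachable x (δ v)}

/-- The mim-width of `(T, δ)`: the maximum of `cutmim` over the cuts given by the edges of `T`. -/
noncomputable def decompositionMimWidth {V W : Type*} (G : SimpleGraph V) (T : SimpleGraph W)
    (δ : V → W) : ℕ∞ :=
  ⨆ (x : W) (y : W) (_ : T.Adj x y), cutmim G (side T δ x y)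

/-- The mim-width of `G`: the minimum over all branch decompositions (`⊤` if there is none). -/
noncomputable def mimWidth {V : Type*} (G : SimpleGraph V) : ℕ∞ :=
  ⨅ (m : ℕ) (T : SimpleGraph (Fin m)) (δ : V → Fin m) (_ : IsBranchDecomposition T δ),
    decompositionMimWidth G T δ

/-- The linear mim-width of `G`: the minimum over all linear branch decompositions
(`⊤` if there is none). -/
noncomputable def linearMimWidth {V : Type*} (G : SimpleGraph V) : ℕ∞ :=
  ⨅ (m : ℕ) (T : SimpleGraph (Fin m)) (δ : V → Fin m) (_ : IsLinearBranchDecomposition T δ),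
    decompositionMimWidth G T δ

/-! ### Random access machines

A structured random access machine with indirect addressing, whose memory cells hold natural
numbers. The only arithmetic operations are addition and truncated subtraction, and each operation
costs one step; this is the usual unit-cost machine, which is polynomially equivalent to Turing
machines. The memory is organized in arrays; a program is a finite text in which arrays are named
by numerals, so it uses finitely many of them. A scalar variable is cell `0` of an array. -/

/-- The memory: `s a i` is the content of cell `i` of array `a`. -/
abbrev Memory : Type := ℕ → ℕ → ℕ

/-- Expressions: numerals, the content of a cell with a computed index, sums and truncated
differences. -/
inductive Expr : Type
  | const (c : ℕ)
  | read (a : ℕ) (i : Expr)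
  | add (e f : Expr)
  | sub (e f : Expr)

namespace Expr

/-- The value of an expression. -/
def eval (s : Memory) : Expr → ℕ
  | const c => c
  | read a i => s a (i.eval s)
  | add e f => e.eval s + f.eval s
  | sub e f => e.eval s - f.eval s

/-- The number of operations needed to evaluate an expression. -/
def cost : Expr → ℕ
  | const _ => 1
  | read _ i => i.cost + 1
  | add e f => e.cost + f.cost + 1
  | sub e f => e.cost + f.cost + 1

end Expr

/-- Programs. `write a i e` stores the value of `e` in the cell of array `a` whose index is the
value of `i`; a condition `e` is true if its value is nonzero. -/
inductive Program : Type
  | skip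
  | write (a : ℕ) (i e : Expr)
  | seq (p q : Program)
  | ite (e : Expr) (p q : Program)
  | loop (e : Expr) (p : Program)

/-- `Run p s k s'`: started on memory `s`, the program `p` halts with memory `s'` after exactly
`k` steps. `loop e p` repeats `p` as long as `e` is true. -/
inductive Run : Program → Memory → ℕ → Memory → Prop
  | skip (s : Memory) : Run .skip s 1 s
  | write (a : ℕ) (i e : Expr) (s : Memory) :
      Run (.write a i e) s (i.cost + e.cost + 1)
        (Function.update s a (Function.update (s a) (i.eval s) (e.eval s)))
  | seq {p q : Program} {s s' s'' : Memory} {k l : ℕ} :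
      Run p s k s' → Run q s' l s'' → Run (.seq p q) s (k + l) s''
  | ite_true {e : Expr} {p : Program} (q : Program) {s s' : Memory} {k : ℕ} :
      e.eval s ≠ 0 → Run p s k s' → Run (.ite e p q) s (e.cost + 1 + k) s'
  | ite_false {e : Expr} (p : Program) {q : Program} {s s' : Memory} {k : ℕ} :
      e.eval s = 0 → Run q s k s' → Run (.ite e p q) s (e.cost + 1 + k) s'
  | loop_true {e : Expr} {p : Program} {s s' s'' : Memory} {k l : ℕ} :
      e.eval s ≠ 0 → Run p s k s' → Run (.loop e p) s' l s'' →
        Run (.loop e p) s (e.cost + 1 + k + l) s''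
  | loop_false {e : Expr} (p : Program) {s : Memory} :
      e.eval s = 0 → Run (.loop e p) s (e.cost + 1) s

/-! ### Input and output format -/

open Classical in
/-- The initial memory for a graph `G` with vertices `0, …, n - 1` and partition classes `A`, `Aᶜ`:
array `0` holds `n` in cell `0`, array `1` holds the indicator vector of `A`, array `2` holds the
adjacency matrix of `G` row by row, and all other cells hold `0`. -/
noncomputable def inputMemory {n : ℕ} (G : SimpleGraph (Fin n)) (A : Set (Fin n)) : Memory :=
  fun a i =>
    if a = 0 ∧ i = 0 then n
    else if a = 1 ∧ ∃ v : Fin n, i = v ∧ v ∈ A then 1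
    else if a = 2 ∧ ∃ u v : Fin n, i = n * u + v ∧ G.Adj u v then 1
    else 0

/-- The final memory `s` holds the pair `(T, δ)`, where `T` has vertices `0, …, m - 1`: array `3`
holds `m` in cell `0` and the number of listed edges of `T` in cell `1`, arrays `4` and `5` hold
the two endpoints of the listed edges, and array `6` holds the values of `δ`. -/
structure IsOutput {n m : ℕ} (s : Memory) (T : SimpleGraph (Fin m)) (δ : Fin n → Fin m) :
    Prop where
  order : s 3 0 = m
  endpoints_lt : ∀ k < s 3 1, s 4 k < m ∧ s 5 k < m
  adj_iff : ∀ x y : Fin m, T.Adj x y ↔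
    ∃ k < s 3 1, (s 4 k = x ∧ s 5 k = y) ∨ (s 4 k = y ∧ s 5 k = x)
  leaf : ∀ v : Fin n, s 6 v = δ v

end LinMim

/-! Call a tree on `A` a support if every hyperedge, that is, the neighbourhood of every vertex
outside `A`, is connected in it; `bag a` is the set of hyperedges through `a`, and the label of an
edge `uv` is `bag u ∩ bag v`. Tree convexity provides a support `H` that is a `(t, Δ)`-tree, and the
handshake lemma bounds its number of leaves by `2 + t * (Δ - 2)` (`IsTDTree.leafCount_le`). So it
suffices to turn a support `T` into a linear decomposition whose mim-width is at most the number of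
leaves of `T`.

For this, remove the vertices of `A` one at a time, each with at most one remaining neighbour in
`T`, and place every `b` outside `A` as soon as all its neighbours are placed. Orient `T` towards
later vertices. Consider an induced matching across a prefix, with edges `ab`, where `a` is placed
and `b` is not. Below each `a` there is a leaf. Two edges cannot share a leaf: otherwise one end
`a'` lies below another end `a`; the neighbourhood of the partner `b'` of `a'` is connected,
contains `a'` and avoids `a`, hence lies strictly below `a`, and `b'` would have been placed before
`a` (`cutmim_prefix_le`). The caterpillar with the vertices hung in this order has only prefixes and
single vertices as cuts, up to complements.

For the algorithm `H` is not given, so a support with the fewest leaves is computed; it has no more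
leaves than `H`. One program serves all `t` and `Δ`.

A support is found by local search: exchange tree edges as long as this enlarges a label. At a local
optimum `T`, exchange edges between `T` and any support `H`: the label of the edge entering `H` is
contained in that of the edge leaving it, and by optimality the two are equal. So `H` remains a
support while it approaches `T`, and `T` is itself a support (`isSupport_of_local_opt`).

The leaves are reduced by a push-relabel scheme. Edge ends are moved so that the tree remains a
support; a vertex has a height, leaves have height `0`, and no end may be movable down by two levels
(`LevelInvariant`). A branch vertex pushes an end one level down if it can, and is raised otherwise.
That pushes preserve the invariant becomes a counting statement once the ends of the edges with a
fixed label are seen as tokens on the components of `sepGraph`: the possible moves depend only on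
the number of tokens at each vertex (`levelInvariant_iff`, `TokenMove.invariant`). When all branch
vertices have reached height `N + 1`, some level in `1, …, N` is empty. The set `Z` above it
contains all branch vertices and no leaf, and no slide leaves it. Among all supports, `T` then
minimizes the degree sum over `Z` (`sum_vdeg_le`), and this makes its number of leaves minimal
(`leafCount_le`). Both searches stop after polynomially many passes because of integer potentials.

The program is written with loops of `n` rounds, so that its running time is a polynomial by
recursion on the syntax (`Cmd.run_compile`), and correctness is proved for a functional semantics.
-/

namespace LinMim

/-! ### Exchanging edges of trees -/

section Trees

variable {α β : Type*}

/-- The vertices on the side of `x` after the edge `xy` has been removed from `T`. -/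
def edgeSide (T : SimpleGraph α) (x y : α) : Set α :=
  {v | (T.deleteEdges {s(x, y)}).Reachable x v}

/-- Replace the edge `xy` by the edge `x'y'`. -/
def swapEdge (T : SimpleGraph α) (x y x' y' : α) : SimpleGraph α :=
  T.deleteEdges {s(x, y)} ⊔ SimpleGraph.edge x' y'

/-- The edges of `T` with both ends in `N`. -/
def restrictTo (T : SimpleGraph α) (N : Set α) : SimpleGraph α where
  Adj u v := T.Adj u v ∧ u ∈ N ∧ v ∈ N
  symm := ⟨fun _ _ h => ⟨h.1.symm, h.2.2, h.2.1⟩⟩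
  loopless := ⟨fun _ h => h.1.ne rfl⟩

/-- `T` is a support of the hypergraph in which the vertex `a` lies in the hyperedges `bag a`:
every hyperedge is connected in `T`. -/
def IsSupport (T : SimpleGraph α) (bag : α → Set β) : Prop :=
  ∀ b u v, b ∈ bag u → b ∈ bag v → (restrictTo T {a | b ∈ bag a}).Reachable u v

/-- A walk to `v`, stopped when it first uses the edge `vw`, has reached `v` or `w` without this
edge. -/
theorem reachable_deleteEdges_or {R : SimpleGraph α} {u v : α} (w : α) (h : R.Reachable u v) :
    (R.deleteEdges {s(v, w)}).Reachable u v ∨ (R.deleteEdges {s(v, w)}).Reachable u w := by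
  obtain ⟨p⟩ := h
  induction p with
  | nil => exact Or.inl (SimpleGraph.Reachable.refl _)
  | @cons a b c hab p ih =>
    by_cases he : s(a, b) = s(c, w)
    · rw [Sym2.eq_iff] at he
      rcases he with ⟨rfl, rfl⟩ | ⟨rfl, rfl⟩
      · exact Or.inl (SimpleGraph.Reachable.refl _)
      · exact Or.inr (SimpleGraph.Reachable.refl _)
    · have hadj : (R.deleteEdges {s(c, w)}).Adj a b := by
        simp [SimpleGraph.deleteEdges_adj, hab, he]
      exact ih.imp hadj.reachable.trans hadj.reachable.trans

theorem self_mem_edgeSide (T : SimpleGraph α) (x y : α) : x ∈ edgeSide T x y :=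
  SimpleGraph.Reachable.refl _

theorem edgeSide_not_mem {T : SimpleGraph α} (hT : T.IsTree) {x y : α} (h : T.Adj x y) :
    y ∉ edgeSide T x y :=
  SimpleGraph.isAcyclic_iff_forall_adj_isBridge.mp hT.isAcyclic h

theorem mem_edgeSide_or {T : SimpleGraph α} (hT : T.IsTree) (x y v : α) :
    v ∈ edgeSide T x y ∨ v ∈ edgeSide T y x := by
  have := reachable_deleteEdges_or y (hT.connected.preconnected v x)
  rcases this with h | h
  · exact Or.inl h.symm
  · right
    rw [Sym2.eq_swap] at h
    exact h.symm

theorem edgeSide_compl {T : SimpleGraph α} (hT : T.IsTree) {x y : α} (h : T.Adj x y) (v : α) :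
    v ∈ edgeSide T y x ↔ v ∉ edgeSide T x y := by
  refine ⟨fun h1 h2 => edgeSide_not_mem hT h ?_, fun h1 => (mem_edgeSide_or hT x y v).resolve_left h1⟩
  have h1' : (T.deleteEdges {s(x, y)}).Reachable y v := by rw [Sym2.eq_swap]; exact h1
  exact SimpleGraph.Reachable.trans h2 h1'.symm

theorem mem_edgeSide_of_adj {T : SimpleGraph α} {x y u v : α} (h : T.Adj u v)
    (hne : s(u, v) ≠ s(x, y)) (hu : u ∈ edgeSide T x y) : v ∈ edgeSide T x y := by
  have hadj : (T.deleteEdges {s(x, y)}).Adj u v := by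
    simp [SimpleGraph.deleteEdges_adj, h, hne]
  exact SimpleGraph.Reachable.trans hu hadj.reachable

theorem eq_of_adj_edgeSide {T : SimpleGraph α} (hT : T.IsTree) {x y u v : α} (hxy : T.Adj x y)
    (h : T.Adj u v) (hu : u ∈ edgeSide T x y) (hv : v ∉ edgeSide T x y) : u = x ∧ v = y := by
  have he : s(u, v) = s(x, y) := by
    by_contra hne
    exact hv (mem_edgeSide_of_adj h hne hu)
  rw [Sym2.eq_iff] at he
  rcases he with h | ⟨rfl, rfl⟩
  · exact h
  · exact absurd hu (edgeSide_not_mem hT hxy)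

/-- A path uses each of its edges only once, so the parts before and after the edge survive its
removal. -/
theorem path_dart_edgeSide {T : SimpleGraph α} {u v : α} (p : T.Walk u v) (hp : p.IsPath)
    (d : T.Dart) (hd : d ∈ p.darts) :
    u ∈ edgeSide T d.fst d.snd ∧ v ∈ edgeSide T d.snd d.fst := by
  induction p with
  | nil => simp at hd
  | @cons a b c hab p ih =>
    rw [SimpleGraph.Walk.cons_isPath_iff] at hp
    rw [SimpleGraph.Walk.darts_cons, List.mem_cons] at hd
    rcases hd with rfl | hd
    · refine ⟨SimpleGraph.Reachable.refl _, ?_⟩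
      have : s(b, a) ∉ p.edges := fun h => hp.2 (p.snd_mem_support_of_mem_edges h)
      exact ⟨p.toDeleteEdges _ (fun e he he' => this (by
        rw [Set.mem_singleton_iff] at he'; exact he' ▸ he))⟩
    · obtain ⟨h1, h2⟩ := ih hp.1 hd
      refine ⟨?_, h2⟩
      have ha : s(b, a) ≠ s(d.fst, d.snd) := by
        intro he
        have : s(b, a) ∈ p.edges := by
          rw [he]
          exact List.mem_map.mpr ⟨d, hd, rfl⟩
        exact hp.2 (p.snd_mem_support_of_mem_edges this)
      exact mem_edgeSide_of_adj hab.symm ha h1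

theorem exists_adj_across {T : SimpleGraph α} {S : Set α} {u v : α} (h : T.Reachable u v)
    (hu : u ∈ S) (hv : v ∉ S) : ∃ x y, T.Adj x y ∧ x ∈ S ∧ y ∉ S ∧ u ∈ edgeSide T x y ∧
      v ∈ edgeSide T y x := by
  classical
  obtain ⟨p, hp⟩ := h.exists_isPath
  obtain ⟨d, hd, h1, h2⟩ := p.exists_boundary_dart S hu hv
  exact ⟨d.fst, d.snd, d.adj, h1, h2, path_dart_edgeSide p hp d hd⟩

theorem swapEdge_adj {T : SimpleGraph α} {x y x' y' u v : α} :
    (swapEdge T x y x' y').Adj u v ↔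
      (T.Adj u v ∧ s(u, v) ≠ s(x, y)) ∨ (s(u, v) = s(x', y') ∧ u ≠ v) := by
  simp only [swapEdge, SimpleGraph.sup_adj, SimpleGraph.deleteEdges_adj, Set.mem_singleton_iff,
    SimpleGraph.edge_adj, Sym2.eq_iff, ne_eq]

theorem swapEdge_edgeSet {T : SimpleGraph α} {x y x' y' : α} (h : x' ≠ y') :
    (swapEdge T x y x' y').edgeSet = insert s(x', y') (T.edgeSet \ {s(x, y)}) := by
  ext e
  induction e with | _ u v
  rw [SimpleGraph.mem_edgeSet, swapEdge_adj]
  simp only [Set.mem_insert_iff, Set.mem_sdiff, SimpleGraph.mem_edgeSet, Set.mem_singleton_iff]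
  constructor
  · rintro (h1 | h1)
    · exact Or.inr h1
    · exact Or.inl h1.1
  · rintro (h1 | h1)
    · refine Or.inr ⟨h1, ?_⟩
      rintro rfl
      rw [Sym2.eq_iff] at h1
      rcases h1 with ⟨rfl, h2⟩ | ⟨rfl, h2⟩
      · exact h h2
      · exact h h2.symm
    · exact Or.inl h1

/-- The new edge reconnects the two sides left by the removal, and the number of edges does not
change. -/
theorem swapEdge_isTree [Finite α] {T : SimpleGraph α} (hT : T.IsTree) {x y x' y' : α}
    (hxy : T.Adj x y) (hx' : x' ∈ edgeSide T x y) (hy' : y' ∉ edgeSide T x y) :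
    (swapEdge T x y x' y').IsTree := by
  have hne : x' ≠ y' := fun h => hy' (h ▸ hx')
  have hle : T.deleteEdges {s(x, y)} ≤ swapEdge T x y x' y' := le_sup_left
  have hy2 := (edgeSide_compl hT hxy y').mpr hy'
  rw [SimpleGraph.isTree_iff_connected_and_card] at hT ⊢
  constructor
  · have hadj : (swapEdge T x y x' y').Adj x' y' := swapEdge_adj.mpr (Or.inr ⟨rfl, hne⟩)
    have key : ∀ v, (swapEdge T x y x' y').Reachable v x' := by
      intro v
      rcases reachable_deleteEdges_or y (hT.1.preconnected v x) with h | h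
      · exact (h.trans hx').mono hle
      · have h3 : (T.deleteEdges {s(x, y)}).Reachable y y' := by rw [Sym2.eq_swap]; exact hy2
        exact ((h.trans h3).mono hle).trans hadj.symm.reachable
    have := hT.1.nonempty
    exact ⟨fun u v => (key u).trans (key v).symm⟩
  · rw [← hT.2, swapEdge_edgeSet hne]
    congr 1
    have hmem : s(x, y) ∈ T.edgeSet := hxy
    have hnot : s(x', y') ∉ T.edgeSet \ {s(x, y)} := by
      rintro ⟨h1, h2⟩
      exact hy' (mem_edgeSide_of_adj h1 h2 hx')
    have hfin : T.edgeSet.Finite := Set.toFinite _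
    change (insert s(x', y') (T.edgeSet \ {s(x, y)})).ncard = T.edgeSet.ncard
    rw [Set.ncard_insert_of_notMem hnot (hfin.subset Set.sdiff_subset),
      Set.ncard_sdiff_singleton_add_one hmem hfin]

/-- The running intersection property: a hyperedge through `u` and `v` is connected in `T`, and `xy`
is the only edge between the two sides. -/
theorem IsSupport.inter_subset {T : SimpleGraph α} {bag : α → Set β} (hS : IsSupport T bag)
    {x y u v : α} (hu : u ∈ edgeSide T x y) (hv : v ∉ edgeSide T x y) :
    bag u ∩ bag v ⊆ bag x ∩ bag y := by
  rintro b ⟨hbu, hbv⟩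
  obtain ⟨p⟩ := hS b u v hbu hbv
  obtain ⟨d, -, h1, h2⟩ := p.exists_boundary_dart (edgeSide T x y) hu hv
  obtain ⟨had, hb1, hb2⟩ := d.adj
  have he : s(d.fst, d.snd) = s(x, y) := by
    by_contra hne
    exact h2 (mem_edgeSide_of_adj had hne h1)
  rw [Sym2.eq_iff] at he
  rcases he with ⟨h3, h4⟩ | ⟨h3, h4⟩
  · exact ⟨h3 ▸ hb1, h4 ▸ hb2⟩
  · exact ⟨h4 ▸ hb2, h3 ▸ hb1⟩

/-- Only hyperedges containing both `x` and `y` lose an edge. Such a hyperedge falls into two parts,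
one on each side, and `x'y'` joins them because `hlab` puts both of its ends into the hyperedge. -/
theorem IsSupport.swapEdge {T : SimpleGraph α} (hT : T.IsTree) {bag : α → Set β}
    (hS : IsSupport T bag) {x y x' y' : α} (hxy : T.Adj x y) (hx' : x' ∈ edgeSide T x y)
    (hy' : y' ∉ edgeSide T x y) (hlab : bag x ∩ bag y ⊆ bag x' ∩ bag y') :
    IsSupport (swapEdge T x y x' y') bag := by
  intro b u v hu hv
  have hne : x' ≠ y' := fun h => hy' (h ▸ hx')
  by_cases hb : b ∈ bag x ∩ bag y
  · set R := restrictTo T {a | b ∈ bag a} with hR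
    have hle : R.deleteEdges {s(x, y)} ≤ restrictTo (LinMim.swapEdge T x y x' y') {a | b ∈ bag a} := by
      intro c d h
      rw [SimpleGraph.deleteEdges_adj] at h
      exact ⟨swapEdge_adj.mpr (Or.inl ⟨h.1.1, h.2⟩), h.1.2⟩
    have hle2 : R.deleteEdges {s(x, y)} ≤ T.deleteEdges {s(x, y)} :=
      SimpleGraph.deleteEdges_mono fun _ _ h => h.1
    have h1 : (R.deleteEdges {s(x, y)}).Reachable x' x := by
      rcases reachable_deleteEdges_or y (hS b x' x (hlab hb).1 hb.1) with h | h
      · exact h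
      · exact absurd (SimpleGraph.Reachable.trans hx' (h.mono hle2)) (edgeSide_not_mem hT hxy)
    have h2 : (R.deleteEdges {s(x, y)}).Reachable y' y := by
      rcases reachable_deleteEdges_or y (hS b y' x (hlab hb).2 hb.1) with h | h
      · exact absurd (h.mono hle2).symm hy'
      · exact h
    have hadj : (restrictTo (LinMim.swapEdge T x y x' y') {a | b ∈ bag a}).Adj x' y' :=
      ⟨swapEdge_adj.mpr (Or.inr ⟨rfl, hne⟩), (hlab hb).1, (hlab hb).2⟩
    have key : ∀ w, b ∈ bag w →
        (restrictTo (LinMim.swapEdge T x y x' y') {a | b ∈ bag a}).Reachable w x' := by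
      intro w hw
      rcases reachable_deleteEdges_or y (hS b w x hw hb.1) with h | h
      · exact (h.trans h1.symm).mono hle
      · exact ((h.trans h2.symm).mono hle).trans hadj.symm.reachable
    exact (key u hu).trans (key v hv).symm
  · refine (hS b u v hu hv).mono ?_
    rintro c d ⟨h1, h2, h3⟩
    refine ⟨swapEdge_adj.mpr (Or.inl ⟨h1, fun he => hb ?_⟩), h2, h3⟩
    rw [Sym2.eq_iff] at he
    rcases he with ⟨rfl, rfl⟩ | ⟨rfl, rfl⟩
    · exact ⟨h2, h3⟩
    · exact ⟨h3, h2⟩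

/-- Symmetric exchange between two trees on the same vertex set. -/
theorem exists_exchange [Finite α] {T H : SimpleGraph α} (hT : T.IsTree) (hH : H.IsTree)
    (hne : T ≠ H) : ∃ x y x' y', T.Adj x y ∧ H.Adj x' y' ∧
      x' ∈ edgeSide T x y ∧ y' ∉ edgeSide T x y ∧ x ∈ edgeSide H x' y' ∧ y ∉ edgeSide H x' y' ∧
      (T.edgeSet \ (swapEdge H x' y' x y).edgeSet).ncard < (T.edgeSet \ H.edgeSet).ncard := by
  have hex : ∃ x y, T.Adj x y ∧ ¬ H.Adj x y := by
    by_contra hcon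
    push Not at hcon
    have hle : T ≤ H := fun x y h => hcon x y h
    have := SimpleGraph.isTree_iff_minimal_connected.mp hH
    exact hne (le_antisymm hle (this.2 hT.connected hle))
  obtain ⟨x, y, hxy, hnxy⟩ := hex
  -- The path of `H` from `x` to `y` has to leave the side of `x` in `T`. The edge where it does so
  -- can be exchanged with `xy` in both trees.
  obtain ⟨x', y', h1, h2, h3, h4, h5⟩ := exists_adj_across (hH.connected.preconnected x y)
    (self_mem_edgeSide T x y) (edgeSide_not_mem hT hxy)
  have h6 := (edgeSide_compl hH h1 y).mp h5
  have hne' : x ≠ y := hxy.ne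
  refine ⟨x, y, x', y', hxy, h1, h2, h3, h4, h6, ?_⟩
  apply Set.ncard_lt_ncard _ (Set.toFinite _)
  rw [swapEdge_edgeSet hne', Set.ssubset_iff_of_subset]
  · exact ⟨s(x, y), ⟨hxy, hnxy⟩, fun h => h.2 (Set.mem_insert _ _)⟩
  -- The removed edge `x'y'` of `H` is not an edge of `T`: only `xy` crosses between the sides in
  -- `T`, and `xy` is not in `H`. So no common edge is lost.
  · rintro e ⟨he1, he2⟩
    refine ⟨he1, fun he3 => he2 ?_⟩
    refine Set.mem_insert_of_mem _ ⟨he3, ?_⟩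
    rintro rfl
    have hT' : T.Adj x' y' := he1
    obtain ⟨rfl, rfl⟩ := eq_of_adj_edgeSide hT hxy hT' h2 h3
    exact hnxy h1

/-- A tree in which no exchange enlarges a label is a support, if there is a support. -/
theorem isSupport_of_local_opt [Finite α] [Finite β] {T H : SimpleGraph α} {bag : α → Set β}
    (hT : T.IsTree) (hH : H.IsTree) (hHS : IsSupport H bag)
    (hopt : ∀ x y x' y', T.Adj x y → x' ∈ edgeSide T x y → y' ∉ edgeSide T x y →
      (bag x' ∩ bag y').ncard ≤ (bag x ∩ bag y).ncard) : IsSupport T bag := by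
  induction hk : (T.edgeSet \ H.edgeSet).ncard using Nat.strong_induction_on generalizing H with
  | _ k ih =>
    by_cases hne : T = H
    · rwa [hne]
    · obtain ⟨x, y, x', y', h1, h2, h3, h4, h5, h6, h7⟩ := exists_exchange hT hH hne
      -- `H` is a support, which gives one inclusion of labels; local optimality of `T` bounds the
      -- sizes the other way and forces equality. Hence the exchange in `H` yields a support closer
      -- to `T`.
      have hsub := hHS.inter_subset h5 h6
      have heq : bag x ∩ bag y = bag x' ∩ bag y' :=
        Set.eq_of_subset_of_ncard_le hsub (hopt x y x' y' h1 h3 h4) (Set.toFinite _)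
      exact ih _ (hk ▸ h7) (swapEdge_isTree hH h2 h5 h6)
        (hHS.swapEdge hH h2 h5 h6 heq.symm.subset) rfl

end Trees

/-! ### Sliding edges of a support -/

section Slides

variable {α β : Type*}

/-- The number of neighbours `z` of `u` in `T` such that `P u z`. -/
noncomputable def halfCount (T : SimpleGraph α) (P : α → α → Prop) (u : α) : ℕ :=
  {z | T.Adj u z ∧ P u z}.ncard

/-- The degree of `u` in `T`. -/
noncomputable def vdeg (T : SimpleGraph α) (u : α) : ℕ := (T.neighborSet u).ncard

/-- The number of edges of `T` at `u` whose label is `S`. -/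
noncomputable def sepDeg (T : SimpleGraph α) (bag : α → Set β) (S : Set β) (u : α) : ℕ :=
  halfCount T (fun u z => bag u ∩ bag z = S) u

theorem vdeg_eq_halfCount (T : SimpleGraph α) (u : α) :
    vdeg T u = halfCount T (fun _ _ => True) u := by
  simp [vdeg, halfCount, SimpleGraph.neighborSet]

open Classical in
theorem halfCount_eq_sum [Fintype α] (T : SimpleGraph α) (P : α → α → Prop) (u : α) :
    halfCount T P u = ∑ z, if T.Adj u z ∧ P u z then 1 else 0 := by
  rw [halfCount, Finset.sum_boole, Nat.cast_id, Set.ncard_eq_toFinset_card', Set.toFinset_ofPred]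

open Classical in
theorem sum_sym2_eq [Fintype α] (P : α → α → Prop) {x y : α} (hne : x ≠ y) (u : α) :
    (∑ z, if s(u, z) = s(x, y) ∧ P u z then 1 else 0) =
      (if u = x ∧ P x y then 1 else 0) + (if u = y ∧ P y x then 1 else 0) := by
  by_cases h1 : u = x
  · subst h1
    have : ∀ z, (s(u, z) = s(u, y) ∧ P u z) ↔ (z = y ∧ P u y) := by
      intro z
      rw [Sym2.eq_iff]
      constructor
      · rintro ⟨⟨-, rfl⟩ | ⟨rfl, rfl⟩, h⟩
        · exact ⟨rfl, h⟩
        · exact absurd rfl hne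
      · rintro ⟨rfl, h⟩
        exact ⟨Or.inl ⟨rfl, rfl⟩, h⟩
    simp only [this, hne, false_and, if_false, add_zero, true_and]
    by_cases hP : P u y <;> simp [hP]
  · by_cases h2 : u = y
    · subst h2
      have : ∀ z, (s(u, z) = s(x, u) ∧ P u z) ↔ (z = x ∧ P u x) := by
        intro z
        rw [Sym2.eq_iff]
        constructor
        · rintro ⟨⟨rfl, rfl⟩ | ⟨-, rfl⟩, h⟩
          · exact absurd rfl hne
          · exact ⟨rfl, h⟩
        · rintro ⟨rfl, h⟩
          exact ⟨Or.inr ⟨rfl, rfl⟩, h⟩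
      simp only [this, h1, false_and, if_false, zero_add, true_and]
      by_cases hP : P u x <;> simp [hP]
    · have : ∀ z, ¬ (s(u, z) = s(x, y) ∧ P u z) := by
        rintro z ⟨h, -⟩
        rw [Sym2.eq_iff] at h
        rcases h with h | h
        · exact h1 h.1
        · exact h2 h.1
      simp only [this, if_false]
      simp [h1, h2]

theorem ite_swap {A B C N : Prop} [Decidable A] [Decidable B] [Decidable C]
    [Decidable (C ∧ ¬ A ∨ B ∧ N)] (h1 : A → C) (h2 : B → C → A) (h3 : B → N) :
    (if C ∧ ¬ A ∨ B ∧ N then 1 else 0) + (if A then 1 else 0) =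
      (if C then 1 else 0) + (if B then 1 else 0) := by
  by_cases c1 : A <;> by_cases c2 : B <;> by_cases c3 : C <;> simp_all

open Classical in
-- The removed and the added edge are accounted for on opposite sides of the equation, which avoids
-- subtraction. By `hnew` the added edge may be present already only if the exchange is trivial.
theorem halfCount_swapEdge [Finite α] {T : SimpleGraph α} (P : α → α → Prop) {x y x' y' : α}
    (hxy : T.Adj x y) (hne : x' ≠ y') (hnew : T.Adj x' y' → s(x', y') = s(x, y)) (u : α) :
    halfCount (swapEdge T x y x' y') P u +
        ((if u = x ∧ P x y then 1 else 0) + (if u = y ∧ P y x then 1 else 0)) =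
      halfCount T P u +
        ((if u = x' ∧ P x' y' then 1 else 0) + (if u = y' ∧ P y' x' then 1 else 0)) := by
  have := Fintype.ofFinite α
  rw [← sum_sym2_eq P hxy.ne, ← sum_sym2_eq P hne, halfCount_eq_sum, halfCount_eq_sum,
    ← Finset.sum_add_distrib, ← Finset.sum_add_distrib]
  refine Finset.sum_congr rfl fun z _ => ?_
  by_cases hP : P u z
  · have h1 : s(u, z) = s(x, y) → T.Adj u z := fun h => by
      have : s(u, z) ∈ T.edgeSet := h ▸ hxy
      exact this
    have h2 : s(u, z) = s(x', y') → T.Adj u z → s(u, z) = s(x, y) := fun h h' => by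
      have : s(x', y') ∈ T.edgeSet := h ▸ h'
      exact h.trans (hnew this)
    have h3 : s(u, z) = s(x', y') → u ≠ z := fun h he => by
      subst he
      rw [Sym2.eq_iff] at h
      rcases h with ⟨rfl, h⟩ | ⟨h, rfl⟩
      · exact hne h
      · exact hne h
    simp only [swapEdge_adj, hP, and_true]
    exact ite_swap h1 h2 h3
  · simp [hP]

/-- Sliding the end `x` of the edge `xy` to `x'`. -/
def slideEdge (T : SimpleGraph α) (x y x' : α) : SimpleGraph α := swapEdge T x y x' y

/-- The slide of the end `x` of the edge `xy` to `x'` turns supports into supports. -/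
structure CanSlide (T : SimpleGraph α) (bag : α → Set β) (x y x' : α) : Prop where
  adj : T.Adj x y
  mem : x' ∈ edgeSide T x y
  subset : bag x ∩ bag y ⊆ bag x'

variable {T H : SimpleGraph α} {bag : α → Set β} {x y x' : α}

/-- Slides preserve labels: `x'` and `y` are on different sides of `xy`, so running intersection
gives the inclusion that the slide condition does not. -/
theorem CanSlide.label (hs : CanSlide T bag x y x') (hT : T.IsTree) (hS : IsSupport T bag) :
    bag x' ∩ bag y = bag x ∩ bag y :=
  (hS.inter_subset hs.mem (edgeSide_not_mem hT hs.adj)).antisymm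
    (Set.subset_inter hs.subset Set.inter_subset_right)

theorem CanSlide.isTree [Finite α] (hs : CanSlide T bag x y x') (hT : T.IsTree) :
    (slideEdge T x y x').IsTree :=
  swapEdge_isTree hT hs.adj hs.mem (edgeSide_not_mem hT hs.adj)

theorem CanSlide.isSupport (hs : CanSlide T bag x y x') (hT : T.IsTree) (hS : IsSupport T bag) :
    IsSupport (slideEdge T x y x') bag :=
  hS.swapEdge hT hs.adj hs.mem (edgeSide_not_mem hT hs.adj) (hs.label hT hS).symm.subset

theorem CanSlide.ne (hs : CanSlide T bag x y x') (hT : T.IsTree) : x' ≠ y :=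
  fun h => edgeSide_not_mem hT hs.adj (h ▸ hs.mem)

theorem CanSlide.eq_of_adj (hs : CanSlide T bag x y x') (hT : T.IsTree) (h : T.Adj x' y) :
    s(x', y) = s(x, y) := by
  rw [(eq_of_adj_edgeSide hT hs.adj h hs.mem (edgeSide_not_mem hT hs.adj)).1]

open Classical in
theorem CanSlide.vdeg [Finite α] (hs : CanSlide T bag x y x') (hT : T.IsTree) (u : α) :
    vdeg (slideEdge T x y x') u + (if u = x then 1 else 0) =
      vdeg T u + (if u = x' then 1 else 0) := by
  have := halfCount_swapEdge (fun _ _ => True) hs.adj (hs.ne hT) (hs.eq_of_adj hT) u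
  simp only [and_true] at this
  rw [vdeg_eq_halfCount, vdeg_eq_halfCount, slideEdge]
  omega

open Classical in
-- As the label is preserved, one edge end with this label moves from `x` to `x'`; by
-- `CanSlide.sepDeg_of_ne` the ends with other labels stay in place.
theorem CanSlide.sepDeg [Finite α] (hs : CanSlide T bag x y x') (hT : T.IsTree)
    (hS : IsSupport T bag) (u : α) :
    sepDeg (slideEdge T x y x') bag (bag x ∩ bag y) u + (if u = x then 1 else 0) =
      sepDeg T bag (bag x ∩ bag y) u + (if u = x' then 1 else 0) := by
  have := halfCount_swapEdge (fun u z => bag u ∩ bag z = bag x ∩ bag y) hs.adj (hs.ne hT)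
    (hs.eq_of_adj hT) u
  simp only [and_true, Set.inter_comm (bag y), hs.label hT hS] at this
  rw [LinMim.sepDeg, LinMim.sepDeg, slideEdge]
  omega

theorem CanSlide.sepDeg_of_ne [Finite α] (hs : CanSlide T bag x y x') (hT : T.IsTree)
    (hS : IsSupport T bag) {S : Set β} (hne : bag x ∩ bag y ≠ S) (u : α) :
    LinMim.sepDeg (slideEdge T x y x') bag S u = LinMim.sepDeg T bag S u := by
  have := halfCount_swapEdge (fun u z => bag u ∩ bag z = S) hs.adj (hs.ne hT)
    (hs.eq_of_adj hT) u
  simp only [Set.inter_comm (bag y), hs.label hT hS, hne, and_false, if_false, add_zero] at this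
  exact this

theorem mem_of_reachable_of_closed {R : SimpleGraph α} {S : Set α} {u v : α} (h : R.Reachable u v)
    (hu : u ∈ S) (hS : ∀ a b, a ∈ S → R.Adj a b → b ∈ S) : v ∈ S := by
  obtain ⟨p⟩ := h
  induction p with
  | nil => exact hu
  | cons hab p ih => exact ih (hS _ _ hu hab)

/-- If `x'` lies on the other side of `xy`, but `vw` is an edge on the side of `x` with the label of
`xy`, then two slides move an edge end from `x` to `x'`. -/
theorem canSlide_canSlide (hT : T.IsTree) (hxy : T.Adj x y) {v w : α}
    (hv : v ∈ edgeSide T x y) (hw : w ∈ edgeSide T x y) (hvw : T.Adj v w)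
    (hlab : bag v ∩ bag w = bag x ∩ bag y) (hsub : bag x ∩ bag y ⊆ bag x')
    (hx' : x' ∉ edgeSide T x y) :
    CanSlide T bag x y v ∧ CanSlide (slideEdge T x y v) bag v w x' := by
  have h1 : CanSlide T bag x y v := ⟨hxy, hv, hlab ▸ Set.inter_subset_left⟩
  have hy := edgeSide_not_mem hT hxy
  have hne : s(v, w) ≠ s(x, y) := by
    intro h
    rw [Sym2.eq_iff] at h
    rcases h with ⟨-, rfl⟩ | ⟨rfl, -⟩
    · exact hy hw
    · exact hy hv
  have hvy : v ≠ y := fun h => hy (h ▸ hv)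
  refine ⟨h1, swapEdge_adj.mpr (Or.inl ⟨hvw, hne⟩), ?_, hlab ▸ hsub⟩
  have hadj : (slideEdge T x y v).Adj v y := swapEdge_adj.mpr (Or.inr ⟨rfl, hvy⟩)
  -- After the first slide `y` hangs at `v`, so everything beyond `y`, including `x'`, is on the
  -- side of `v` when `vw` is removed. This permits the second slide. In total `v` loses and gains
  -- one end.
  have hy1 : y ∈ edgeSide (slideEdge T x y v) v w := by
    refine mem_edgeSide_of_adj hadj (fun h => ?_) (self_mem_edgeSide _ _ _)
    rw [Sym2.eq_iff] at h
    rcases h with ⟨-, rfl⟩ | ⟨rfl, rfl⟩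
    · exact hy hw
    · exact hy hv
  have h2 : (T.deleteEdges {s(y, x)}).Reachable y x' := (edgeSide_compl hT hxy x').mpr hx'
  refine (mem_of_reachable_of_closed (S := edgeSide T y x ∩ edgeSide (slideEdge T x y v) v w) h2
    ⟨self_mem_edgeSide _ _ _, hy1⟩ ?_).2
  rintro a b ⟨ha1, ha2⟩ hab
  rw [SimpleGraph.deleteEdges_adj, Set.mem_singleton_iff] at hab
  refine ⟨mem_edgeSide_of_adj hab.1 hab.2 ha1, mem_edgeSide_of_adj ?_ (fun h => ?_) ha2⟩
  · exact swapEdge_adj.mpr (Or.inl ⟨hab.1, by rw [Sym2.eq_swap (a := x)]; exact hab.2⟩)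
  · have ha3 := (edgeSide_compl hT hxy a).mp ha1
    rw [Sym2.eq_iff] at h
    rcases h with ⟨rfl, -⟩ | ⟨rfl, -⟩
    · exact ha3 hv
    · exact ha3 hw

/-! ### Edge ends of a given label -/

/-- The graph whose components are joined by the edges with label `S` of any support. -/
def sepGraph (bag : α → Set β) (S : Set β) : SimpleGraph α :=
  SimpleGraph.fromRel fun u v => S ⊂ bag u ∩ bag v

theorem sepGraph_adj {S : Set β} {u v : α} :
    (sepGraph bag S).Adj u v ↔ u ≠ v ∧ S ⊂ bag u ∩ bag v := by
  simp [sepGraph, Set.inter_comm (bag v)]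

open Classical in
/-- The total of `d` over the component of `u`. -/
noncomputable def compSum [Fintype α] (K : SimpleGraph α) (d : α → ℕ) (u : α) : ℕ :=
  ∑ v, if K.Reachable u v then d v else 0

/-- One of the `d u` tokens at `u` may move to `v`: within its component of `K`, or
to any element of `A` if the component has another token. -/
structure TokenMove [Fintype α] (K : SimpleGraph α) (A : Set α) (d : α → ℕ) (u v : α) : Prop where
  pos : 1 ≤ d u
  mem : v ∈ A
  move : K.Reachable u v ∨ 2 ≤ compSum K d u

theorem compSum_congr [Fintype α] {K : SimpleGraph α} {d : α → ℕ} {u v : α}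
    (h : K.Reachable u v) : compSum K d u = compSum K d v := by
  classical
  unfold compSum
  refine Finset.sum_congr rfl fun w _ => ?_
  have : K.Reachable u w ↔ K.Reachable v w := ⟨h.symm.trans, h.trans⟩
  by_cases hw : K.Reachable u w
  · rw [if_pos hw, if_pos (this.mp hw)]
  · rw [if_neg hw, if_neg fun h => hw (this.mpr h)]

open Classical in
theorem compSum_move [Fintype α] {K : SimpleGraph α} {d d' : α → ℕ} {x x' : α}
    (hd : ∀ u, d' u + (if u = x then 1 else 0) = d u + (if u = x' then 1 else 0)) (u : α) :
    compSum K d' u + (if K.Reachable u x then 1 else 0) =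
      compSum K d u + (if K.Reachable u x' then 1 else 0) := by
  have e : ∀ z, (if K.Reachable u z then 1 else 0) =
      ∑ v, if K.Reachable u v then (if v = z then 1 else 0) else 0 := by
    intro z
    rw [Finset.sum_eq_single z] <;> simp +contextual
  rw [e, e, compSum, compSum, ← Finset.sum_add_distrib, ← Finset.sum_add_distrib]
  refine Finset.sum_congr rfl fun v _ => ?_
  have := hd v
  split_ifs at * <;> omega

/-- Moving a token one level down preserves that no token may move down two levels. -/
theorem TokenMove.invariant [Fintype α] {K : SimpleGraph α} {A : Set α} {d d' : α → ℕ}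
    {h : α → ℕ} {x x' : α} (hm : TokenMove K A d x x') (hh : h x = h x' + 1)
    (hinv : ∀ u v, TokenMove K A d u v → h u ≤ h v + 1)
    (hd : ∀ u, d' u + (open Classical in if u = x then 1 else 0) =
      d u + (open Classical in if u = x' then 1 else 0)) :
    ∀ u v, TokenMove K A d' u v → h u ≤ h v + 1 := by
  classical
  rintro u v ⟨h1, h2, h3⟩
  -- A second token in the component of `x` allows the token of `x` to move anywhere in `A`.
  have hfree : 2 ≤ compSum K d x → h x ≤ h v + 1 := fun h => hinv x v ⟨hm.pos, h2, Or.inr h⟩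
  have hsum := compSum_move (K := K) hd u
  by_cases hu : u = x'
  · subst hu
    have hrefl : K.Reachable u u := SimpleGraph.Reachable.refl _
    by_cases hK : K.Reachable x u
    · have hd2 : h x ≤ h v + 1 := by
        rcases h3 with h3 | h3
        · exact hinv x v ⟨hm.pos, h2, Or.inl (hK.trans h3)⟩
        · apply hfree
          rw [compSum_congr hK]
          simp only [hrefl, hK.symm, if_true] at hsum
          omega
      omega
    · have := hfree (hm.move.resolve_left hK)
      omega
  · have hpos : 1 ≤ d u := by
      have := hd u
      simp only [hu, if_false] at this
      omega
    rcases h3 with h3 | h3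
    · exact hinv u v ⟨hpos, h2, Or.inl h3⟩
    · by_cases h4 : 2 ≤ compSum K d u
      · exact hinv u v ⟨hpos, h2, Or.inr h4⟩
      · have hux' : K.Reachable u x' := by
          by_contra hc
          simp only [hc, if_false] at hsum
          omega
        have hux : ¬ K.Reachable u x := by
          intro hc
          simp only [hc, hux', if_true] at hsum
          omega
        have hx := hfree (hm.move.resolve_left fun hc => hux (hux'.trans hc.symm))
        have := hinv u x' ⟨hpos, hm.mem, Or.inl hux'⟩
        omega

theorem le_compSum [Fintype α] (K : SimpleGraph α) (d : α → ℕ) {u v : α} (h : K.Reachable u v) :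
    d v ≤ compSum K d u := by
  classical
  unfold compSum
  calc d v = if K.Reachable u v then d v else 0 := by simp [h]
    _ ≤ _ := Finset.single_le_sum (f := fun v => if K.Reachable u v then d v else 0)
      (fun _ _ => Nat.zero_le _) (Finset.mem_univ v)

theorem add_le_compSum [Fintype α] (K : SimpleGraph α) (d : α → ℕ) {u v w : α}
    (hv : K.Reachable u v) (hw : K.Reachable u w) (hne : v ≠ w) : d v + d w ≤ compSum K d u := by
  classical
  unfold compSum
  calc d v + d w = ∑ z ∈ {v, w}, if K.Reachable u z then d z else 0 := by
        rw [Finset.sum_pair hne]; simp [hv, hw]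
    _ ≤ _ := Finset.sum_le_sum_of_subset (Finset.subset_univ _)

theorem sepDeg_pos [Finite α] {S : Set β} {u z : α} (h : T.Adj u z) (hl : bag u ∩ bag z = S) :
    1 ≤ LinMim.sepDeg T bag S u :=
  (Set.ncard_pos (Set.toFinite _)).mpr ⟨z, h, hl⟩

theorem exists_of_sepDeg_pos {S : Set β} {u : α} (h : 1 ≤ LinMim.sepDeg T bag S u) :
    ∃ z, T.Adj u z ∧ bag u ∩ bag z = S :=
  Set.nonempty_of_ncard_ne_zero (Nat.one_le_iff_ne_zero.mp h)

/-- The condition under which an end of the edge `xy` may move to `x'` by one or two slides. -/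
structure CanPush (T : SimpleGraph α) (bag : α → Set β) (x y x' : α) : Prop where
  adj : T.Adj x y
  subset : bag x ∩ bag y ⊆ bag x'
  side : x' ∈ edgeSide T x y ∨ ∃ v w, v ∈ edgeSide T x y ∧ w ∈ edgeSide T x y ∧ T.Adj v w ∧
    bag v ∩ bag w = bag x ∩ bag y

/-- The ends of `xy` at `x` and of `uz` at `u` are different tokens of the same component, either at
different vertices or at the same vertex with different neighbours. -/
theorem two_le_compSum [Fintype α] {S : Set β} (hxy : T.Adj x y) (hl : bag x ∩ bag y = S) {u z : α}
    (hu : (sepGraph bag S).Reachable x u) (huz : T.Adj u z) (hl' : bag u ∩ bag z = S)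
    (hne : s(u, z) ≠ s(x, y)) : 2 ≤ compSum (sepGraph bag S) (LinMim.sepDeg T bag S) x := by
  by_cases h : u = x
  · subst h
    refine le_trans ?_ (le_compSum _ _ (SimpleGraph.Reachable.refl _))
    have hzy : z ≠ y := fun h => hne (by rw [h])
    calc 2 = ({z, y} : Set α).ncard := (Set.ncard_pair hzy).symm
      _ ≤ _ := Set.ncard_le_ncard (by
        rintro a (rfl | rfl)
        · exact ⟨huz, hl'⟩
        · exact ⟨hxy, hl⟩) (Set.toFinite _)
  · have h1 := add_le_compSum (sepGraph bag S) (LinMim.sepDeg T bag S)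
      (SimpleGraph.Reachable.refl x) hu (Ne.symm h)
    have h2 := sepDeg_pos hxy hl
    have h3 := sepDeg_pos huz hl'
    omega

/-- All labels along the path from `x` to `v` contain the label `S` of `xy`. If the path leaves the
component of `x` in `sepGraph`, then the edge on which it does so has a label that is not strictly
larger, hence equal to `S`, and contributes a second token. -/
theorem reachable_or_two_le [Fintype α] (hT : T.IsTree) (hS : IsSupport T bag) (hxy : T.Adj x y)
    {v : α} (hv : v ∈ edgeSide T x y) (hsub : bag x ∩ bag y ⊆ bag v) :
    (sepGraph bag (bag x ∩ bag y)).Reachable x v ∨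
      2 ≤ compSum (sepGraph bag (bag x ∩ bag y)) (LinMim.sepDeg T bag (bag x ∩ bag y)) x := by
  classical
  by_cases hK : (sepGraph bag (bag x ∩ bag y)).Reachable x v
  · exact Or.inl hK
  right
  obtain ⟨p, hp⟩ := SimpleGraph.Reachable.exists_isPath hv
  have hle : T.deleteEdges {s(x, y)} ≤ T := SimpleGraph.deleteEdges_le _
  obtain ⟨d, hd, h1, h2⟩ := (p.mapLe hle).exists_boundary_dart
    {u | (sepGraph bag (bag x ∩ bag y)).Reachable x u} (SimpleGraph.Reachable.refl _) hK
  have hd' := path_dart_edgeSide _ ((SimpleGraph.Walk.isPath_mapLe hle).mpr hp) d hd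
  have hne : s(d.fst, d.snd) ≠ s(x, y) := by
    have h3 : s(d.fst, d.snd) ∈ (p.mapLe hle).edges := List.mem_map.mpr ⟨d, hd, rfl⟩
    rw [SimpleGraph.Walk.edges_mapLe_eq_edges] at h3
    have h4 : (T.deleteEdges {s(x, y)}).Adj d.fst d.snd := p.adj_of_mem_edges h3
    rw [SimpleGraph.deleteEdges_adj] at h4
    exact h4.2
  have hsub2 : bag x ∩ bag y ⊆ bag d.fst ∩ bag d.snd :=
    (Set.subset_inter Set.inter_subset_left hsub).trans
      (hS.inter_subset hd'.1 ((edgeSide_compl hT d.adj v).mp hd'.2))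
  have heq : bag d.fst ∩ bag d.snd = bag x ∩ bag y := by
    by_contra hne
    refine h2 (SimpleGraph.Reachable.trans h1 (SimpleGraph.Adj.reachable ?_))
    exact sepGraph_adj.mpr ⟨d.adj.ne, lt_of_le_of_ne hsub2 (Ne.symm hne)⟩
  exact two_le_compSum hxy rfl h1 d.adj heq hne

/-- If the push needs two slides, the auxiliary edge `vw` is the source of a second token: either
its end `v` lies in the component of `x`, or the path to `v` already yields one. -/
theorem CanPush.tokenMove [Fintype α] (h : CanPush T bag x y x') (hT : T.IsTree)
    (hS : IsSupport T bag) :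
    TokenMove (sepGraph bag (bag x ∩ bag y)) {v | bag x ∩ bag y ⊆ bag v}
      (LinMim.sepDeg T bag (bag x ∩ bag y)) x x' := by
  refine ⟨sepDeg_pos h.adj rfl, h.subset, ?_⟩
  rcases h.side with hv | ⟨v, w, hv, hw, hvw, hl⟩
  · exact reachable_or_two_le hT hS h.adj hv h.subset
  · right
    rcases reachable_or_two_le hT hS h.adj hv (hl ▸ Set.inter_subset_left) with h1 | h1
    · refine two_le_compSum h.adj rfl h1 hvw hl fun he => edgeSide_not_mem hT h.adj ?_
      rw [Sym2.eq_iff] at he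
      rcases he with ⟨rfl, rfl⟩ | ⟨rfl, rfl⟩
      · exact hw
      · exact hv
    · exact h1

/-- A pair separated by `xy` has its common hyperedges inside the label of `xy`, so no edge of
`sepGraph` for this label crosses `xy`. -/
theorem mem_edgeSide_of_sepGraph (hS : IsSupport T bag) {v : α}
    (h : (sepGraph bag (bag x ∩ bag y)).Reachable x v) : v ∈ edgeSide T x y := by
  refine mem_of_reachable_of_closed h (self_mem_edgeSide T x y) fun a b ha hab => ?_
  by_contra hb
  have h1 := (sepGraph_adj.mp hab).2
  exact absurd (hS.inter_subset ha hb) h1.not_subset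

theorem exists_half_of_two_le [Fintype α] {S : Set β} (y : α)
    (h : 2 ≤ compSum (sepGraph bag S) (LinMim.sepDeg T bag S) x) :
    ∃ u z, (sepGraph bag S).Reachable x u ∧ T.Adj u z ∧ bag u ∩ bag z = S ∧
      (u = x → z ≠ y) := by
  classical
  by_cases hu : ∃ u, u ≠ x ∧ (sepGraph bag S).Reachable x u ∧ 1 ≤ LinMim.sepDeg T bag S u
  · obtain ⟨u, hne, hr, h1⟩ := hu
    obtain ⟨z, h2, h3⟩ := exists_of_sepDeg_pos h1
    exact ⟨u, z, hr, h2, h3, fun h => absurd h hne⟩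
  · push Not at hu
    have h2 : 2 ≤ LinMim.sepDeg T bag S x := by
      unfold compSum at h
      rw [Finset.sum_eq_single x] at h
      · simpa using h
      · intro v _ hv
        split_ifs with hr
        · have := hu v hv hr
          omega
        · rfl
      · simp
    obtain ⟨z, hz, hne⟩ := Set.exists_ne_of_one_lt_ncard (show 1 < Set.ncard _ from h2) y
    exact ⟨x, z, SimpleGraph.Reachable.refl _, hz.1, hz.2, fun _ => hne⟩

/-- Within a component of `sepGraph` a single slide is available. For another target, the second
token is an edge with label `S` on the side of `x`, which serves as auxiliary edge for two slides.
-/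
theorem TokenMove.exists_canPush [Fintype α] {S : Set β} {x v : α} (hT : T.IsTree)
    (hS : IsSupport T bag)
    (h : TokenMove (sepGraph bag S) {v | S ⊆ bag v} (LinMim.sepDeg T bag S) x v) :
    ∃ y, CanPush T bag x y v := by
  obtain ⟨y, hxy, rfl⟩ := exists_of_sepDeg_pos h.pos
  refine ⟨y, hxy, h.mem, ?_⟩
  rcases h.move with h1 | h1
  · exact Or.inl (mem_edgeSide_of_sepGraph hS h1)
  · right
    obtain ⟨u, z, hr, h2, h3, h4⟩ := exists_half_of_two_le y h1
    have hu := mem_edgeSide_of_sepGraph hS hr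
    refine ⟨u, z, hu, mem_edgeSide_of_adj h2 (fun he => ?_) hu, h2, h3⟩
    rw [Sym2.eq_iff] at he
    rcases he with ⟨rfl, rfl⟩ | ⟨rfl, rfl⟩
    · exact h4 rfl rfl
    · exact edgeSide_not_mem hT hxy hu

/-- No edge end can be moved down by two levels. -/
def LevelInvariant (T : SimpleGraph α) (bag : α → Set β) (h : α → ℕ) : Prop :=
  ∀ x y x', CanPush T bag x y x' → h x ≤ h x' + 1

/-- On the right-hand side the tree enters only through the numbers of edge ends with each label. So
the effect of a push on the invariant can be computed from the change of these numbers. -/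
theorem levelInvariant_iff [Fintype α] (hT : T.IsTree) (hS : IsSupport T bag) {h : α → ℕ} :
    LevelInvariant T bag h ↔ ∀ S u v,
      TokenMove (sepGraph bag S) {v | S ⊆ bag v} (LinMim.sepDeg T bag S) u v → h u ≤ h v + 1 := by
  constructor
  · intro hI S u v hm
    obtain ⟨y, hy⟩ := hm.exists_canPush hT hS
    exact hI _ _ _ hy
  · intro hI x y x' hp
    exact hI _ _ _ (hp.tokenMove hT hS)

/-- `T'` is a support in which one edge end of `T` has moved from `x` to `x'`. -/
structure IsPush (T T' : SimpleGraph α) (bag : α → Set β) (x x' : α) : Prop where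
  isTree : T'.IsTree
  isSupport : IsSupport T' bag
  vdeg : ∀ u, LinMim.vdeg T' u + (open Classical in if u = x then 1 else 0) =
    LinMim.vdeg T u + (open Classical in if u = x' then 1 else 0)
  level : ∀ h : α → ℕ, LevelInvariant T bag h → h x = h x' + 1 → LevelInvariant T' bag h

theorem CanPush.isPush_of_sepDeg [Finite α] (h : CanPush T bag x y x') (hT : T.IsTree)
    (hS : IsSupport T bag) {T' : SimpleGraph α} (hT' : T'.IsTree) (hS' : IsSupport T' bag)
    (hv : ∀ u, LinMim.vdeg T' u + (open Classical in if u = x then 1 else 0) =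
      LinMim.vdeg T u + (open Classical in if u = x' then 1 else 0))
    (h1 : ∀ u, LinMim.sepDeg T' bag (bag x ∩ bag y) u + (open Classical in if u = x then 1 else 0) =
      LinMim.sepDeg T bag (bag x ∩ bag y) u + (open Classical in if u = x' then 1 else 0))
    (h2 : ∀ S, bag x ∩ bag y ≠ S → ∀ u, LinMim.sepDeg T' bag S u = LinMim.sepDeg T bag S u) :
    IsPush T T' bag x x' := by
  have := Fintype.ofFinite α
  refine ⟨hT', hS', hv, fun f hI hf => ?_⟩
  rw [levelInvariant_iff hT hS] at hI
  rw [levelInvariant_iff hT' hS']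
  intro S
  by_cases hSS : bag x ∩ bag y = S
  · subst hSS
    exact (h.tokenMove hT hS).invariant hf (hI _) h1
  · have : LinMim.sepDeg T' bag S = LinMim.sepDeg T bag S := funext (h2 S hSS)
    rw [this]
    exact hI S

theorem CanSlide.isPush [Finite α] (h : CanSlide T bag x y x') (hT : T.IsTree)
    (hS : IsSupport T bag) : IsPush T (slideEdge T x y x') bag x x' :=
  CanPush.isPush_of_sepDeg ⟨h.adj, h.subset, Or.inl h.mem⟩ hT hS (h.isTree hT) (h.isSupport hT hS)
    (h.vdeg hT) (h.sepDeg hT hS) fun _ hne => h.sepDeg_of_ne hT hS hne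

theorem isPush_slide_slide [Finite α] (hT : T.IsTree) (hS : IsSupport T bag) (hxy : T.Adj x y)
    {v w : α} (hv : v ∈ edgeSide T x y) (hw : w ∈ edgeSide T x y) (hvw : T.Adj v w)
    (hlab : bag v ∩ bag w = bag x ∩ bag y) (hsub : bag x ∩ bag y ⊆ bag x')
    (hx' : x' ∉ edgeSide T x y) :
    IsPush T (slideEdge (slideEdge T x y v) v w x') bag x x' := by
  obtain ⟨h1, h2⟩ := canSlide_canSlide hT hxy hv hw hvw hlab hsub hx'
  have hT1 := h1.isTree hT
  have hS1 := h1.isSupport hT hS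
  refine CanPush.isPush_of_sepDeg ⟨hxy, hsub, Or.inr ⟨v, w, hv, hw, hvw, hlab⟩⟩ hT hS
    (h2.isTree hT1) (h2.isSupport hT1 hS1) (fun u => ?_) (fun u => ?_) (fun S hne u => ?_)
  · have := h1.vdeg hT u
    have := h2.vdeg hT1 u
    omega
  · have e1 := h1.sepDeg hT hS u
    have e2 := h2.sepDeg hT1 hS1 u
    rw [hlab] at e2
    omega
  · rw [h2.sepDeg_of_ne hT1 hS1 (hlab ▸ hne), h1.sepDeg_of_ne hT hS hne]

/-! ### Supports with the fewest leaves -/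

/-- Transform `H` into `T` by exchanges. Both trees are supports, so the exchanged labels agree, and
in `T` the edge `xy` can be slid from `x` to `x'` and from `y` to `y'`. Thus an end entering `Z` in
`H` is matched by an end leaving `Z`, and no exchange increases the sum over `Z`. -/
theorem sum_vdeg_le [Fintype α] (hT : T.IsTree) (hTS : IsSupport T bag) (hH : H.IsTree)
    (hHS : IsSupport H bag) (Z : Finset α)
    (hZ : ∀ x y x', CanSlide T bag x y x' → x ∈ Z → x' ∈ Z) :
    ∑ u ∈ Z, vdeg T u ≤ ∑ u ∈ Z, vdeg H u := by
  classical
  induction hk : (T.edgeSet \ H.edgeSet).ncard using Nat.strong_induction_on generalizing H with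
  | _ k ih =>
    by_cases hne : T = H
    · rw [hne]
    · obtain ⟨x, y, x', y', h1, h2, h3, h4, h5, h6, h7⟩ := exists_exchange hT hH hne
      have heq : bag x ∩ bag y = bag x' ∩ bag y' :=
        (hHS.inter_subset h5 h6).antisymm (hTS.inter_subset h3 h4)
      have hle := ih _ (hk ▸ h7) (swapEdge_isTree hH h2 h5 h6)
        (hHS.swapEdge hH h2 h5 h6 heq.symm.subset) rfl
      have hx : x ∈ Z → x' ∈ Z :=
        hZ x y x' ⟨h1, h3, heq ▸ Set.inter_subset_left⟩
      have hy : y ∈ Z → y' ∈ Z := by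
        refine hZ y x y' ⟨h1.symm, (edgeSide_compl hT h1 y').mpr h4, ?_⟩
        rw [Set.inter_comm, heq]
        exact Set.inter_subset_right
      have hnew : H.Adj x y → s(x, y) = s(x', y') := fun h => by
        obtain ⟨rfl, rfl⟩ := eq_of_adj_edgeSide hH h2 h h5 h6
        rfl
      have hsum : ∑ u ∈ Z, (vdeg (LinMim.swapEdge H x' y' x y) u +
          ((if u = x' then 1 else 0) + (if u = y' then 1 else 0))) =
          ∑ u ∈ Z, (vdeg H u + ((if u = x then 1 else 0) + (if u = y then 1 else 0))) := by
        refine Finset.sum_congr rfl fun u _ => ?_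
        have := halfCount_swapEdge (fun _ _ => True) h2 h1.ne hnew u
        simpa only [and_true, ← vdeg_eq_halfCount] using this
      simp only [Finset.sum_add_distrib, Finset.sum_ite_eq'] at hsum
      split_ifs at hsum <;> first | omega | tauto

theorem sum_vdeg_add_two [Fintype α] (hT : T.IsTree) :
    ∑ u, vdeg T u + 2 = 2 * Fintype.card α := by
  classical
  have h1 : ∀ u, vdeg T u = T.degree u := fun u => by
    rw [vdeg, ← SimpleGraph.card_neighborSet_eq_degree, Set.ncard_eq_toFinset_card',
      Set.toFinset_card]
  simp only [h1, SimpleGraph.sum_degrees_eq_twice_card_edges]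
  have := hT.card_edgeFinset
  omega

theorem one_le_vdeg [Finite α] [Nontrivial α] (hT : T.IsTree) (u : α) : 1 ≤ vdeg T u := by
  obtain ⟨v, hv⟩ := hT.connected.preconnected.exists_adj_of_nontrivial u
  exact (Set.ncard_pos (Set.toFinite _)).mpr ⟨v, hv⟩

/-- The number of leaves. -/
noncomputable def leafCount (T : SimpleGraph α) : ℕ := {u | vdeg T u ≤ 1}.ncard

/-- A set `Z` that contains all branch vertices and no leaf of `T` and is closed under slides
certifies minimality: by `sum_vdeg_le` the degree sum of `T` outside `Z` is at least that of `H`,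
and outside `Z` a vertex of `T` has degree one or two. If `T` is a path, the empty set will do. -/
theorem leafCount_le [Fintype α] (hT : T.IsTree) (hTS : IsSupport T bag) (hH : H.IsTree)
    (hHS : IsSupport H bag) {h : α → ℕ} {N : ℕ} (hN : Fintype.card α ≤ N)
    (hI : LevelInvariant T bag h) (hleaf : ∀ u, vdeg T u ≤ 1 → h u = 0)
    (hbranch : ∀ u, 3 ≤ vdeg T u → h u = N + 1) : leafCount T ≤ leafCount H := by
  classical
  rcases subsingleton_or_nontrivial α with hα | hα
  · rw [Subsingleton.elim T H]
  have hZ : ∃ Z : Finset α, (∀ u ∈ Z, 2 ≤ vdeg T u) ∧ (∀ u ∉ Z, vdeg T u ≤ 2) ∧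
      ∀ x y x', CanSlide T bag x y x' → x ∈ Z → x' ∈ Z := by
    by_cases hex : ∃ u, 3 ≤ vdeg T u
    · obtain ⟨u₀, hu₀⟩ := hex
      -- A branch vertex has height `N + 1`, and the at most `N - 1` other vertices cannot fill all
      -- `N` levels in between.
      have hgap : ∃ j ∈ Finset.Icc 1 N, j ∉ (Finset.univ.erase u₀).image h := by
        by_contra hcon
        push Not at hcon
        have h1 := Finset.card_le_card (show Finset.Icc 1 N ⊆ _ from hcon)
        have h2 := Finset.card_image_le (s := Finset.univ.erase u₀) (f := h)
        rw [Finset.card_erase_of_mem (Finset.mem_univ _), Finset.card_univ] at h2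
        rw [Nat.card_Icc] at h1
        have := Fintype.card_pos (α := α)
        omega
      obtain ⟨j, hj, hjh⟩ := hgap
      rw [Finset.mem_Icc] at hj
      have hj' : ∀ u, h u ≠ j := by
        intro u hu
        by_cases hu' : u = u₀
        · have := hbranch u₀ hu₀
          subst hu'
          omega
        · exact hjh (Finset.mem_image.mpr ⟨u, by simp [hu'], hu⟩)
      refine ⟨Finset.univ.filter fun u => j < h u, ?_, ?_, ?_⟩
      · intro u hu
        rw [Finset.mem_filter] at hu
        by_contra hc
        have := hleaf u (by omega)
        omega
      · intro u hu
        rw [Finset.mem_filter] at hu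
        by_contra hc
        have := hbranch u (by omega)
        exact hu ⟨Finset.mem_univ _, by omega⟩
      -- A slide goes down by at most one level and cannot end on the empty level `j`, so it stays
      -- above `j`.
      · intro x y x' hs hx
        rw [Finset.mem_filter] at hx ⊢
        have h1 := hI x y x' ⟨hs.adj, hs.subset, Or.inl hs.mem⟩
        have h2 := hj' x'
        exact ⟨Finset.mem_univ _, by omega⟩
    · push Not at hex
      exact ⟨∅, by simp, fun u _ => by have := hex u; omega, by simp⟩
  obtain ⟨Z, hZ1, hZ2, hZ3⟩ := hZ
  have hle := sum_vdeg_le hT hTS hH hHS Z hZ3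
  have hcount : ∀ K : SimpleGraph α, leafCount K = ∑ u, if vdeg K u ≤ 1 then 1 else 0 := by
    intro K
    rw [leafCount, Finset.sum_boole, Nat.cast_id, Set.ncard_eq_toFinset_card', Set.toFinset_ofPred]
  rw [hcount, hcount]
  have e1 := sum_vdeg_add_two hT
  have e2 := sum_vdeg_add_two hH
  rw [← Finset.sum_add_sum_compl Z] at e1 e2
  have h1 : ∑ u ∈ Z, (if vdeg T u ≤ 1 then 1 else 0) = 0 :=
    Finset.sum_eq_zero fun u hu => by
      have := hZ1 u hu
      rw [if_neg (by omega)]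
  -- Outside `Z`, leaf indicator plus degree is exactly `2` in `T`; in any tree with at least two
  -- vertices it is at least `2`.
  have h2 : ∑ u ∈ Zᶜ, ((if vdeg T u ≤ 1 then 1 else 0) + vdeg T u) = ∑ u ∈ Zᶜ, 2 :=
    Finset.sum_congr rfl fun u hu => by
      have := hZ2 u (Finset.mem_compl.mp hu)
      have := one_le_vdeg hT u
      split_ifs <;> omega
  have h3 : ∑ u ∈ Zᶜ, 2 ≤ ∑ u ∈ Zᶜ, ((if vdeg H u ≤ 1 then 1 else 0) + vdeg H u) :=
    Finset.sum_le_sum fun u _ => by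
      have := one_le_vdeg hH u
      split_ifs <;> omega
  rw [Finset.sum_add_distrib] at h2 h3
  rw [← Finset.sum_add_sum_compl Z, ← Finset.sum_add_sum_compl Z (fun u => if vdeg H u ≤ 1 then 1 else 0)]
  omega

end Slides

/-! ### Elimination orders and cuts -/

section Orders

variable {V : Type*} {G : SimpleGraph V} {A : Set V} {T : SimpleGraph A} {pos : V → ℕ}

/-- The vertices of `A` are eliminated along the tree `T`, so that the remaining vertices induce a
connected subgraph of `T`; each `b ∉ A` is placed as soon as all its neighbours are placed. -/
structure IsEliminationOrder (G : SimpleGraph V) (A : Set V) (T : SimpleGraph A) (pos : V → ℕ) :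
    Prop where
  inj : Function.Injective pos
  before : ∀ b ∉ A, ∀ a, G.Adj b a → pos a < pos b
  up : ∀ a : A, {z : A | T.Adj a z ∧ pos a < pos z}.Subsingleton
  ready : ∀ a ∈ A, ∀ b ∉ A, (∀ z, G.Adj b z → pos z < pos a) → pos b < pos a

/-- One step upwards in the tree. -/
def UpStep (T : SimpleGraph A) (pos : V → ℕ) (u v : A) : Prop := T.Adj u v ∧ pos u < pos v

/-- Descend as long as possible. A vertex without lower neighbours has only its upper neighbour, of
which there is at most one. -/
theorem exists_leaf_below [Finite V] (hpos : IsEliminationOrder G A T pos) (a : A) :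
    ∃ l, vdeg T l ≤ 1 ∧ Relation.ReflTransGen (UpStep T pos) l a := by
  induction hk : pos a using Nat.strong_induction_on generalizing a with
  | _ k ih =>
    by_cases h : ∃ z, T.Adj a z ∧ pos z < pos a
    · obtain ⟨z, hz, hlt⟩ := h
      obtain ⟨l, h1, h2⟩ := ih _ (hk ▸ hlt) z rfl
      exact ⟨l, h1, h2.tail ⟨hz.symm, hlt⟩⟩
    · push Not at h
      refine ⟨a, ?_, Relation.ReflTransGen.refl⟩
      have hsub : T.neighborSet a ⊆ {z : A | T.Adj a z ∧ pos a < pos z} := fun z hz =>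
        ⟨hz, lt_of_le_of_ne (h z hz) fun he => hz.ne (Subtype.ext (hpos.inj he))⟩
      exact Set.ncard_le_one_iff_subsingleton.mpr ((hpos.up a).anti hsub)

theorem one_le_leafCount [Finite V] (hpos : IsEliminationOrder G A T pos) (hA : A.Nonempty) :
    1 ≤ leafCount T := by
  obtain ⟨l, hl, -⟩ := exists_leaf_below hpos ⟨_, hA.some_mem⟩
  exact (Set.ncard_pos (Set.toFinite _)).mpr ⟨l, hl⟩

theorem upStep_le {u v : A} (h : Relation.ReflTransGen (UpStep T pos) u v) : pos u ≤ pos v := by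
  induction h with
  | refl => exact le_rfl
  | tail _ h ih => exact ih.trans h.2.le

/-- The neighbourhood of `b` is connected and contains `a'`, which lies strictly below `a`. As each
vertex has at most one upper neighbour, one can leave the part strictly below `a` only through `a`,
which is not a neighbour of `b`. -/
theorem lt_of_adj_of_below (hpos : IsEliminationOrder G A T pos)
    (hS : IsSupport T fun a : A => G.neighborSet a) {a a' : A} {b : V}
    (h : Relation.ReflTransGen (UpStep T pos) a' a) (hadj : G.Adj a' b)
    (hnadj : ¬ G.Adj a b) : ∀ z : A, G.Adj z b → pos z < pos a := by
  have key : ∀ z : A, G.Adj z b → Relation.ReflTransGen (UpStep T pos) z a ∧ z ≠ a := by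
    intro z hz
    refine mem_of_reachable_of_closed
      (S := {z | Relation.ReflTransGen (UpStep T pos) z a ∧ z ≠ a}) (hS b a' z hadj hz)
      ⟨h, fun he => hnadj (he ▸ hadj)⟩ ?_
    rintro c d ⟨hc, hca⟩ ⟨hcd, -, hd⟩
    refine ⟨?_, fun he => hnadj (he ▸ hd)⟩
    rcases lt_or_gt_of_ne (fun he => hcd.ne (Subtype.ext (hpos.inj he))) with hlt | hlt
    · rcases Relation.ReflTransGen.cases_head hc with rfl | ⟨e, he, hea⟩
      · exact absurd rfl hca
      · rwa [hpos.up c ⟨hcd, hlt⟩ he]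
    · exact Relation.ReflTransGen.head ⟨hcd.symm, hlt⟩ hc
  intro z hz
  obtain ⟨h1, h2⟩ := key z hz
  exact lt_of_le_of_ne (upStep_le h1) fun he => h2 (Subtype.ext (hpos.inj he))

/-- Every prefix of an elimination order is a cut of small mim-value. -/
theorem cutmim_prefix_le [Finite V] (hG : G.IsBipartiteWith A Aᶜ)
    (hpos : IsEliminationOrder G A T pos) (hS : IsSupport T fun a : A => G.neighborSet a) (i : ℕ) :
    cutmim G {v | pos v < i} ≤ leafCount T := by
  refine iSup₂_le fun M hM => ?_
  have hex : ∀ e : M, ∃ (a : A) (b : V), e.1 = s(a.1, b) ∧ b ∉ A ∧ pos a < i ∧ i ≤ pos b ∧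
      G.Adj a b := by
    rintro ⟨e, he⟩
    have hadj := hM.1 he
    induction e with | _ u v
    rw [SimpleGraph.mem_edgeSet, SimpleGraph.between_adj] at hadj
    simp only [Set.mem_compl_iff, Set.mem_ofPred_eq, not_lt] at hadj
    obtain ⟨hadj, hcut⟩ := hadj
    have hor : (u ∈ A ∧ v ∉ A) ∨ (u ∉ A ∧ v ∈ A) := hG.mem_of_adj hadj
    rcases hor with ⟨hu, hv⟩ | ⟨hu, hv⟩
    · have := hpos.before v hv u hadj.symm
      exact ⟨⟨u, hu⟩, v, rfl, hv, by simp only; omega, by omega, hadj⟩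
    · have := hpos.before u hu v hadj
      exact ⟨⟨v, hv⟩, u, Sym2.eq_swap, hu, by simp only; omega, by omega, hadj.symm⟩
  choose a b he hb hai hbi hadj using hex
  have hnot : ∀ e f : M, e ≠ f → ¬ G.Adj (a e) (b f) := by
    intro e f hne hc
    refine (hM.2 e e.2 f f.2 (fun h => hne (Subtype.ext h)) (a e) (by rw [he e]; simp) (b f)
      (by rw [he f]; simp)).2 ?_
    rw [SimpleGraph.between_adj]
    exact ⟨hc, Or.inl ⟨hai e, by simpa using hbi f⟩⟩
  choose l hl hla using fun e : M => exists_leaf_below hpos (a e)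
  have hkey : ∀ e f : M, e ≠ f → ¬ Relation.ReflTransGen (UpStep T pos) (a f) (a e) := by
    intro e f hne hc
    have h1 := lt_of_adj_of_below hpos hS hc (hadj f) (hnot e f hne)
    have h2 := hpos.ready (a e) (a e).2 (b f) (hb f) (fun z hz => by
      have hzA : z ∈ A := by
        rcases hG.mem_of_adj hz with ⟨h, -⟩ | ⟨-, h⟩
        · exact absurd h (hb f)
        · exact h
      exact h1 ⟨z, hzA⟩ hz.symm)
    have := hai e
    have := hbi f
    omega
  -- Upward chains from a common leaf are comparable, because each vertex has at most one upper
  -- neighbour.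
  have hinj : Function.Injective l := by
    intro e f hef
    by_contra hne
    have hru : Relator.RightUnique (UpStep T pos) := fun u v w h1 h2 => hpos.up u h1 h2
    have := Relation.ReflTransGen.total_of_right_unique hru (hla e) (hef ▸ hla f)
    rcases this with h | h
    · exact hkey f e (Ne.symm hne) h
    · exact hkey e f hne h
  have hfin : M.Finite := Set.toFinite _
  have := Set.ncard_le_ncard (show Set.range l ⊆ {u | vdeg T u ≤ 1} from by
    rintro _ ⟨e, rfl⟩
    exact hl e) (Set.toFinite _)
  rw [← hfin.cast_ncard_eq]
  refine Nat.cast_le.mpr (le_trans (le_of_eq ?_) this)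
  rw [← Set.image_univ, Set.ncard_image_of_injective _ hinj, Set.ncard_univ]
  rfl

theorem cutmim_compl (G : SimpleGraph V) (X : Set V) : cutmim G Xᶜ = cutmim G X := by
  unfold cutmim
  rw [compl_compl, SimpleGraph.between_comm]

theorem cutmim_subsingleton_le (G : SimpleGraph V) {X : Set V} (hX : X.Subsingleton) :
    cutmim G X ≤ 1 := by
  refine iSup₂_le fun M hM => Set.encard_le_one_iff.mpr fun e f he hf => ?_
  have hmem : ∀ e ∈ M, ∃ v ∈ X, v ∈ e := by
    intro e he
    have hadj := hM.1 he
    induction e with | _ u v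
    rw [SimpleGraph.mem_edgeSet, SimpleGraph.between_adj] at hadj
    rcases hadj.2 with h | h
    · exact ⟨u, h.1, by simp⟩
    · exact ⟨v, h.2, by simp⟩
  by_contra hne
  obtain ⟨u, hu, hue⟩ := hmem e he
  obtain ⟨v, hv, hvf⟩ := hmem f hf
  exact (hM.2 e he f hf hne u hue v hvf).1 (hX hu hv)

end Orders

/-! ### Trees given by parents -/

/-- The graph on `Fin m` in which every vertex other than the last is joined to its parent. -/
def parentGraph (m : ℕ) (par : ℕ → ℕ) : SimpleGraph (Fin m) where
  Adj x y := x ≠ y ∧ ((x.1 + 1 < m ∧ par x = y) ∨ (y.1 + 1 < m ∧ par y = x))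
  symm := ⟨fun _ _ h => ⟨h.1.symm, h.2.symm⟩⟩
  loopless := ⟨fun _ h => h.1 rfl⟩

/-- Parents are larger, so every vertex leads up to the last one, and the `m - 1` edges to the
parents are distinct. -/
theorem parentGraph_isTree {m : ℕ} {par : ℕ → ℕ} (hm : 1 ≤ m)
    (hpar : ∀ x, x + 1 < m → x < par x ∧ par x < m) : (parentGraph m par).IsTree := by
  rw [SimpleGraph.isTree_iff_connected_and_card]
  have hadj : ∀ x (hx : x + 1 < m),
      (parentGraph m par).Adj ⟨x, by omega⟩ ⟨par x, (hpar x hx).2⟩ := by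
    intro x hx
    refine ⟨fun h => ?_, Or.inl ⟨hx, rfl⟩⟩
    have := (hpar x hx).1
    rw [Fin.mk.injEq] at h
    omega
  constructor
  · have hroot : ∀ k (x : Fin m), m - 1 - x.1 = k →
        (parentGraph m par).Reachable x ⟨m - 1, by omega⟩ := by
      intro k
      induction k using Nat.strong_induction_on with
      | _ k ih =>
        intro x hx
        by_cases h : x.1 + 1 < m
        · have h1 := hpar x.1 h
          exact (hadj x.1 h).reachable.trans (ih _ (by simp only; omega) ⟨par x.1, h1.2⟩ rfl)
        · have : x = ⟨m - 1, by omega⟩ := Fin.ext (by simp only; omega)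
          rw [this]
    have : Nonempty (Fin m) := ⟨⟨0, by omega⟩⟩
    exact ⟨fun x y => (hroot _ x rfl).trans (hroot _ y rfl).symm⟩
  · have hE : (parentGraph m par).edgeSet =
        Set.range fun x : Fin (m - 1) =>
          s((⟨x.1, by omega⟩ : Fin m), ⟨par x.1, (hpar x.1 (by omega)).2⟩) := by
      ext e
      induction e with | _ x y
      rw [SimpleGraph.mem_edgeSet, Set.mem_range]
      constructor
      · rintro ⟨-, ⟨h1, h2⟩ | ⟨h1, h2⟩⟩
        · exact ⟨⟨x.1, by omega⟩, by simp [h2]⟩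
        · refine ⟨⟨y.1, by omega⟩, ?_⟩
          rw [Sym2.eq_swap]
          simp [h2]
      · rintro ⟨z, hz⟩
        rw [← SimpleGraph.mem_edgeSet, ← hz]
        exact hadj z.1 (by omega)
    rw [hE, Nat.card_range_of_injective, Nat.card_fin, Nat.card_fin]
    · omega
    · intro x y hxy
      have hx := hpar x.1 (by omega)
      have hy := hpar y.1 (by omega)
      simp only [Sym2.eq_iff, Fin.mk.injEq] at hxy
      exact Fin.ext (by omega)

/-- A set that is left only through the edge `xy` is the whole side of `x`. This identifies the cuts
of the caterpillar. -/
theorem mem_edgeSide_iff_of_closed {m : ℕ} {T : SimpleGraph (Fin m)} (hT : T.IsTree)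
    {x y : Fin m} (hxy : T.Adj x y) {S : Set (Fin m)} (hx : x ∈ S) (hy : y ∉ S)
    (hS : ∀ u v, T.Adj u v → u ∈ S → v ∉ S → u = x ∧ v = y) (w : Fin m) :
    w ∈ edgeSide T x y ↔ w ∈ S := by
  constructor
  · intro h
    refine mem_of_reachable_of_closed h hx fun a b ha hab => ?_
    by_contra hb
    rw [SimpleGraph.deleteEdges_adj] at hab
    obtain ⟨rfl, rfl⟩ := hS a b hab.1 ha hb
    exact hab.2 rfl
  · intro h
    by_contra hc
    have h1 := (edgeSide_compl hT hxy w).mpr hc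
    refine absurd h (mem_of_reachable_of_closed (S := Sᶜ) h1 hy fun a b ha hab => ?_)
    intro hb
    rw [SimpleGraph.deleteEdges_adj] at hab
    obtain ⟨rfl, rfl⟩ := hS b a hab.1.symm hb ha
    exact hab.2 rfl

/-! ### Caterpillars -/

/-- The parent of a vertex of the caterpillar with leaves `0, …, n - 1` and spine
`n, …, 2 * n - 1`. -/
def catParent (n x : ℕ) : ℕ := if x < n then n + x else x + 1

/-- The number of vertices of the caterpillar. -/
def catOrder (n : ℕ) : ℕ := 2 * n - (2 - n)

/-- The caterpillar with leaves `0, …, n - 1`; it has no spine if `n = 1`. -/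
def caterpillar (n : ℕ) : SimpleGraph (Fin (catOrder n)) := parentGraph (catOrder n) (catParent n)

/-- The number `2 * n - (2 - n)` equals `2 * n` for `n ≥ 2`, but `1` for `n = 1`, where a spine
vertex would be a second leaf, and `0` for `n = 0`. -/
theorem catParent_bound (n x : ℕ) (h : x + 1 < catOrder n) :
    x < catParent n x ∧ catParent n x < catOrder n := by
  unfold catOrder at *
  unfold catParent
  split_ifs <;> omega

theorem one_le_catOrder {n : ℕ} (hn : 1 ≤ n) : 1 ≤ catOrder n := by
  unfold catOrder
  omega

theorem caterpillar_isTree {n : ℕ} (hn : 1 ≤ n) : (caterpillar n).IsTree :=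
  parentGraph_isTree (one_le_catOrder hn) (catParent_bound n)

theorem caterpillar_adj {n : ℕ} (x y : Fin (catOrder n)) :
    (caterpillar n).Adj x y ↔
      (x.1 < n ∧ y.1 = n + x) ∨ (n ≤ x.1 ∧ y.1 = x + 1) ∨
      (y.1 < n ∧ x.1 = n + y) ∨ (n ≤ y.1 ∧ x.1 = y + 1) := by
  have hx := x.2
  have hy := y.2
  have hm : catOrder n = 2 * n - (2 - n) := rfl
  change (x ≠ y ∧ ((x.1 + 1 < catOrder n ∧ catParent n x = y) ∨
    (y.1 + 1 < catOrder n ∧ catParent n y = x))) ↔ _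
  rw [Ne, Fin.ext_iff, catParent, catParent]
  split_ifs <;> omega

/-- The spine up to `z` together with its leaves is a set that can be left only at `z`. -/
theorem spine_mem_support {n : ℕ} {x y : Fin (catOrder n)} (hx : x.1 = n)
    (hy : y.1 + 1 = catOrder n) (p : (caterpillar n).Walk x y) (z : Fin (catOrder n))
    (hz : n ≤ z.1) : z ∈ p.support := by
  have hm : catOrder n = 2 * n - (2 - n) := rfl
  have hz2 := z.2
  by_cases hz' : z.1 + 1 < catOrder n
  · obtain ⟨d, hd, h1, h2⟩ := p.exists_boundary_dart
      {w | w.1 ≤ z.1 ∧ (w.1 < n → n + w.1 ≤ z.1)} (by constructor <;> omega)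
      (by simp only [Set.mem_ofPred_eq]; omega)
    have hadj := (caterpillar_adj _ _).mp d.adj
    simp only [Set.mem_ofPred_eq] at h1 h2
    have : d.fst = z := Fin.ext (by omega)
    rw [← this]
    exact p.dart_fst_mem_support_of_mem_darts hd
  · have : z = y := Fin.ext (by omega)
    rw [this]
    exact p.end_mem_support

theorem caterpillar_isCaterpillar {n : ℕ} (hn : 1 ≤ n) : IsCaterpillar (caterpillar n) := by
  have hT := caterpillar_isTree hn
  have hm : catOrder n = 2 * n - (2 - n) := rfl
  refine ⟨hT, ?_⟩
  by_cases h1 : n = 1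
  · subst h1
    exact ⟨⟨0, by omega⟩, ⟨0, by omega⟩, SimpleGraph.Walk.nil, SimpleGraph.Walk.IsPath.nil,
      fun w hw => absurd (by simp only [SimpleGraph.Walk.support_nil, List.mem_singleton, Fin.ext_iff]; have := w.2; omega) hw⟩
  · obtain ⟨p, hp⟩ := (hT.connected.preconnected ⟨n, by omega⟩
      ⟨catOrder n - 1, by omega⟩).exists_isPath
    have key := spine_mem_support rfl (by simp only; omega) p
    refine ⟨_, _, p, hp, fun w hw => ?_⟩
    have hwn : w.1 < n := by
      by_contra hc
      exact hw (key w (by omega))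
    refine ⟨⟨n + w.1, by omega⟩, key _ (by simp), ?_⟩
    rw [caterpillar_adj]
    exact Or.inl ⟨hwn, rfl⟩

theorem caterpillar_subcubic {n : ℕ} (w : Fin (catOrder n)) :
    ((caterpillar n).neighborSet w).encard ≤ 3 := by
  have hsub : ((caterpillar n).neighborSet w) ⊆
      Fin.val ⁻¹' (if w.1 < n then {n + w.1, n + w.1, n + w.1} else
        {w.1 - n, w.1 - 1, w.1 + 1} : Set ℕ) := by
    intro z hz
    have := (caterpillar_adj _ _).mp hz
    split_ifs
    · simp only [Set.mem_preimage, Set.mem_insert_iff, Set.mem_singleton_iff]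
      omega
    · simp only [Set.mem_preimage, Set.mem_insert_iff, Set.mem_singleton_iff]
      omega
  have h3 : ∀ a b c : ℕ, ({a, b, c} : Set ℕ).encard ≤ 3 := by
    intro a b c
    have h1 := Set.encard_insert_le {b, c} a
    have h2 := Set.encard_insert_le {c} b
    rw [Set.encard_singleton] at h2
    calc _ ≤ _ := h1
      _ ≤ (1 + 1) + 1 := by gcongr
      _ = 3 := by norm_num
  rw [← Fin.val_injective.encard_image]
  refine (Set.encard_le_encard (Set.image_subset_iff.mpr hsub)).trans ?_
  split_ifs <;> exact h3 _ _ _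

theorem caterpillar_leaf_iff {n : ℕ} (w : Fin (catOrder n)) :
    ((caterpillar n).neighborSet w).encard ≤ 1 ↔ w.1 < n := by
  have hm : catOrder n = 2 * n - (2 - n) := rfl
  have hw := w.2
  rw [Set.encard_le_one_iff]
  constructor
  · intro h
    by_contra hc
    have h1 : (⟨w.1 - n, by omega⟩ : Fin (catOrder n)) ∈ (caterpillar n).neighborSet w := by
      rw [SimpleGraph.mem_neighborSet, caterpillar_adj]
      simp only
      omega
    by_cases h2 : w.1 + 1 < catOrder n
    · have h3 : (⟨w.1 + 1, h2⟩ : Fin (catOrder n)) ∈ (caterpillar n).neighborSet w := by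
        rw [SimpleGraph.mem_neighborSet, caterpillar_adj]
        exact Or.inr (Or.inl ⟨by omega, rfl⟩)
      have := h _ _ h1 h3
      rw [Fin.mk.injEq] at this
      omega
    · have h3 : (⟨w.1 - 1, by omega⟩ : Fin (catOrder n)) ∈ (caterpillar n).neighborSet w := by
        rw [SimpleGraph.mem_neighborSet, caterpillar_adj]
        simp only
        omega
      have := h _ _ h1 h3
      rw [Fin.mk.injEq] at this
      omega
  · intro h a b ha hb
    rw [SimpleGraph.mem_neighborSet, caterpillar_adj] at ha hb
    exact Fin.ext (by omega)

/-! ### The decomposition given by an elimination order -/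

section Decomposition

variable {V : Type*} {G : SimpleGraph V} {A : Set V} {T : SimpleGraph A} {pos : V → ℕ} {n : ℕ}
  {δ : V → Fin (catOrder n)}

theorem caterpillar_isLinearBranchDecomposition (hn : 1 ≤ n)
    (hbij : Set.BijOn pos Set.univ (Set.Iio n)) (hδ : ∀ v, (δ v : ℕ) = pos v) :
    IsLinearBranchDecomposition (caterpillar n) δ := by
  refine ⟨⟨caterpillar_isTree hn, caterpillar_subcubic, ?_, ?_, ?_⟩, caterpillar_isCaterpillar hn⟩
  · intro v _
    rw [Set.mem_ofPred_eq, caterpillar_leaf_iff, hδ]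
    exact hbij.mapsTo (Set.mem_univ v)
  · intro u hu v hv huv
    apply hbij.injOn hu hv
    rw [← hδ, ← hδ, huv]
  · intro w hw
    rw [Set.mem_ofPred_eq, caterpillar_leaf_iff] at hw
    obtain ⟨v, hv, hvw⟩ := hbij.surjOn hw
    exact ⟨v, hv, Fin.ext (by rw [hδ, hvw])⟩

theorem cutmim_side_le [Finite V] (hn : 1 ≤ n) (hG : G.IsBipartiteWith A Aᶜ)
    (hpos : IsEliminationOrder G A T pos) (hS : IsSupport T fun a : A => G.neighborSet a)
    (hA : A.Nonempty) (hδ : ∀ v, (δ v : ℕ) = pos v) (hlt : ∀ v, pos v < n)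
    {x y : Fin (catOrder n)} (hxy : (caterpillar n).Adj x y) (hlt' : x.1 < y.1) :
    cutmim G (side (caterpillar n) δ x y) ≤ leafCount T := by
  have hT := caterpillar_isTree hn
  have hadj := (caterpillar_adj _ _).mp hxy
  by_cases hx : x.1 < n
  · refine (cutmim_subsingleton_le G ?_).trans (Nat.one_le_cast.mpr (one_le_leafCount hpos hA))
    have key := mem_edgeSide_iff_of_closed hT hxy (S := {x}) rfl (fun h => hxy.ne h.symm) (by
      intro u v huv hu hv
      rw [Set.mem_singleton_iff] at hu
      subst hu
      have := (caterpillar_adj _ _).mp huv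
      exact ⟨rfl, Fin.ext (by omega)⟩)
    intro u hu v hv
    have h1 : δ u = x := (key _).mp hu
    have h2 : δ v = x := (key _).mp hv
    apply hpos.inj
    rw [← hδ, ← hδ, h1, h2]
  · have key := mem_edgeSide_iff_of_closed hT hxy
      (S := {w | w.1 ≤ x.1 ∧ (w.1 < n → n + w.1 ≤ x.1)})
      (by constructor <;> omega) (by simp only [Set.mem_ofPred_eq]; omega) (by
      intro u v huv hu hv
      have := (caterpillar_adj _ _).mp huv
      simp only [Set.mem_ofPred_eq] at hu hv
      exact ⟨Fin.ext (by omega), Fin.ext (by omega)⟩)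
    -- The spine vertex `x` is number `x - n`, so its side consists of the leaves in positions `0,
    -- …, x - n`.
    have heq : side (caterpillar n) δ x y = {v | pos v < x.1 - n + 1} := by
      ext v
      refine (key (δ v)).trans ?_
      have := hlt v
      simp only [Set.mem_ofPred_eq, hδ]
      omega
    rw [heq]
    exact cutmim_prefix_le hG hpos hS _

theorem caterpillar_mimWidth_le [Finite V] (hn : 1 ≤ n) (hG : G.IsBipartiteWith A Aᶜ)
    (hpos : IsEliminationOrder G A T pos) (hS : IsSupport T fun a : A => G.neighborSet a)
    (hA : A.Nonempty) (hδ : ∀ v, (δ v : ℕ) = pos v) (hlt : ∀ v, pos v < n) :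
    decompositionMimWidth G (caterpillar n) δ ≤ leafCount T := by
  refine iSup_le fun x => iSup₂_le fun y hxy => ?_
  rcases lt_or_gt_of_ne (fun h => hxy.ne (Fin.ext h)) with h | h
  · exact cutmim_side_le hn hG hpos hS hA hδ hlt hxy h
  · have : side (caterpillar n) δ x y = (side (caterpillar n) δ y x)ᶜ := by
      ext v
      exact edgeSide_compl (caterpillar_isTree hn) hxy.symm (δ v)
    rw [this, cutmim_compl]
    exact cutmim_side_le hn hG hpos hS hA hδ hlt hxy.symm h

end Decomposition

/-! ### Supports from tree convexity -/

/-- Leaf indicator plus degree is at most `2`, and at most `2 + (Δ - 2)` for a branch vertex.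
Summing over all vertices and subtracting the degree sum `2 * |A| - 2` gives the bound. -/
theorem IsTDTree.leafCount_le {α : Type*} [Finite α] {t Δ : ℕ} {H : SimpleGraph α}
    (h : IsTDTree t Δ H) : leafCount H ≤ 2 + t * (Δ - 2) := by
  classical
  have := Fintype.ofFinite α
  have hcast : ∀ w, (H.neighborSet w).encard = vdeg H w := fun w =>
    ((Set.toFinite _).cast_ncard_eq).symm
  have hcount : leafCount H = ∑ u, if vdeg H u ≤ 1 then 1 else 0 := by
    rw [leafCount, Finset.sum_boole, Nat.cast_id, Set.ncard_eq_toFinset_card', Set.toFinset_ofPred]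
  rcases subsingleton_or_nontrivial α with hα | hα
  · have : leafCount H ≤ 1 := Set.ncard_le_one_of_subsingleton _
    omega
  have h1 : ∑ u, ((if vdeg H u ≤ 1 then 1 else 0) + vdeg H u) ≤
      ∑ u, (2 + if 3 ≤ vdeg H u then Δ - 2 else 0) := by
    refine Finset.sum_le_sum fun u _ => ?_
    have h2 := h.degree_le u
    rw [hcast, Nat.cast_le] at h2
    have := one_le_vdeg h.isTree u
    split_ifs <;> omega
  have h2 := sum_vdeg_add_two h.isTree
  have h3 : (Finset.univ.filter fun u => 3 ≤ vdeg H u).card ≤ t := by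
    have h4 := h.branch_le
    have h5 : {w | 3 ≤ (H.neighborSet w).encard} = {w | 3 ≤ vdeg H w} := by
      ext w
      rw [Set.mem_ofPred_eq, Set.mem_ofPred_eq, hcast]
      exact_mod_cast Iff.rfl
    rw [h5, ← (Set.toFinite _).cast_ncard_eq, Nat.cast_le, Set.ncard_eq_toFinset_card',
      Set.toFinset_ofPred] at h4
    exact h4
  rw [Finset.sum_add_distrib, Finset.sum_add_distrib, ← Finset.sum_filter, ← Finset.sum_filter,
    Finset.sum_const, Finset.sum_const, Finset.sum_const, Finset.card_univ] at h1
  rw [hcount, ← Finset.sum_filter, Finset.sum_const]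
  simp only [smul_eq_mul] at *
  have := Nat.mul_le_mul_right (Δ - 2) h3
  omega

theorem isSupport_of_preconnected {V : Type*} {G : SimpleGraph V} {A : Set V} {H : SimpleGraph A}
    (hG : G.IsBipartiteWith A Aᶜ)
    (h : ∀ b ∈ Aᶜ, (H.induce {a : A | G.Adj b a}).Preconnected) :
    IsSupport H fun a : A => G.neighborSet a := by
  intro b u v hu hv
  have hb : b ∈ Aᶜ := by
    rcases hG.mem_of_adj hu with h | h
    · exact h.2
    · exact absurd u.2 h.1
  have := h b hb ⟨u, SimpleGraph.Adj.symm hu⟩ ⟨v, SimpleGraph.Adj.symm hv⟩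
  let f : H.induce {a : A | G.Adj b a} →g restrictTo H {a | b ∈ G.neighborSet a} :=
    ⟨fun a => a.1, fun {c d} hcd => ⟨hcd, SimpleGraph.Adj.symm c.2, SimpleGraph.Adj.symm d.2⟩⟩
  exact this.map f

/-! ### Programs with bounded loops -/

/-- Store `v` in cell `i` of array `a`. -/
def setCell (s : Memory) (a i v : ℕ) : Memory := Function.update s a (Function.update (s a) i v)

theorem setCell_of_ne {s : Memory} {a i v b : ℕ} (h : b ≠ a) : setCell s a i v b = s b := by
  simp [setCell, h]

theorem setCell_self (s : Memory) (a i v : ℕ) : setCell s a i v a i = v := by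
  simp [setCell]

theorem setCell_apply (s : Memory) (a i v j : ℕ) :
    setCell s a i v a j = if j = i then v else s a j := by
  simp [setCell, Function.update_apply]

/-! ### Conditions as expressions -/

namespace Expr

/-- The arrays read by an expression. -/
def reads : Expr → List ℕ
  | const _ => []
  | read a i => a :: i.reads
  | add e f => e.reads ++ f.reads
  | sub e f => e.reads ++ f.reads

theorem eval_congr (e : Expr) {s s' : Memory} (h : ∀ a ∈ e.reads, s a = s' a) :
    e.eval s = e.eval s' := by
  induction e with
  | const c => rfl
  | read a i ih =>
    have h1 := ih fun b hb => h b (List.mem_cons_of_mem _ hb)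
    simp only [eval, h1, h a List.mem_cons_self]
  | add e f ih1 ih2 =>
    simp only [eval, ih1 fun b hb => h b (List.mem_append_left _ hb),
      ih2 fun b hb => h b (List.mem_append_right _ hb)]
  | sub e f ih1 ih2 =>
    simp only [eval, ih1 fun b hb => h b (List.mem_append_left _ hb),
      ih2 fun b hb => h b (List.mem_append_right _ hb)]

/-- The scalar variable stored in cell `0` of array `x`. -/
def var (x : ℕ) : Expr := read x (const 0)

/-- Entry `(x, y)` of the matrix stored in array `a`; array `7` holds the multiples of `n`. -/
def entry (a x y : ℕ) : Expr := read a (add (read 7 (var x)) (var y))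

/-- Negation. -/
def not (e : Expr) : Expr := sub (const 1) e

/-- Conjunction. -/
def and (e f : Expr) : Expr := not (add (not e) (not f))

/-- The comparison `e < f`. -/
def lt (e f : Expr) : Expr := sub f e

/-- Equality. -/
def eq (e f : Expr) : Expr := not (add (sub e f) (sub f e))

variable (s : Memory)

theorem eval_const (c : ℕ) : (const c).eval s = c := rfl

theorem eval_add (e f : Expr) : (add e f).eval s = e.eval s + f.eval s := rfl

theorem eval_read (a : ℕ) (e : Expr) : (read a e).eval s = s a (e.eval s) := rfl

theorem eval_var (x : ℕ) : (var x).eval s = s x 0 := rfl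

theorem eval_entry (a x y : ℕ) : (entry a x y).eval s = s a (s 7 (s x 0) + s y 0) := rfl

/-- Truth is expressed by `≠ 0` throughout, since `lt` yields a difference and not a value `0` or
`1`. -/
theorem eval_not (e : Expr) : (not e).eval s ≠ 0 ↔ ¬ e.eval s ≠ 0 := by
  simp only [not, eval]
  omega

theorem eval_and (e f : Expr) : (and e f).eval s ≠ 0 ↔ e.eval s ≠ 0 ∧ f.eval s ≠ 0 := by
  simp only [and, not, eval]
  omega

theorem eval_lt (e f : Expr) : (lt e f).eval s ≠ 0 ↔ e.eval s < f.eval s := by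
  simp only [lt, eval]
  omega

theorem eval_eq (e f : Expr) : (eq e f).eval s ≠ 0 ↔ e.eval s = f.eval s := by
  simp only [eq, not, eval]
  omega

end Expr

/-- Programs whose loops run through `0, …, n - 1`, where `n` is the content of cell `0` of
array `0`. -/
inductive Cmd : Type
  | skip
  | write (a : ℕ) (i e : Expr)
  | seq (p q : Cmd)
  | ite (e : Expr) (p q : Cmd)
  | forn (x : ℕ) (p : Cmd)

namespace Cmd

/-- Translation to programs. -/
def compile : Cmd → Program
  | skip => .skip
  | write a i e => .write a i e
  | seq p q => .seq p.compile q.compile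
  | ite e p q => .ite e p.compile q.compile
  | forn x p => .seq (.write x (.const 0) (.const 0))
      (.loop (.sub (.var 0) (.var x))
        (.seq p.compile (.write x (.const 0) (.add (.var x) (.const 1)))))

/-- The memory after `i` rounds of a loop with the loop variable `x`. -/
def loopState (step : Memory → Memory) (x : ℕ) (s : Memory) : ℕ → Memory
  | 0 => setCell s x 0 0
  | i + 1 => setCell (step (loopState step x s i)) x 0 (i + 1)

/-- The memory after the execution. -/
def den : Cmd → Memory → Memory
  | skip, s => s
  | write a i e, s => setCell s a (i.eval s) (e.eval s)
  | seq p q, s => q.den (p.den s)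
  | ite e p q, s => if e.eval s = 0 then q.den s else p.den s
  | forn x p, s => loopState (fun s' => p.den s') x s (s 0 0)

/-- The arrays that a command may change. -/
def writes : Cmd → List ℕ
  | skip => []
  | write a _ _ => [a]
  | seq p q => p.writes ++ q.writes
  | ite _ p q => p.writes ++ q.writes
  | forn x p => x :: p.writes

/-- No loop body changes the loop variable or the loop bound. -/
def WellFormed : Cmd → Bool
  | skip => true
  | write a _ _ => a != 0
  | seq p q => p.WellFormed && q.WellFormed
  | ite _ p q => p.WellFormed && q.WellFormed
  | forn x p => x != 0 && !p.writes.contains x && p.WellFormed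

open Polynomial in
/-- A bound on the running time. -/
noncomputable def time : Cmd → ℕ[X]
  | skip => 1
  | write _ i e => C (i.cost + e.cost + 1)
  | seq p q => p.time + q.time
  | ite e p q => C (e.cost + 1) + p.time + q.time
  | forn _ p => C 9 + X * (p.time + C 12)

/-- The frame rule. The list of written arrays is computable, so for concrete commands its
hypothesis is left to `decide` or `simp`. -/
theorem den_of_not_mem_writes (p : Cmd) {a : ℕ} (h : a ∉ p.writes) (s : Memory) :
    p.den s a = s a := by
  induction p generalizing s with
  | skip => rfl
  | write b i e => exact setCell_of_ne (by simpa [writes] using h)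
  | seq p q ihp ihq =>
    simp only [writes, List.mem_append, not_or] at h
    simp only [den, ihq h.2, ihp h.1]
  | ite e p q ihp ihq =>
    simp only [writes, List.mem_append, not_or] at h
    simp only [den]
    split_ifs
    · exact ihq h.2 s
    · exact ihp h.1 s
  | forn x p ih =>
    simp only [writes, List.mem_cons, not_or] at h
    simp only [den]
    induction s 0 0 with
    | zero => exact setCell_of_ne h.1
    | succ i ihi => rw [loopState, setCell_of_ne h.1, ih h.2, ihi]

theorem zero_not_mem_writes {p : Cmd} (h : p.WellFormed) : 0 ∉ p.writes := by
  induction p with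
  | skip => exact List.not_mem_nil
  | write a i e => exact fun hm => bne_iff_ne.mp h (List.mem_singleton.mp hm).symm
  | seq p q ihp ihq =>
    simp only [WellFormed, Bool.and_eq_true] at h
    exact fun hm => (List.mem_append.mp hm).elim (ihp h.1) (ihq h.2)
  | ite e p q ihp ihq =>
    simp only [WellFormed, Bool.and_eq_true] at h
    exact fun hm => (List.mem_append.mp hm).elim (ihp h.1) (ihq h.2)
  | forn x p ih =>
    simp only [WellFormed, Bool.and_eq_true, bne_iff_ne] at h
    exact fun hm => (List.mem_cons.mp hm).elim (fun he => h.1.1 he.symm) (ih h.2)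

/-- In the bound for a loop, each test and each increment of the loop variable costs `6` steps,
which makes `12` per round; the initialization costs `3` and the last test `6`, which makes `9`. -/
theorem run_compile {p : Cmd} (hp : p.WellFormed) (s : Memory) :
    ∃ k ≤ p.time.eval (s 0 0), Run p.compile s k (p.den s) := by
  induction p generalizing s with
  | skip => exact ⟨1, by rw [time, Polynomial.eval_one], Run.skip s⟩
  | write a i e => exact ⟨_, by rw [time, Polynomial.eval_C], Run.write a i e s⟩
  | seq p q ihp ihq =>
    simp only [WellFormed, Bool.and_eq_true] at hp
    obtain ⟨k, hk, hrk⟩ := ihp hp.1 s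
    obtain ⟨l, hl, hrl⟩ := ihq hp.2 (p.den s)
    rw [den_of_not_mem_writes p (zero_not_mem_writes hp.1)] at hl
    exact ⟨k + l, by simp only [time, Polynomial.eval_add]; omega, Run.seq hrk hrl⟩
  | ite e p q ihp ihq =>
    simp only [WellFormed, Bool.and_eq_true] at hp
    simp only [time, Polynomial.eval_add, Polynomial.eval_C, den, compile]
    split_ifs with h
    · obtain ⟨k, hk, hr⟩ := ihq hp.2 s
      exact ⟨_, by omega, Run.ite_false _ h hr⟩
    · obtain ⟨k, hk, hr⟩ := ihp hp.1 s
      exact ⟨_, by omega, Run.ite_true _ h hr⟩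
  | forn x p ih =>
    simp only [WellFormed, Bool.and_eq_true, bne_iff_ne, Bool.not_eq_true', List.contains_eq_mem,
      decide_eq_false_iff_not] at hp
    obtain ⟨⟨hx0, hxp⟩, hp⟩ := hp
    have h0p := zero_not_mem_writes hp
    set n := s 0 0 with hn
    let st : ℕ → Memory := loopState (fun s' => p.den s') x s
    have hst0 : ∀ i, st i 0 0 = n ∧ st i x 0 = i := by
      intro i
      induction i with
      | zero => exact ⟨by simp only [st, loopState]; rw [setCell_of_ne hx0.symm], setCell_self _ _ _ _⟩
      | succ i ihi =>
        refine ⟨?_, setCell_self _ _ _ _⟩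
        change setCell (p.den (st i)) x 0 (i + 1) 0 0 = n
        rw [setCell_of_ne hx0.symm, den_of_not_mem_writes p h0p]
        exact ihi.1
    have hloop : ∀ j i, i + j = n → ∃ k ≤ 6 + j * (p.time.eval n + 12),
        Run (.loop (.sub (.var 0) (.var x))
          (.seq p.compile (.write x (.const 0) (.add (.var x) (.const 1))))) (st i) k (st n) := by
      intro j
      induction j with
      | zero =>
        intro i hi
        have h1 := hst0 n
        rw [show i = n by omega]
        refine ⟨_, ?_, Run.loop_false _ ?_⟩
        · simp [Expr.cost, Expr.var]
        · simp only [Expr.eval, Expr.var, h1.1, h1.2, Nat.sub_self]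
      | succ j ihj =>
        intro i hi
        obtain ⟨l, hl, hrl⟩ := ihj (i + 1) (by omega)
        obtain ⟨k, hk, hrk⟩ := ih hp (st i)
        have h1 := hst0 i
        rw [h1.1] at hk
        have hw := Run.write x (.const 0) (.add (.var x) (.const 1)) (p.den (st i))
        have hev : (Expr.add (.var x) (.const 1)).eval (p.den (st i)) = i + 1 := by
          simp only [Expr.eval, Expr.var, den_of_not_mem_writes p hxp, h1.2]
        rw [hev] at hw
        refine ⟨_, ?_, Run.loop_true ?_ (Run.seq hrk hw) hrl⟩
        · simp only [Expr.cost, Expr.var]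
          rw [Nat.add_mul]
          omega
        · simp only [Expr.eval, Expr.var, h1.1, h1.2]
          omega
    obtain ⟨k, hk, hr⟩ := hloop n 0 (by omega)
    refine ⟨_, ?_, Run.seq (Run.write x (.const 0) (.const 0) s) hr⟩
    simp only [time, Polynomial.eval_add, Polynomial.eval_mul, Polynomial.eval_C, Polynomial.eval_X,
      Expr.cost]
    omega

/-! ### Rules for loops -/

/-- The invariant rule for an invariant that does not depend on the loop variable. -/
theorem forn_rule {x : ℕ} {p : Cmd} (hp : (forn x p).WellFormed) {s : Memory} {n : ℕ}
    (hs : s 0 0 = n) (I : ℕ → Memory → Prop) (hI : ∀ i s v, I i s → I i (setCell s x 0 v))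
    (h0 : I 0 s)
    (hstep : ∀ i s', i < n → I i s' → s' x 0 = i → s' 0 0 = n → I (i + 1) (p.den s')) :
    I n ((forn x p).den s) := by
  simp only [WellFormed, Bool.and_eq_true, bne_iff_ne, Bool.not_eq_true', List.contains_eq_mem,
    decide_eq_false_iff_not] at hp
  obtain ⟨⟨hx0, hxp⟩, hp⟩ := hp
  have h0p := zero_not_mem_writes hp
  simp only [den, hs]
  have key : ∀ i, i ≤ n → ∀ st : Memory,
      st = loopState (fun s' => p.den s') x s i →
      I i st ∧ st x 0 = i ∧ st 0 0 = n := by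
    intro i
    induction i with
    | zero =>
      rintro - _ rfl
      exact ⟨hI _ _ _ h0, setCell_self _ _ _ _, by rw [loopState, setCell_of_ne hx0.symm, hs]⟩
    | succ i ih =>
      rintro hi _ rfl
      obtain ⟨h1, h2, h3⟩ := ih (by omega) _ rfl
      refine ⟨hI _ _ _ (hstep i _ hi h1 h2 h3), setCell_self _ _ _ _, ?_⟩
      rw [loopState, setCell_of_ne hx0.symm, den_of_not_mem_writes p h0p, h3]
  exact (key n le_rfl _ rfl).1

/-- Count in `f` the values of `z` for which `c` holds. -/
def count (f z : ℕ) (c : Expr) : Cmd :=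
  seq (write f (.const 0) (.const 0))
    (forn z (ite c (write f (.const 0) (.add (.var f) (.const 1))) skip))

theorem den_count {f z : ℕ} {c : Expr} {s : Memory} {n : ℕ} (hs : s 0 0 = n)
    (hw : (count f z c).WellFormed) (hf : f ∉ c.reads) :
    (count f z c).den s f 0 =
      ((Finset.range n).filter fun i => c.eval (setCell s z 0 i) ≠ 0).card := by
  have hw' := hw
  simp only [count, WellFormed, writes, Bool.and_eq_true, bne_iff_ne, Bool.not_eq_true',
    List.contains_eq_mem, decide_eq_false_iff_not, List.append_nil, List.mem_singleton] at hw'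
  obtain ⟨hf0, ⟨hz0, hzf⟩, -⟩ := hw'
  have key := forn_rule (x := z) (p := ite c (write f (.const 0) (.add (.var f) (.const 1))) skip)
    (s := setCell s f 0 0) (n := n)
    (by simpa [count, WellFormed, writes] using And.intro ⟨hz0, hzf⟩ hf0)
    (by rw [setCell_of_ne hf0.symm, hs])
    (fun i s' => (∀ a, a ≠ f → a ≠ z → s' a = s a) ∧ (∀ j, j ≠ 0 → s' z j = s z j) ∧
      s' f 0 = ((Finset.range i).filter fun i => c.eval (setCell s z 0 i) ≠ 0).card)
    ?_ ?_ ?_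
  · exact key.2.2
  · rintro i s' v ⟨h1, h2, h3⟩
    refine ⟨fun a ha hz => by rw [setCell_of_ne hz, h1 a ha hz], fun j hj => ?_, ?_⟩
    · rw [setCell_apply, if_neg hj, h2 j hj]
    · rw [setCell_of_ne (Ne.symm hzf), h3]
  · refine ⟨fun a ha hz => setCell_of_ne ha, fun j hj => by rw [setCell_of_ne hzf], ?_⟩
    rw [setCell_self]
    rfl
  · rintro i s' hi ⟨h1, h2, h3⟩ hz hn
    have hc : c.eval s' = c.eval (setCell s z 0 i) := by
      refine Expr.eval_congr c fun a ha => ?_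
      have haf : a ≠ f := fun h => hf (h ▸ ha)
      by_cases haz : a = z
      · subst haz
        ext j
        rw [setCell_apply]
        split_ifs with hj
        · rw [hj, hz]
        · exact h2 j hj
      · rw [h1 a haf haz, setCell_of_ne haz]
    rw [Finset.range_add_one, Finset.filter_insert]
    simp only [den]
    split_ifs with h4 h5 h5
    · exact absurd (hc ▸ h4) h5
    · exact ⟨h1, h2, h3⟩
    · refine ⟨fun a ha hz => by rw [setCell_of_ne ha, h1 a ha hz],
        fun j hj => by rw [setCell_of_ne hzf, h2 j hj], ?_⟩
      rw [Finset.card_insert_of_notMem (by simp)]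
      simp only [Expr.eval_const]
      rw [setCell_self, Expr.eval_add, Expr.eval_var, h3, Expr.eval_const]
    · exact absurd (hc ▸ not_not.mp h5) h4

/-- A command acts on the states represented by the memory: it either keeps the state, if
`N` holds, or decreases the potential, if `N` fails. -/
def Advances {σ : Type*} (Rep : Memory → σ → Prop) (Φ : σ → ℕ) (E : Memory → Prop) (p : Cmd)
    (N : σ → Prop) : Prop :=
  ∀ s a, Rep s a → E s → ∃ a', Rep (p.den s) a' ∧ ((a' = a ∧ N a) ∨ (Φ a' < Φ a ∧ ¬ N a))

/-- As long as the state is unchanged, round `i` certifies `N i` for the initial state. A first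
change of the state occurs in a round whose `N i` fails for the initial state, and later rounds
never raise the potential. -/
theorem advances_forn {σ : Type*} {Rep : Memory → σ → Prop} {Φ : σ → ℕ} {E : Memory → Prop}
    {x : ℕ} {p : Cmd} {n : ℕ} {N : ℕ → σ → Prop} (hp : (forn x p).WellFormed)
    (hRep0 : ∀ s a, Rep s a → s 0 0 = n) (hRep : ∀ s a v, Rep s a → Rep (setCell s x 0 v) a)
    (hE : ∀ s v, E s → E (setCell s x 0 v)) (hEp : ∀ s, E s → E (p.den s))
    (h : ∀ i < n, Advances Rep Φ (fun s => E s ∧ s x 0 = i) p (N i)) :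
    Advances Rep Φ E (forn x p) fun a => ∀ i < n, N i a := by
  intro s a hs hEs
  have key := forn_rule hp (hRep0 s a hs)
    (fun i s' => E s' ∧ ∃ a', Rep s' a' ∧ ((a' = a ∧ ∀ j < i, N j a) ∨
      (Φ a' < Φ a ∧ ∃ j < n, ¬ N j a))) ?_ ?_ ?_
  · obtain ⟨-, a', h1, h2⟩ := key
    refine ⟨a', h1, h2.imp id fun h => ⟨h.1, ?_⟩⟩
    push Not
    exact h.2
  · rintro i s' v ⟨h0, a', h1, h2⟩
    exact ⟨hE _ _ h0, a', hRep _ _ _ h1, h2⟩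
  · exact ⟨hEs, a, hs, Or.inl ⟨rfl, fun j hj => absurd hj (Nat.not_lt_zero j)⟩⟩
  · rintro i s' hi ⟨h0, a', h1, h2⟩ hx -
    obtain ⟨a'', h3, h4⟩ := h i hi s' a' h1 ⟨h0, hx⟩
    refine ⟨hEp _ h0, a'', h3, ?_⟩
    rcases h2 with ⟨rfl, h2⟩ | ⟨h2, h5⟩
    · rcases h4 with ⟨rfl, h4⟩ | ⟨h4, h6⟩
      · left
        refine ⟨rfl, fun j hj => ?_⟩
        rcases Nat.lt_succ_iff_lt_or_eq.mp hj with hj | rfl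
        · exact h2 j hj
        · exact h4
      · exact Or.inr ⟨h4, i, hi, h6⟩
    · right
      refine ⟨?_, h5⟩
      rcases h4 with ⟨rfl, -⟩ | ⟨h4, -⟩
      · exact h2
      · exact h4.trans h2

/-- A command decreases the potential by `m`, unless a state with `N` is reached. -/
def Iterates {σ : Type*} (Rep : Memory → σ → Prop) (Φ : σ → ℕ) (m : ℕ) (p : Cmd)
    (N : σ → Prop) : Prop :=
  ∀ s a, Rep s a → ∃ a', Rep (p.den s) a' ∧ (N a' ∨ (Φ a' + m ≤ Φ a ∧ ¬ N a))

theorem Advances.iterates {σ : Type*} {Rep : Memory → σ → Prop} {Φ : σ → ℕ} {p : Cmd}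
    {N : σ → Prop} (h : Advances Rep Φ (fun _ => True) p N) : Iterates Rep Φ 1 p N := by
  intro s a hs
  obtain ⟨a', h1, h2⟩ := h s a hs trivial
  refine ⟨a', h1, h2.imp ?_ id⟩
  rintro ⟨rfl, h3⟩
  exact h3

/-- If `N` fails at the end, then the second command acted on a state without `N`, so the first one
decreased the potential as well and the decreases add up. -/
theorem Iterates.seq {σ : Type*} {Rep : Memory → σ → Prop} {Φ : σ → ℕ} {p q : Cmd} {m k : ℕ}
    {N : σ → Prop} (hp : Iterates Rep Φ m p N) (hq : Iterates Rep Φ k q N) :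
    Iterates Rep Φ (m + k) (p.seq q) N := by
  intro s a hs
  obtain ⟨a', h1, h2⟩ := hp s a hs
  obtain ⟨a'', h3, h4⟩ := hq _ a' h1
  refine ⟨a'', h3, ?_⟩
  rcases h4 with h4 | ⟨h4, h5⟩
  · exact Or.inl h4
  · obtain ⟨h6, h7⟩ := h2.resolve_left h5
    exact Or.inr ⟨by omega, h7⟩

theorem Iterates.forn {σ : Type*} {Rep : Memory → σ → Prop} {Φ : σ → ℕ} {x : ℕ} {p : Cmd}
    {m n : ℕ} {N : σ → Prop} (hn : 1 ≤ n) (hp : (forn x p).WellFormed)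
    (hRep0 : ∀ s a, Rep s a → s 0 0 = n)
    (hRep : ∀ s a v, Rep s a → Rep (setCell s x 0 v) a) (h : Iterates Rep Φ m p N) :
    Iterates Rep Φ (n * m) (forn x p) N := by
  intro s a hs
  have key := forn_rule hp (hRep0 s a hs) (fun i s' => ∃ a', Rep s' a' ∧
    (i = 0 → a' = a) ∧ (1 ≤ i → N a' ∨ (Φ a' + i * m ≤ Φ a ∧ ¬ N a))) ?_ ?_ ?_
  · obtain ⟨a', h1, -, h2⟩ := key
    exact ⟨a', h1, h2 hn⟩
  · rintro i s' v ⟨a', h1, h2⟩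
    exact ⟨a', hRep _ _ _ h1, h2⟩
  · exact ⟨a, hs, fun _ => rfl, fun h => absurd h (by omega)⟩
  · rintro i s' hi ⟨a', h1, h2, h3⟩ - -
    obtain ⟨a'', h4, h5⟩ := h s' a' h1
    refine ⟨a'', h4, fun h => absurd h (by omega), fun _ => ?_⟩
    rcases h5 with h5 | ⟨h5, h6⟩
    · exact Or.inl h5
    · right
      by_cases h0 : i = 0
      · subst h0
        obtain rfl := h2 rfl
        exact ⟨by omega, h6⟩
      · obtain ⟨h7, h8⟩ := (h3 (by omega)).resolve_left h6
        refine ⟨?_, h8⟩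
        rw [Nat.add_mul]
        omega

end Cmd

/-! ### Graphs in memory -/

theorem index_inj {n : ℕ} (u v u' v' : Fin n) :
    n * (u : ℕ) + v = n * (u' : ℕ) + v' ↔ u = u' ∧ v = v' := by
  constructor
  · intro h
    have h1 : (u : ℕ) = u' := by
      have := congrArg (· / n) h
      simpa [Nat.mul_add_div u.pos, Nat.div_eq_of_lt v.2, Nat.div_eq_of_lt v'.2] using this
    refine ⟨Fin.ext h1, Fin.ext ?_⟩
    rw [h1] at h
    omega
  · rintro ⟨rfl, rfl⟩
    rfl

section Represent

variable {n : ℕ} {G : SimpleGraph (Fin n)} {A : Set (Fin n)} {T : SimpleGraph A} {s : Memory}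

/-- The memory holds the graph `G` with the partition class `A`, and the multiples of `n`. -/
structure HoldsInput (G : SimpleGraph (Fin n)) (A : Set (Fin n)) (s : Memory) : Prop where
  size : s 0 0 = n
  memA : ∀ v : Fin n, s 1 v ≠ 0 ↔ v ∈ A
  adj : ∀ u v : Fin n, s 2 (n * u + v) ≠ 0 ↔ G.Adj u v
  mul : ∀ u : Fin n, s 7 u = n * u

/-- Array `8` holds the adjacency matrix of `T`. -/
def HoldsTree (T : SimpleGraph A) (s : Memory) : Prop :=
  ∀ u v : Fin n, s 8 (n * u + v) ≠ 0 ↔ ∃ (hu : u ∈ A) (hv : v ∈ A), T.Adj ⟨u, hu⟩ ⟨v, hv⟩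

theorem HoldsInput.congr {s' : Memory} (h : HoldsInput G A s)
    (hs : ∀ a ∈ [0, 1, 2, 7], s' a = s a) : HoldsInput G A s' := by
  simp only [List.mem_cons, List.not_mem_nil, or_false, forall_eq_or_imp, forall_eq] at hs
  exact ⟨by rw [hs.1, h.size], fun v => by rw [hs.2.1, h.memA],
    fun u v => by rw [hs.2.2.1, h.adj], fun u => by rw [hs.2.2.2, h.mul]⟩

theorem HoldsInput.den (h : HoldsInput G A s) (p : Cmd)
    (hp : ∀ a ∈ [0, 1, 2, 7], a ∉ p.writes) : HoldsInput G A (p.den s) :=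
  h.congr fun a ha => p.den_of_not_mem_writes (hp a ha) s

theorem HoldsTree.congr {s' : Memory} (h : HoldsTree T s) (hs : s' 8 = s 8) : HoldsTree T s' := by
  intro u v
  rw [hs, h]

theorem HoldsTree.iff (h : HoldsTree T s) (u v : A) : s 8 (n * u.1 + v.1) ≠ 0 ↔ T.Adj u v := by
  rw [h]
  exact ⟨fun ⟨_, _, h⟩ => h, fun h => ⟨u.2, v.2, h⟩⟩

theorem HoldsInput.eval_entry (h : HoldsInput G A s) {x : ℕ} {u : Fin n} (hx : s x 0 = u)
    (a y : ℕ) : (Expr.entry a x y).eval s = s a (n * u + s y 0) := by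
  rw [Expr.eval_entry, hx, h.mul]

/-- Replace the edge `xy` of the tree by the edge `x'y'`. -/
def swapCmd (x y x' y' : ℕ) : Cmd :=
  .seq (.write 8 (.add (.read 7 (.var x)) (.var y)) (.const 0))
    (.seq (.write 8 (.add (.read 7 (.var y)) (.var x)) (.const 0))
      (.seq (.write 8 (.add (.read 7 (.var x')) (.var y')) (.const 1))
        (.write 8 (.add (.read 7 (.var y')) (.var x')) (.const 1))))

theorem swapCmd_writes (x y x' y' : ℕ) : (swapCmd x y x' y').writes = [8, 8, 8, 8] := rfl

theorem den_swapCmd_of_ne (x y x' y' : ℕ) (s : Memory) {a : ℕ} (ha : a ≠ 8) :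
    (swapCmd x y x' y').den s a = s a :=
  Cmd.den_of_not_mem_writes _ (by simp [swapCmd_writes, ha]) s

theorem HoldsTree.den_swapCmd (hT : HoldsTree T s) (hs : HoldsInput G A s)
    {i j i' j' : ℕ} (hi : i ≠ 8) (hj : j ≠ 8) (hi' : i' ≠ 8) (hj' : j' ≠ 8) {x y x' y' : A}
    (hx : s i 0 = x.1) (hy : s j 0 = y.1) (hx' : s i' 0 = x'.1) (hy' : s j' 0 = y'.1)
    (hne : x' ≠ y') :
    HoldsTree (swapEdge T x y x' y') ((swapCmd i j i' j').den s) := by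
  intro u v
  -- The new edge is written after the old one has been erased, so it prevails if they coincide.
  have hval : (swapCmd i j i' j').den s 8 (n * u + v) =
      if (u = y'.1 ∧ v = x'.1) ∨ (u = x'.1 ∧ v = y'.1) then 1
      else if (u = y.1 ∧ v = x.1) ∨ (u = x.1 ∧ v = y.1) then 0 else s 8 (n * u + v) := by
    simp only [swapCmd, Cmd.den, Expr.eval_add, Expr.eval_read, Expr.eval_var, Expr.eval_const,
      setCell_apply, setCell_of_ne hi, setCell_of_ne hj, setCell_of_ne hi', setCell_of_ne hj',
      setCell_of_ne (show (7 : ℕ) ≠ 8 by decide), hx, hy, hx', hy', hs.mul, index_inj]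
    split_ifs <;> first | rfl | tauto
  rw [hval]
  constructor
  · intro h
    split_ifs at h with h1 h2
    · rcases h1 with ⟨rfl, rfl⟩ | ⟨rfl, rfl⟩
      · exact ⟨y'.2, x'.2, swapEdge_adj.mpr (Or.inr ⟨Sym2.eq_swap, Ne.symm hne⟩)⟩
      · exact ⟨x'.2, y'.2, swapEdge_adj.mpr (Or.inr ⟨rfl, hne⟩)⟩
    · exact absurd rfl h
    · obtain ⟨hu, hv, h3⟩ := (hT u v).mp h
      refine ⟨hu, hv, swapEdge_adj.mpr (Or.inl ⟨h3, fun he => h2 ?_⟩)⟩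
      rw [Sym2.eq_iff] at he
      rcases he with ⟨h4, h5⟩ | ⟨h4, h5⟩
      · exact Or.inr ⟨congrArg Subtype.val h4, congrArg Subtype.val h5⟩
      · exact Or.inl ⟨congrArg Subtype.val h4, congrArg Subtype.val h5⟩
  · rintro ⟨hu, hv, h⟩
    rw [swapEdge_adj] at h
    split_ifs with h1 h2
    · exact one_ne_zero
    · exfalso
      rcases h with ⟨h3, h4⟩ | ⟨h3, -⟩
      · apply h4
        rcases h2 with ⟨rfl, rfl⟩ | ⟨rfl, rfl⟩
        · exact Sym2.eq_swap
        · rfl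
      · rw [Sym2.eq_iff] at h3
        rcases h3 with ⟨h4, h5⟩ | ⟨h4, h5⟩
        · exact h1 (Or.inr ⟨congrArg Subtype.val h4, congrArg Subtype.val h5⟩)
        · exact h1 (Or.inl ⟨congrArg Subtype.val h4, congrArg Subtype.val h5⟩)
    · rcases h with ⟨h3, -⟩ | ⟨h3, -⟩
      · exact (hT u v).mpr ⟨hu, hv, h3⟩
      · exfalso
        rw [Sym2.eq_iff] at h3
        rcases h3 with ⟨h4, h5⟩ | ⟨h4, h5⟩
        · exact h1 (Or.inr ⟨congrArg Subtype.val h4, congrArg Subtype.val h5⟩)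
        · exact h1 (Or.inl ⟨congrArg Subtype.val h4, congrArg Subtype.val h5⟩)

/-! ### The side of an edge -/

/-- One round of the computation of a side: if `26` is marked, then mark its neighbour `27`. -/
def markStep : Cmd :=
  .ite (.and (.read 10 (.var 26)) (.and (.entry 8 26 27)
      (.and (.not (.and (.eq (.var 26) (.var 20)) (.eq (.var 27) (.var 21))))
        (.not (.and (.eq (.var 26) (.var 21)) (.eq (.var 27) (.var 20)))))))
    (.write 10 (.var 27) (.const 1)) .skip

/-- Mark in array `10` the side of the vertex `20` of the edge between the vertices `20`, `21`. -/
def markSide : Cmd :=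
  .seq (.forn 26 (.write 10 (.var 26) (.const 0)))
    (.seq (.write 10 (.var 20) (.const 1)) (.forn 25 (.forn 26 (.forn 27 markStep))))

/-- The adjacency in array `8` without the edge between the vertices `20` and `21`. -/
def MarkAdj (n : ℕ) (s : Memory) (u v : ℕ) : Prop :=
  u < n ∧ v < n ∧ s 8 (s 7 u + v) ≠ 0 ∧ ¬ (u = s 20 0 ∧ v = s 21 0) ∧ ¬ (u = s 21 0 ∧ v = s 20 0)

/-- Vertices reached within `i` steps. -/
def MarkWithin (n : ℕ) (s : Memory) : ℕ → ℕ → Prop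
  | 0, v => v = s 20 0
  | i + 1, v => MarkWithin n s i v ∨ ∃ u, MarkWithin n s i u ∧ MarkAdj n s u v

/-- The arrays other than the mark and the loop variables are unchanged, and all marks are
justified. -/
structure MarkSound (n : ℕ) (s s' : Memory) : Prop where
  frame : ∀ a, a ∉ [10, 25, 26, 27] → s' a = s a
  sound : ∀ v < n, s' 10 v ≠ 0 → Relation.ReflTransGen (MarkAdj n s) (s 20 0) v

theorem MarkSound.setCell {s' : Memory} (h : MarkSound n s s') {x : ℕ} (v : ℕ)
    (hx : x ∈ [25, 26, 27]) : MarkSound n s (setCell s' x 0 v) := by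
  have hx10 : 10 ≠ x := by rintro rfl; simp at hx
  refine ⟨fun a ha => ?_, fun u hu => ?_⟩
  · rw [setCell_of_ne, h.frame a ha]
    rintro rfl
    exact ha (List.mem_cons_of_mem _ hx)
  · rw [setCell_of_ne hx10]
    exact h.sound u hu

theorem MarkSound.den_markStep {s' : Memory} (h : MarkSound n s s') {u v : ℕ} (hu : u < n)
    (hv : v < n) (hu' : s' 26 0 = u) (hv' : s' 27 0 = v) :
    MarkSound n s (markStep.den s') ∧ (∀ w, s' 10 w ≠ 0 → markStep.den s' 10 w ≠ 0) ∧
      (s' 10 u ≠ 0 → MarkAdj n s u v → markStep.den s' 10 v ≠ 0) := by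
  have hcond : (Expr.and (.read 10 (.var 26)) (.and (.entry 8 26 27)
      (.and (.not (.and (.eq (.var 26) (.var 20)) (.eq (.var 27) (.var 21))))
        (.not (.and (.eq (.var 26) (.var 21)) (.eq (.var 27) (.var 20))))))).eval s' ≠ 0 ↔
      s' 10 u ≠ 0 ∧ MarkAdj n s u v := by
    simp only [Expr.eval_and, Expr.eval_not, Expr.eval_eq, Expr.eval_read, Expr.eval_entry,
      Expr.eval_var, hu', hv', MarkAdj, hu, hv, true_and, h.frame 8 (by simp),
      h.frame 7 (by simp), h.frame 20 (by simp), h.frame 21 (by simp)]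
  by_cases hc : s' 10 u ≠ 0 ∧ MarkAdj n s u v
  · have hden : markStep.den s' = LinMim.setCell s' 10 v 1 := by
      simp only [markStep, Cmd.den, if_neg (hcond.mpr hc), Expr.eval_var, Expr.eval_const, hv']
    rw [hden]
    refine ⟨⟨fun a ha => ?_, fun w hw => ?_⟩, fun w hw => ?_, fun _ _ => ?_⟩
    · rw [setCell_of_ne (by rintro rfl; simp at ha), h.frame a ha]
    · rw [setCell_apply]
      split_ifs with hwv
      · intro _
        subst hwv
        exact (h.sound u hu hc.1).tail hc.2
      · exact h.sound w hw
    · rw [setCell_apply]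
      split_ifs
      · exact one_ne_zero
      · exact hw
    · rw [setCell_self]
      exact one_ne_zero
  · have hden : markStep.den s' = s' := by
      simp only [markStep, Cmd.den, if_pos (not_not.mp fun h => hc (hcond.mp h))]
    rw [hden]
    exact ⟨h, fun _ h => h, fun h1 h2 => absurd ⟨h1, h2⟩ hc⟩

/-- After `i` outer rounds everything within `i` steps is marked. Marks may run ahead of this within
a round, but each mark is justified by a chain of edges. -/
theorem den_markSide (hs : s 0 0 = n) :
    MarkSound n s (markSide.den s) ∧ ∀ v, MarkWithin n s n v → markSide.den s 10 v ≠ 0 := by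
  have hs26 : ∀ s' : Memory, MarkSound n s s' → s' 0 0 = n := fun s' h => by
    rw [h.frame 0 (by simp), hs]
  have h1 := Cmd.forn_rule (x := 26) (p := .write 10 (.var 26) (.const 0)) rfl hs
    (fun i s' => (∀ a, a ∉ [10, 25, 26, 27] → s' a = s a) ∧ ∀ v < i, s' 10 v = 0)
    (by
      rintro i s' v ⟨h1, h2⟩
      refine ⟨fun a ha => ?_, fun u hu => ?_⟩
      · rw [LinMim.setCell_of_ne (by rintro rfl; simp at ha), h1 a ha]
      · rw [LinMim.setCell_of_ne (by decide), h2 u hu])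
    ⟨fun _ _ => rfl, fun v hv => absurd hv (Nat.not_lt_zero v)⟩
    (by
      rintro i s' hi ⟨h1, h2⟩ h3 -
      simp only [Cmd.den, Expr.eval_var, Expr.eval_const, h3]
      refine ⟨fun a ha => ?_, fun u hu => ?_⟩
      · rw [LinMim.setCell_of_ne (by rintro rfl; simp at ha), h1 a ha]
      · rw [setCell_apply]
        split_ifs with h
        · rfl
        · exact h2 u (by omega))
  obtain ⟨h1, h2⟩ := h1
  set s1 := (Cmd.forn 26 (.write 10 (.var 26) (.const 0))).den s with hs1
  set s2 := LinMim.setCell s1 10 (s 20 0) 1 with hs2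
  have hden : markSide.den s = (Cmd.forn 25 (.forn 26 (.forn 27 markStep))).den s2 := by
    simp only [markSide, Cmd.den, Expr.eval_var, Expr.eval_const]
    rw [show s 20 0 = s1 20 0 by rw [h1 20 (by simp)]] at hs2
    rw [hs2, hs1]
    rfl
  have hsound : MarkSound n s s2 := by
    refine ⟨fun a ha => ?_, fun v hv => ?_⟩
    · rw [hs2, LinMim.setCell_of_ne (by rintro rfl; simp at ha), h1 a ha]
    · rw [hs2, setCell_apply]
      split_ifs with h
      · intro _
        rw [h]
      · intro h3
        exact absurd (h2 v hv) h3
  rw [hden]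
  refine Cmd.forn_rule (x := 25) rfl (hs26 _ hsound)
    (fun i s' => MarkSound n s s' ∧ ∀ v, MarkWithin n s i v → s' 10 v ≠ 0) ?_ ?_ ?_
  · rintro i s' v ⟨h3, h4⟩
    exact ⟨h3.setCell v (by simp), fun w hw => by rw [LinMim.setCell_of_ne (by decide)]; exact h4 w hw⟩
  · refine ⟨hsound, fun v hv => ?_⟩
    rw [hs2, show v = s 20 0 from hv, setCell_self]
    exact one_ne_zero
  rintro i s3 hi ⟨h3, h4⟩ - -
  have h5 := Cmd.forn_rule (x := 26) (p := .forn 27 markStep) rfl (hs26 _ h3)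
    (fun u s' => MarkSound n s s' ∧ (∀ v, s3 10 v ≠ 0 → s' 10 v ≠ 0) ∧
      ∀ w < u, ∀ v, MarkWithin n s i w → MarkAdj n s w v → s' 10 v ≠ 0) ?_ ?_ ?_
  · refine ⟨h5.1, fun v hv => ?_⟩
    rcases hv with hv | ⟨u, hu, huv⟩
    · exact h5.2.1 v (h4 v hv)
    · exact h5.2.2 u huv.1 v hu huv
  · rintro u s' v ⟨h6, h7, h8⟩
    have : LinMim.setCell s' 26 0 v 10 = s' 10 := LinMim.setCell_of_ne (by decide)
    exact ⟨h6.setCell v (by simp), by rwa [this], by rwa [this]⟩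
  · exact ⟨h3, fun _ h => h, fun w hw => absurd hw (Nat.not_lt_zero w)⟩
  · rintro u s4 hu ⟨h6, h7, h8⟩ hu4 -
    have h9 := Cmd.forn_rule (x := 27) (p := markStep) rfl (hs26 _ h6)
      (fun q s' => MarkSound n s s' ∧ s' 26 0 = u ∧ (∀ v, s4 10 v ≠ 0 → s' 10 v ≠ 0) ∧
        ∀ v < q, MarkWithin n s i u → MarkAdj n s u v → s' 10 v ≠ 0) ?_ ?_ ?_
    · refine ⟨h9.1, fun v hv => h9.2.2.1 v (h7 v hv), fun w hw v hiw hwv => ?_⟩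
      rcases Nat.lt_succ_iff_lt_or_eq.mp hw with hw | rfl
      · exact h9.2.2.1 v (h8 w hw v hiw hwv)
      · exact h9.2.2.2 v hwv.2.1 hiw hwv
    · rintro q s' v ⟨h9, h10, h11, h12⟩
      have e1 : LinMim.setCell s' 27 0 v 10 = s' 10 := LinMim.setCell_of_ne (by decide)
      have e2 : LinMim.setCell s' 27 0 v 26 = s' 26 := LinMim.setCell_of_ne (by decide)
      exact ⟨h9.setCell v (by simp), by rwa [e2], by rwa [e1], by rwa [e1]⟩
    · exact ⟨h6, hu4, fun _ h => h, fun w hw => absurd hw (Nat.not_lt_zero w)⟩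
    · rintro q s5 hq ⟨h9, h10, h11, h12⟩ hq5 -
      obtain ⟨h13, h14, h15⟩ := h9.den_markStep hu hq h10 hq5
      refine ⟨h13, ?_, fun v hv => h14 v (h11 v hv), fun v hv hiu huv => ?_⟩
      · rw [Cmd.den_of_not_mem_writes _ (by decide), h10]
      · rcases Nat.lt_succ_iff_lt_or_eq.mp hv with hv | rfl
        · exact h14 v (h12 v hv hiu huv)
        · exact h15 (h11 u (h7 u (h4 u hiu))) huv

theorem markAdj_iff (hs : HoldsInput G A s) (hT : HoldsTree T s) {x y : A} (hx : s 20 0 = x.1)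
    (hy : s 21 0 = y.1) (u : A) (v : Fin n) :
    MarkAdj n s u.1 v ↔ ∃ hv : v ∈ A, (T.deleteEdges {s(x, y)}).Adj u ⟨v, hv⟩ := by
  simp only [MarkAdj, hx, hy, hs.mul, hT u.1 v, u.1.2, v.2, true_and, SimpleGraph.deleteEdges_adj,
    Set.mem_singleton_iff, Sym2.eq_iff, ← Fin.ext_iff]
  constructor
  · rintro ⟨⟨_, hv, h1⟩, h2, h3⟩
    refine ⟨hv, h1, ?_⟩
    rintro (⟨h4, h5⟩ | ⟨h4, h5⟩)
    · exact h2 ⟨congrArg Subtype.val h4, congrArg Subtype.val h5⟩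
    · exact h3 ⟨congrArg Subtype.val h4, congrArg Subtype.val h5⟩
  · rintro ⟨hv, h1, h2⟩
    refine ⟨⟨u.2, hv, h1⟩, fun h => h2 (Or.inl ⟨?_, ?_⟩), fun h => h2 (Or.inr ⟨?_, ?_⟩)⟩
    · exact Subtype.ext h.1
    · exact Subtype.ext h.2
    · exact Subtype.ext h.1
    · exact Subtype.ext h.2

theorem markSide_iff (hs : HoldsInput G A s) (hT : HoldsTree T s) {x y : A} (hx : s 20 0 = x.1)
    (hy : s 21 0 = y.1) (v : Fin n) :
    markSide.den s 10 v ≠ 0 ↔ ∃ hv : v ∈ A, (⟨v, hv⟩ : A) ∈ edgeSide T x y := by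
  classical
  obtain ⟨h1, h2⟩ := den_markSide hs.size
  constructor
  · intro h
    have h3 := h1.sound v v.2 h
    rw [hx] at h3
    have key : ∀ w : ℕ, Relation.ReflTransGen (MarkAdj n s) x.1 w →
        ∃ (hw : w < n) (hv : (⟨w, hw⟩ : Fin n) ∈ A), (⟨⟨w, hw⟩, hv⟩ : A) ∈ edgeSide T x y := by
      intro w hw
      induction hw with
      | refl => exact ⟨x.1.2, x.2, self_mem_edgeSide T x y⟩
      | @tail b c _ hbc ih =>
        obtain ⟨hb1, hb2, hb3⟩ := ih
        obtain ⟨hc, hadj⟩ := (markAdj_iff hs hT hx hy ⟨⟨b, hb1⟩, hb2⟩ ⟨c, hbc.2.1⟩).mp hbc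
        exact ⟨hbc.2.1, hc, SimpleGraph.Reachable.trans hb3 hadj.reachable⟩
    obtain ⟨_, hv, h4⟩ := key v h3
    exact ⟨hv, h4⟩
  · rintro ⟨hv, hr⟩
    apply h2
    have hmono : ∀ i j w, i ≤ j → MarkWithin n s i w → MarkWithin n s j w := by
      intro i j w hij h
      induction hij with
      | refl => exact h
      | step _ ih => exact Or.inl ih
    have key : ∀ (a b : A) (p : (T.deleteEdges {s(x, y)}).Walk a b) (i : ℕ),
        MarkWithin n s i a.1 → MarkWithin n s (i + p.length) b.1 := by
      intro a b p
      induction p with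
      | nil => exact fun i h => h
      | @cons a b c hab p ih =>
        intro i h
        have := ih (i + 1) (Or.inr ⟨a.1, h, (markAdj_iff hs hT hx hy a b.1).mpr ⟨b.2, hab⟩⟩)
        rw [SimpleGraph.Walk.length_cons]
        rwa [Nat.add_assoc, Nat.add_comm 1] at this
    -- A path in the tree has fewer than `n` edges, so `n` rounds reach its end.
    obtain ⟨p, hp⟩ := SimpleGraph.Reachable.exists_isPath hr
    have hlen := hp.length_lt
    have hcard : Fintype.card A ≤ n := by
      simpa using Fintype.card_subtype_le (· ∈ A)
    refine hmono (0 + p.length) n _ (by omega) (key _ _ p 0 hx.symm)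

end Represent

/-! ### Computing a support -/

section Weight

variable {α β : Type*} [Fintype α] [Fintype β]

/-- Twice the total size of the labels of the edges of `T`. -/
noncomputable def labelWeight (T : SimpleGraph α) (bag : α → Set β) : ℕ :=
  ∑ b, ∑ u, halfCount T (fun u z => b ∈ bag u ∩ bag z) u

theorem labelWeight_le (T : SimpleGraph α) (bag : α → Set β) :
    labelWeight T bag ≤ Fintype.card β * (Fintype.card α * Fintype.card α) := by
  unfold labelWeight
  refine (Finset.sum_le_card_nsmul _ _ (Fintype.card α * Fintype.card α) fun b _ => ?_).trans
    (by simp)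
  refine (Finset.sum_le_card_nsmul _ _ (Fintype.card α) fun u _ => ?_).trans (by simp)
  unfold halfCount
  exact (Set.ncard_le_ncard (Set.subset_univ _)).trans
    (by rw [Set.ncard_univ, Nat.card_eq_fintype_card])

/-- The factor `2` appears because `labelWeight` counts every edge from both of its ends. -/
theorem labelWeight_swapEdge {T : SimpleGraph α} {bag : α → Set β} {x y x' y' : α}
    (hxy : T.Adj x y) (hne : x' ≠ y') (hnew : T.Adj x' y' → s(x', y') = s(x, y)) :
    labelWeight (swapEdge T x y x' y') bag + 2 * (bag x ∩ bag y).ncard =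
      labelWeight T bag + 2 * (bag x' ∩ bag y').ncard := by
  classical
  have h1 : ∀ S : Set β, 2 * S.ncard = ∑ b, 2 * if b ∈ S then 1 else 0 := by
    intro S
    rw [← Finset.mul_sum, Finset.sum_boole, Nat.cast_id, Set.ncard_eq_toFinset_card']
    congr 2
    ext
    simp
  unfold labelWeight
  rw [h1, h1, ← Finset.sum_add_distrib, ← Finset.sum_add_distrib]
  refine Finset.sum_congr rfl fun b _ => ?_
  have h2 := Finset.sum_congr (rfl : (Finset.univ : Finset α) = Finset.univ) fun u _ =>
    halfCount_swapEdge (fun u z => b ∈ bag u ∩ bag z) hxy hne hnew u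
  simp only [Finset.sum_add_distrib, Set.inter_comm (bag y), Set.inter_comm (bag y'), ite_and,
    Finset.sum_ite_eq', Finset.mem_univ, if_true] at h2
  rw [two_mul, two_mul]
  convert h2

end Weight

theorem card_filter_range_eq (n : ℕ) (P : ℕ → Prop) [DecidablePred P] :
    ((Finset.range n).filter P).card = {z : Fin n | P z}.ncard := by
  rw [← Set.ncard_coe_finset, ← Set.ncard_image_of_injective _ Fin.val_injective]
  congr 1
  ext z
  simp only [Finset.coe_filter, Finset.mem_range, Set.mem_ofPred_eq, Set.mem_image]
  constructor
  · rintro ⟨h1, h2⟩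
    exact ⟨⟨z, h1⟩, h2, rfl⟩
  · rintro ⟨w, hw, rfl⟩
    exact ⟨w.2, hw⟩

/-- The listed scalar variables have the listed values. -/
def VarsAre (L : List (ℕ × ℕ)) (s : Memory) : Prop := ∀ q ∈ L, s q.1 0 = q.2

theorem VarsAre.congr {L : List (ℕ × ℕ)} {s s' : Memory} (h : VarsAre L s)
    (hs : ∀ x ∈ L.map Prod.fst, s' x = s x) : VarsAre L s' := fun q hq => by
  rw [hs _ (List.mem_map_of_mem hq), h q hq]

theorem VarsAre.den {L : List (ℕ × ℕ)} {s : Memory} (h : VarsAre L s) (p : Cmd)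
    (hp : ∀ x ∈ L.map Prod.fst, x ∉ p.writes) : VarsAre L (p.den s) :=
  h.congr fun x hx => p.den_of_not_mem_writes (hp x hx) s

/-- The list `L` carries the values of the outer loop variables, so that nested loops run through
all tuples of vertices. -/
theorem Cmd.advances_forn_vars {σ : Type*} {Rep : Memory → σ → Prop} {Φ : σ → ℕ}
    {L : List (ℕ × ℕ)} {x : ℕ} {p : Cmd} {n : ℕ} {N : ℕ → σ → Prop} (hp : (forn x p).WellFormed)
    (hRep0 : ∀ s a, Rep s a → s 0 0 = n) (hRep : ∀ s a v, Rep s a → Rep (setCell s x 0 v) a)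
    (hL : ∀ y ∈ L.map Prod.fst, y ∉ (forn x p).writes)
    (h : ∀ i < n, Advances Rep Φ (VarsAre ((x, i) :: L)) p (N i)) :
    Advances Rep Φ (VarsAre L) (forn x p) fun a => ∀ i < n, N i a := by
  refine advances_forn hp hRep0 hRep (fun s v hs => hs.congr fun y hy => setCell_of_ne ?_)
    (fun s hs => hs.den p fun y hy hyp => hL y hy (List.mem_cons_of_mem _ hyp)) fun i hi s a hs hE => ?_
  · rintro rfl
    exact hL y hy List.mem_cons_self
  · refine h i hi s a hs fun q hq => ?_
    rcases List.mem_cons.mp hq with rfl | hq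
    · exact hE.2
    · exact hE.1 q hq

/-! ### Local search for a support -/

section Support

variable {n : ℕ} {G : SimpleGraph (Fin n)} {A : Set (Fin n)} {T : SimpleGraph A} {s : Memory}

theorem HoldsInput.setCell (h : HoldsInput G A s) {x : ℕ} (hx : x ∉ [0, 1, 2, 7]) (i v : ℕ) :
    HoldsInput G A (setCell s x i v) :=
  h.congr fun _ ha => setCell_of_ne fun he => hx (he ▸ ha)

theorem HoldsTree.setCell (h : HoldsTree T s) {x : ℕ} (hx : 8 ≠ x) (i v : ℕ) :
    HoldsTree T (setCell s x i v) := h.congr (setCell_of_ne hx)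

theorem HoldsTree.den (h : HoldsTree T s) (p : Cmd) (hp : 8 ∉ p.writes) : HoldsTree T (p.den s) :=
  h.congr (p.den_of_not_mem_writes hp s)

/-- Count in `f` the common neighbours of the vertices `x` and `y`. -/
def countCommon (f x y : ℕ) : Cmd := .count f 28 (.and (.entry 2 x 28) (.entry 2 y 28))

theorem den_countCommon (hs : HoldsInput G A s) {f x y : ℕ}
    (hw : (countCommon f x y).WellFormed) (hf : f ∉ [2, 7, x, 28, y])
    (hx : x ≠ 28) (hy : y ≠ 28) {u v : Fin n} (hu : s x 0 = u) (hv : s y 0 = v) :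
    (countCommon f x y).den s f 0 = (G.neighborSet u ∩ G.neighborSet v).ncard := by
  simp only [List.mem_cons, List.not_mem_nil, or_false, not_or] at hf
  unfold countCommon
  rw [Cmd.den_count hs.size hw (by
    simp only [Expr.and, Expr.not, Expr.entry, Expr.var, Expr.reads, List.mem_append,
      List.mem_cons, List.not_mem_nil, or_false]
    tauto), card_filter_range_eq]
  congr 1
  ext z
  simp only [Expr.eval_and, Expr.eval_entry, Set.mem_inter_iff, SimpleGraph.mem_neighborSet,
    Set.mem_ofPred_eq, setCell_of_ne hx, setCell_of_ne hy, setCell_self, hu, hv,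
    setCell_of_ne (show 2 ≠ 28 by decide), setCell_of_ne (show 7 ≠ 28 by decide), hs.mul, hs.adj]

/-- Exchange the edge between `20` and `21` for one between `22` and `23` with a larger label. -/
def improveStep : Cmd :=
  .seq markSide (.seq (countCommon 30 22 23) (.seq (countCommon 31 20 21)
    (.ite (.and (.entry 8 20 21) (.and (.read 10 (.var 22)) (.and (.not (.read 10 (.var 23)))
        (.and (.read 1 (.var 23)) (.lt (.var 31) (.var 30))))))
      (swapCmd 20 21 22 23) .skip)))

/-- The exchange of `xy` for `x'y'` yields a tree and enlarges the label. -/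
structure Improves {α β : Type*} (T : SimpleGraph α) (bag : α → Set β) (x y x' y' : α) : Prop where
  adj : T.Adj x y
  mem : x' ∈ edgeSide T x y
  not_mem : y' ∉ edgeSide T x y
  lt : (bag x ∩ bag y).ncard < (bag x' ∩ bag y').ncard

/-- The neighbourhoods of the elements of `A`. -/
abbrev nbag (G : SimpleGraph (Fin n)) (A : Set (Fin n)) (a : A) : Set (Fin n) := G.neighborSet a

/-- The memory holds the input and a tree. -/
def RepTree (G : SimpleGraph (Fin n)) (A : Set (Fin n)) (s : Memory) (T : SimpleGraph A) : Prop :=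
  HoldsInput G A s ∧ HoldsTree T s ∧ T.IsTree

/-- The potential of the search for a support. -/
noncomputable def improvePotential (G : SimpleGraph (Fin n)) (A : Set (Fin n))
    (T : SimpleGraph A) : ℕ :=
  open Classical in n * (n * n) - labelWeight T (nbag G A)

theorem card_subset_le (A : Set (Fin n)) [Fintype A] : Fintype.card A ≤ n := by
  classical
  have := Fintype.card_subtype_le (· ∈ A)
  rw [Fintype.card_fin] at this
  convert this

theorem advances_improveStep (x y x' y' : Fin n) :
    Cmd.Advances (RepTree G A) (improvePotential G A)
      (VarsAre [(23, y'), (22, x'), (21, y), (20, x)]) improveStep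
      (fun T => ∀ a b c d : A, a.1 = x → b.1 = y → c.1 = x' → d.1 = y' →
        ¬ Improves T (nbag G A) a b c d) := by
  classical
  rintro s T ⟨hs, hT, htree⟩ hE
  have h23 : s 23 0 = y' := hE (23, y') (by simp)
  have h22 : s 22 0 = x' := hE (22, x') (by simp)
  have h21 : s 21 0 = y := hE (21, y) (by simp)
  have h20 : s 20 0 = x := hE (20, x) (by simp)
  set s1 := markSide.den s with hs1
  set s2 := (countCommon 30 22 23).den s1 with hs2
  set s3 := (countCommon 31 20 21).den s2 with hs3
  have f1 : ∀ a, a ∉ [10, 25, 26, 27] → s1 a = s a := fun a ha => (den_markSide hs.size).1.frame a ha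
  have f2 : ∀ a, a ∉ [30, 28] → s2 a = s1 a := fun a ha =>
    Cmd.den_of_not_mem_writes _ (by
      simp only [countCommon, Cmd.count, Cmd.writes, List.mem_append, List.mem_cons,
        List.not_mem_nil, or_false] at ha ⊢
      tauto) _
  have f3 : ∀ a, a ∉ [31, 28] → s3 a = s2 a := fun a ha =>
    Cmd.den_of_not_mem_writes _ (by
      simp only [countCommon, Cmd.count, Cmd.writes, List.mem_append, List.mem_cons,
        List.not_mem_nil, or_false] at ha ⊢
      tauto) _
  have hs' : HoldsInput G A s3 := by
    refine hs.congr fun a ha => ?_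
    simp only [List.mem_cons, List.not_mem_nil, or_false] at ha
    rcases ha with rfl | rfl | rfl | rfl <;> rw [f3 _ (by simp), f2 _ (by simp), f1 _ (by simp)]
  have hs1' : HoldsInput G A s1 := by
    refine hs.congr fun a ha => ?_
    simp only [List.mem_cons, List.not_mem_nil, or_false] at ha
    rcases ha with rfl | rfl | rfl | rfl <;> rw [f1 _ (by simp)]
  have hs2' : HoldsInput G A s2 := by
    refine hs1'.congr fun a ha => ?_
    simp only [List.mem_cons, List.not_mem_nil, or_false] at ha
    rcases ha with rfl | rfl | rfl | rfl <;> rw [f2 _ (by simp)]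
  have hT' : HoldsTree T s3 := hT.congr (by rw [f3 _ (by simp), f2 _ (by simp), f1 _ (by simp)])
  have c30 : s3 30 0 = (G.neighborSet x' ∩ G.neighborSet y').ncard := by
    rw [f3 _ (by simp), hs2]
    exact den_countCommon hs1' (by decide) (by simp) (by decide) (by decide)
      (by rw [f1 _ (by simp), h22]) (by rw [f1 _ (by simp), h23])
  have c31 : s3 31 0 = (G.neighborSet x ∩ G.neighborSet y).ncard := by
    rw [hs3]
    exact den_countCommon hs2' (by decide) (by simp) (by decide) (by decide)
      (by rw [f2 _ (by simp), f1 _ (by simp), h20]) (by rw [f2 _ (by simp), f1 _ (by simp), h21])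
  have e20 : s3 20 0 = x := by rw [f3 _ (by simp), f2 _ (by simp), f1 _ (by simp), h20]
  have e21 : s3 21 0 = y := by rw [f3 _ (by simp), f2 _ (by simp), f1 _ (by simp), h21]
  have e22 : s3 22 0 = x' := by rw [f3 _ (by simp), f2 _ (by simp), f1 _ (by simp), h22]
  have e23 : s3 23 0 = y' := by rw [f3 _ (by simp), f2 _ (by simp), f1 _ (by simp), h23]
  have e10 : s3 10 = s1 10 := by rw [f3 _ (by simp), f2 _ (by simp)]
  -- Marked vertices lie in `A`, but unmarked ones need not, so membership in `A` is tested for the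
  -- vertex `23`.
  set e : Expr := (.and (.entry 8 20 21) (.and (.read 10 (.var 22)) (.and (.not (.read 10 (.var 23)))
        (.and (.read 1 (.var 23)) (.lt (.var 31) (.var 30)))))) with he
  have hcond : e.eval s3 ≠ 0 ↔ ∃ a b c d : A, (a.1 = x ∧ b.1 = y ∧ c.1 = x' ∧ d.1 = y') ∧
      Improves T (nbag G A) a b c d := by
    simp only [he, Expr.eval_and, Expr.eval_not, Expr.eval_lt, Expr.eval_read, Expr.eval_var,
      hs'.eval_entry e20, e21, e22, e23, c30, c31, hs'.memA, e10, hT' x y]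
    constructor
    · rintro ⟨⟨hx, hy, hadj⟩, h1, h2, h3, h4⟩
      have hmark := markSide_iff hs hT (x := ⟨x, hx⟩) (y := ⟨y, hy⟩) h20 h21
      obtain ⟨hx', h1⟩ := (hmark x').mp h1
      exact ⟨⟨x, hx⟩, ⟨y, hy⟩, ⟨x', hx'⟩, ⟨y', h3⟩, ⟨rfl, rfl, rfl, rfl⟩, hadj, h1,
        fun h => h2 ((hmark y').mpr ⟨h3, h⟩), h4⟩
    · rintro ⟨a, b, c, d, ⟨rfl, rfl, rfl, rfl⟩, himp⟩
      have hmark := markSide_iff hs hT h20 h21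
      refine ⟨⟨a.2, b.2, himp.adj⟩, (hmark c).mpr ⟨c.2, himp.mem⟩, fun h => ?_, d.2, himp.lt⟩
      obtain ⟨_, h⟩ := (hmark d).mp h
      exact himp.not_mem h
  have hden : improveStep.den s = if e.eval s3 = 0 then s3 else (swapCmd 20 21 22 23).den s3 := rfl
  rw [hden]
  split_ifs with h
  · refine ⟨T, ⟨hs', hT', htree⟩, Or.inl ⟨rfl, ?_⟩⟩
    intro a b c d ha hb hc hd himp
    exact hcond.mpr ⟨a, b, c, d, ⟨ha, hb, hc, hd⟩, himp⟩ h
  · obtain ⟨a, b, c, d, ⟨rfl, rfl, rfl, rfl⟩, himp⟩ := hcond.mp h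
    have hne : c ≠ d := fun h => himp.not_mem (h ▸ himp.mem)
    refine ⟨swapEdge T a b c d, ⟨hs'.den _ (by decide), hT'.den_swapCmd hs' (by decide) (by decide)
      (by decide) (by decide) e20 e21 e22 e23 hne, swapEdge_isTree htree himp.adj himp.mem
        himp.not_mem⟩, Or.inr ⟨?_, fun hN => hN a b c d rfl rfl rfl rfl himp⟩⟩
    have hw := labelWeight_swapEdge (bag := nbag G A) himp.adj hne fun h => by
      obtain ⟨rfl, rfl⟩ := eq_of_adj_edgeSide htree himp.adj h himp.mem himp.not_mem
      rfl
    have hlt := himp.lt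
    -- The weight never exceeds `n * (n * n)`, so the truncated subtraction in the potential loses
    -- nothing.
    have hle := labelWeight_le (swapEdge T a b c d) (nbag G A)
    have hc := card_subset_le A
    have hle2 : Fintype.card (Fin n) * (Fintype.card A * Fintype.card A) ≤ n * (n * n) := by
      rw [Fintype.card_fin]
      gcongr
    unfold improvePotential
    omega

/-- One pass of the search for a support. -/
def improvePass : Cmd := .forn 20 (.forn 21 (.forn 22 (.forn 23 improveStep)))

/-- Cubically many passes. -/
def cubeRepeat (p : Cmd) : Cmd := .forn 40 (.forn 41 (.forn 42 p))

/-- Turn a tree into a support. -/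
def improveCmd : Cmd := .seq (cubeRepeat improvePass) (cubeRepeat improvePass)

theorem RepTree.setCell (h : RepTree G A s T) {x : ℕ} (hx : x ∉ [0, 1, 2, 7, 8]) (i v : ℕ) :
    RepTree G A (setCell s x i v) T := by
  simp only [List.mem_cons, List.not_mem_nil, or_false, not_or] at hx
  exact ⟨h.1.setCell (by simp; tauto) i v, h.2.1.setCell (Ne.symm hx.2.2.2.2) i v, h.2.2⟩

theorem advances_improvePass : Cmd.Advances (RepTree G A) (improvePotential G A)
    (fun _ => True) improvePass fun T => ∀ x < n, ∀ y < n, ∀ x' < n, ∀ y' < n,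
      ∀ a b c d : A, a.1.1 = x → b.1.1 = y → c.1.1 = x' → d.1.1 = y' →
        ¬ Improves T (nbag G A) a b c d := by
  have h0 : ∀ s T, RepTree G A s T → s 0 0 = n := fun s T h => h.1.size
  have key : Cmd.Advances (RepTree G A) (improvePotential G A)
    (VarsAre []) improvePass fun T => ∀ x < n, ∀ y < n, ∀ x' < n, ∀ y' < n,
      ∀ a b c d : A, a.1.1 = x → b.1.1 = y → c.1.1 = x' → d.1.1 = y' →
        ¬ Improves T (nbag G A) a b c d := by
    refine Cmd.advances_forn_vars (by decide) h0 (fun s T v h => h.setCell (by decide) 0 v)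
      (by simp) fun x hx => ?_
    refine Cmd.advances_forn_vars (by decide) h0 (fun s T v h => h.setCell (by decide) 0 v)
      (show ∀ y ∈ [20], y ∉ _ by decide) fun y hy => ?_
    refine Cmd.advances_forn_vars (by decide) h0 (fun s T v h => h.setCell (by decide) 0 v)
      (show ∀ y ∈ [21, 20], y ∉ _ by decide) fun x' hx' => ?_
    refine Cmd.advances_forn_vars (by decide) h0 (fun s T v h => h.setCell (by decide) 0 v)
      (show ∀ y ∈ [22, 21, 20], y ∉ _ by decide) fun y' hy' => ?_
    have := advances_improveStep (G := G) (A := A) ⟨x, hx⟩ ⟨y, hy⟩ ⟨x', hx'⟩ ⟨y', hy'⟩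
    simpa only [Fin.ext_iff] using this
  intro s T hs _
  exact key s T hs (fun q hq => absurd hq List.not_mem_nil)

theorem iterates_cubeRepeat {σ : Type*} {Rep : Memory → σ → Prop} {Φ : σ → ℕ} {p : Cmd}
    {N : σ → Prop} (hn : 1 ≤ n) (hp : (cubeRepeat p).WellFormed)
    (h0 : ∀ s a, Rep s a → s 0 0 = n)
    (hRep : ∀ x ∈ [40, 41, 42], ∀ s a v, Rep s a → Rep (setCell s x 0 v) a)
    (h : Cmd.Advances Rep Φ (fun _ => True) p N) :
    Cmd.Iterates Rep Φ (n * (n * (n * 1))) (cubeRepeat p) N := by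
  have hp1 : (Cmd.forn 41 (.forn 42 p)).WellFormed := by
    simp only [cubeRepeat, Cmd.WellFormed, Bool.and_eq_true] at hp ⊢
    exact hp.2
  have hp2 : (Cmd.forn 42 p).WellFormed := by
    simp only [Cmd.WellFormed, Bool.and_eq_true] at hp1 ⊢
    exact hp1.2
  exact ((h.iterates.forn hn hp2 h0 (hRep 42 (by simp))).forn hn hp1 h0 (hRep 41 (by simp))).forn
    hn hp h0 (hRep 40 (by simp))

/-- There are `2 * n ^ 3` passes and the potential is at most `n ^ 3`, so a local optimum is
reached. The existence of some support `H` makes this optimum a support; the command does not use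
`H`. -/
theorem den_improveCmd (hn : 1 ≤ n) (h : RepTree G A s T) {H : SimpleGraph A} (hH : H.IsTree)
    (hHS : IsSupport H (nbag G A)) :
    ∃ T' : SimpleGraph A, RepTree G A (improveCmd.den s) T' ∧ IsSupport T' (nbag G A) := by
  have h0 : ∀ s T, RepTree G A s T → s 0 0 = n := fun s T h => h.1.size
  have hR : ∀ x ∈ [40, 41, 42], ∀ s T v, RepTree G A s T → RepTree G A (LinMim.setCell s x 0 v) T := by
    intro x hx s T v h
    simp only [List.mem_cons, List.not_mem_nil, or_false] at hx
    rcases hx with rfl | rfl | rfl <;> exact h.setCell (by decide) 0 v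
  have hit := iterates_cubeRepeat hn (by decide) h0 hR (advances_improvePass (G := G) (A := A))
  obtain ⟨T', h1, h2⟩ := hit.seq hit s T h
  refine ⟨T', h1, isSupport_of_local_opt h1.2.2 hH hHS fun x y x' y' hxy hx' hy' => ?_⟩
  rcases h2 with h2 | ⟨h2, -⟩
  · by_contra hc
    exact h2 x x.1.2 y y.1.2 x' x'.1.2 y' y'.1.2 x y x' y' rfl rfl rfl rfl
      ⟨hxy, hx', hy', not_le.mp hc⟩
  · exfalso
    have h3 : improvePotential G A T ≤ n * (n * n) := Nat.sub_le _ _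
    have h4 : 1 ≤ n * (n * n) := by
      have := Nat.mul_pos hn (Nat.mul_pos hn hn)
      omega
    rw [mul_one] at h2
    omega

end Support

/-! ### Computing a support with the fewest leaves -/

section Potential

variable {α β : Type*}

/-- The potential of the search for a support with few leaves. -/
noncomputable def pushPotential [Fintype α] (N : ℕ) (T : SimpleGraph α) (h : α → ℕ) : ℕ :=
  2 * N * ∑ u, (N + 1 - h u) + ∑ u, vdeg T u * h u

/-- One unit of degree moves one level down, and the heights stay the same. -/
theorem pushPotential_push [Fintype α] {T T' : SimpleGraph α} {bag : α → Set β} {x x' : α} (N : ℕ)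
    {h : α → ℕ} (hp : IsPush T T' bag x x') (hx : h x = h x' + 1) :
    pushPotential N T' h < pushPotential N T h := by
  classical
  have h1 : ∑ u, vdeg T' u * h u + h x = ∑ u, vdeg T u * h u + h x' := by
    have h2 := Finset.sum_congr (rfl : (Finset.univ : Finset α) = Finset.univ) fun u _ =>
      congrArg (· * h u) (hp.vdeg u)
    simp only [add_mul, ite_mul, one_mul, zero_mul, Finset.sum_add_distrib] at h2
    convert h2 <;> simp
  unfold pushPotential
  omega

/-- The first sum drops by one and has weight `2 * N`, while the second sum grows by the degree of
`x`, which is at most `N`. -/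
theorem pushPotential_raise [Fintype α] [DecidableEq α] {T : SimpleGraph α} {x : α} {N : ℕ} {h : α → ℕ}
    (hN : Fintype.card α ≤ N) (hx : h x ≤ N) :
    pushPotential N T (Function.update h x (h x + 1)) < pushPotential N T h := by
  have h1 : vdeg T x ≤ N := by
    unfold vdeg
    refine (Set.ncard_le_ncard (Set.subset_univ _)).trans ?_
    rw [Set.ncard_univ, Nat.card_eq_fintype_card]
    exact hN
  have h2 : 1 ≤ N := (Fintype.card_pos_iff.mpr ⟨x⟩).trans_le hN
  have h3 : ∀ f : α → ℕ → ℕ, ∑ u, f u (Function.update h x (h x + 1) u) + f x (h x) =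
      ∑ u, f u (h u) + f x (h x + 1) := by
    intro f
    rw [← Finset.add_sum_erase _ _ (Finset.mem_univ x),
      ← Finset.add_sum_erase Finset.univ (fun u => f u (h u)) (Finset.mem_univ x),
      Function.update_self]
    have : ∑ u ∈ Finset.univ.erase x, f u (Function.update h x (h x + 1) u) =
        ∑ u ∈ Finset.univ.erase x, f u (h u) :=
      Finset.sum_congr rfl fun u hu => by
        rw [Function.update_of_ne (Finset.ne_of_mem_erase hu)]
    omega
  have h4 := h3 fun _ k => N + 1 - k
  have h5 := h3 fun u k => vdeg T u * k
  have h6 : ∑ u, (N + 1 - h u) = ∑ u, (N + 1 - Function.update h x (h x + 1) u) + 1 := by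
    have h7 : N + 1 - (h x + 1) + 1 = N + 1 - h x := by omega
    omega
  unfold pushPotential
  rw [h6]
  simp only [Nat.mul_add] at h5 ⊢
  omega

theorem pushPotential_zero_le [Fintype α] {T : SimpleGraph α} {N : ℕ} (hN : Fintype.card α ≤ N) :
    pushPotential N T (fun _ => 0) ≤ 2 * N * (N * (N + 1)) := by
  simp only [pushPotential, Nat.sub_zero, Finset.sum_const, Finset.card_univ, smul_eq_mul,
    Nat.mul_zero, Nat.add_zero]
  gcongr

/-- An edge end can be moved from `x` to `x'`, one level down. -/
structure Pushable (N : ℕ) (T : SimpleGraph α) (bag : α → Set β) (h : α → ℕ)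
    (x y x' v w : α) : Prop where
  branch : 3 ≤ vdeg T x
  le : h x ≤ N
  height : h x = h x' + 1
  adj : T.Adj x y
  subset : bag x ∩ bag y ⊆ bag x'
  side : x' ∈ edgeSide T x y ∨
    (v ∈ edgeSide T x y ∧ w ∈ edgeSide T x y ∧ T.Adj v w ∧ bag v ∩ bag w = bag x ∩ bag y)

/-- Raising `x` endangers only moves from `x` to a vertex exactly one level below, and such a move
would be an available push. -/
theorem LevelInvariant.raise [DecidableEq α] {N : ℕ} {T : SimpleGraph α} {bag : α → Set β}
    {h : α → ℕ} {x : α} (hI : LevelInvariant T bag h) (hx : 3 ≤ vdeg T x) (hxN : h x ≤ N)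
    (hno : ∀ y x' v w, ¬ Pushable N T bag h x y x' v w) :
    LevelInvariant T bag (Function.update h x (h x + 1)) := by
  intro u y u' hp
  have h1 := hI u y u' hp
  simp only [Function.update_apply]
  split_ifs with h2 h3 h3
  · omega
  · subst h2
    by_contra hc
    have h4 : h u = h u' + 1 := by omega
    rcases hp.side with h5 | ⟨v, w, h5, h6, h7, h8⟩
    -- A push by a single slide needs no auxiliary edge; its last two arguments are arbitrary.
    · exact hno y u' u u ⟨hx, hxN, h4, hp.adj, hp.subset, Or.inl h5⟩
    · exact hno y u' v w ⟨hx, hxN, h4, hp.adj, hp.subset, Or.inr ⟨h5, h6, h7, h8⟩⟩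
  · subst h3
    omega
  · exact h1

end Potential

/-! ### Pushing and raising in memory -/

section Push

variable {n : ℕ} {G : SimpleGraph (Fin n)} {A : Set (Fin n)} {T : SimpleGraph A} {s : Memory}

theorem den_count_eq {f z : ℕ} {c : Expr} (hs : s 0 0 = n) (hw : (Cmd.count f z c).WellFormed)
    (hf : f ∉ c.reads) {P : Fin n → Prop}
    (hP : ∀ i : Fin n, c.eval (setCell s z 0 i) ≠ 0 ↔ P i) :
    (Cmd.count f z c).den s f 0 = {i | P i}.ncard := by
  rw [Cmd.den_count hs hw hf, card_filter_range_eq]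
  simp only [hP]

/-- The memory holds the input, a support and heights of its vertices. -/
structure RepPush (G : SimpleGraph (Fin n)) (A : Set (Fin n)) (s : Memory)
    (a : SimpleGraph A × (A → ℕ)) : Prop where
  rep : RepTree G A s a.1
  height : ∀ u : A, s 9 u.1 = a.2 u
  isSupport : IsSupport a.1 (nbag G A)
  level : LevelInvariant a.1 (nbag G A) a.2
  leaf : ∀ u, vdeg a.1 u ≤ 1 → a.2 u = 0
  le : ∀ u, a.2 u ≤ n + 1

theorem RepPush.congr {a : SimpleGraph A × (A → ℕ)} {s' : Memory} (h : RepPush G A s a)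
    (hs : ∀ x ∈ [0, 1, 2, 7, 8, 9], s' x = s x) : RepPush G A s' a := by
  refine ⟨⟨h.rep.1.congr fun x hx => hs x ?_, h.rep.2.1.congr (hs 8 (by simp)), h.rep.2.2⟩,
    fun u => ?_, h.isSupport, h.level, h.leaf, h.le⟩
  · simp only [List.mem_cons, List.not_mem_nil, or_false] at hx ⊢
    tauto
  · rw [hs 9 (by simp), h.height]

theorem RepPush.setCell {a : SimpleGraph A × (A → ℕ)} (h : RepPush G A s a) {x : ℕ}
    (hx : x ∉ [0, 1, 2, 7, 8, 9]) (i v : ℕ) : RepPush G A (setCell s x i v) a :=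
  h.congr fun _ hy => setCell_of_ne fun he => hx (he ▸ hy)

/-- Membership of `28` in the label of the edge between `x` and `y`. -/
def labelExpr (x y : ℕ) : Expr := .and (.entry 2 x 28) (.entry 2 y 28)

/-- Gather the data for a push: the side of the edge, the size of the difference of its label and
the neighbourhood of the new end, the number of differences between the labels of both edges, and
the degree of the old end. -/
def pushData : Cmd :=
  .seq markSide
    (.seq (.count 30 28 (.and (labelExpr 20 21) (.not (.entry 2 22 28))))
      (.seq (.count 31 28 (.not (.and (.not (.and (labelExpr 20 21) (.not (labelExpr 23 24))))
          (.not (.and (labelExpr 23 24) (.not (labelExpr 20 21)))))))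
        (.count 33 28 (.entry 8 20 28))))

/-- The conditions for a push apart from the side of the new end. -/
def pushGuard : Expr :=
  .and (.lt (.const 2) (.var 33)) (.and (.lt (.read 9 (.var 20)) (.add (.var 0) (.const 1)))
    (.and (.eq (.read 9 (.var 20)) (.add (.read 9 (.var 22)) (.const 1)))
      (.and (.entry 8 20 21) (.and (.not (.var 30))
        (.and (.read 1 (.var 22)) (.and (.read 1 (.var 23)) (.read 1 (.var 24))))))))

/-- The condition for a push by two slides. -/
def pairGuard : Expr :=
  .and (.read 10 (.var 23)) (.and (.read 10 (.var 24)) (.and (.entry 8 23 24) (.not (.var 31))))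

/-- Perform a push if possible and set the flag `34`. -/
def pushStep : Cmd :=
  .seq pushData (.ite pushGuard
    (.ite (.read 10 (.var 22)) (.seq (swapCmd 20 21 22 21) (.write 34 (.const 0) (.const 1)))
      (.ite pairGuard
        (.seq (.seq (swapCmd 20 21 23 21) (swapCmd 23 24 22 24)) (.write 34 (.const 0) (.const 1)))
        .skip)) .skip)

/-- What `pushData` computes. -/
structure PushDataSpec (G : SimpleGraph (Fin n)) (T : SimpleGraph A) (x y x' v w : Fin n)
    (s s' : Memory) : Prop where
  frame : ∀ a, a ∉ [10, 25, 26, 27, 28, 30, 31, 33] → s' a = s a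
  mark : s' 10 = markSide.den s 10
  sub : s' 30 0 = 0 ↔ G.neighborSet x ∩ G.neighborSet y ⊆ G.neighborSet x'
  label : s' 31 0 = 0 ↔ G.neighborSet v ∩ G.neighborSet w = G.neighborSet x ∩ G.neighborSet y
  deg : ∀ hx : x ∈ A, s' 33 0 = vdeg T ⟨x, hx⟩

theorem labelExpr_eval (hs : HoldsInput G A s) {i j : ℕ} (hi : i ≠ 28) (hj : j ≠ 28)
    {x y : Fin n} (hx : s i 0 = x) (hy : s j 0 = y) (z : Fin n) :
    (labelExpr i j).eval (setCell s 28 0 z) ≠ 0 ↔ z ∈ G.neighborSet x ∩ G.neighborSet y := by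
  simp only [labelExpr, Expr.eval_and, Expr.eval_entry, Set.mem_inter_iff,
    SimpleGraph.mem_neighborSet, setCell_of_ne hi, setCell_of_ne hj, setCell_self, hx, hy,
    setCell_of_ne (show 2 ≠ 28 by decide), setCell_of_ne (show 7 ≠ 28 by decide), hs.mul, hs.adj]

theorem entry_eval (hs : HoldsInput G A s) (a : ℕ) {i : ℕ} (ha : a ≠ 28) (hi : i ≠ 28)
    {x : Fin n} (hx : s i 0 = x) (z : Fin n) :
    (Expr.entry a i 28).eval (setCell s 28 0 z) = s a (n * x + z) := by
  simp only [Expr.eval_entry, setCell_of_ne hi, setCell_self, hx, setCell_of_ne ha,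
    setCell_of_ne (show 7 ≠ 28 by decide), hs.mul]

theorem vdeg_eq_ncard (hT : HoldsTree T s) (x : A) :
    {z : Fin n | s 8 (n * x.1 + z) ≠ 0}.ncard = vdeg T x := by
  rw [vdeg, ← Set.ncard_image_of_injective _ Subtype.val_injective]
  congr 1
  ext z
  simp only [Set.mem_ofPred_eq, Set.mem_image, SimpleGraph.mem_neighborSet]
  rw [hT x z]
  constructor
  · rintro ⟨_, hz, h⟩
    exact ⟨⟨z, hz⟩, h, rfl⟩
  · rintro ⟨z, h, rfl⟩
    exact ⟨x.2, z.2, h⟩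

theorem den_pushData (hs : HoldsInput G A s) (hT : HoldsTree T s) {x y x' v w : Fin n}
    (hE : VarsAre [(24, (w : ℕ)), (23, (v : ℕ)), (22, (x' : ℕ)), (21, (y : ℕ)), (20, (x : ℕ))] s) :
    PushDataSpec G T x y x' v w s (pushData.den s) := by
  set s1 := markSide.den s with hs1
  set c2 := Cmd.count 30 28 (.and (labelExpr 20 21) (.not (.entry 2 22 28))) with hc2
  set s2 := c2.den s1 with hs2
  set c3 := Cmd.count 31 28 (.not (.and (.not (.and (labelExpr 20 21) (.not (labelExpr 23 24))))
          (.not (.and (labelExpr 23 24) (.not (labelExpr 20 21)))))) with hc3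
  set s3 := c3.den s2 with hs3
  set c4 := Cmd.count 33 28 (.entry 8 20 28) with hc4
  have hden : pushData.den s = c4.den s3 := rfl
  have w2 : c2.writes = [30, 28, 30] := rfl
  have w3 : c3.writes = [31, 28, 31] := rfl
  have w4 : c4.writes = [33, 28, 33] := rfl
  have f1 : ∀ a, a ∉ [10, 25, 26, 27] → s1 a = s a := fun a ha => (den_markSide hs.size).1.frame a ha
  have f2 : ∀ a, a ∉ [30, 28, 30] → s2 a = s1 a := fun a ha =>
    Cmd.den_of_not_mem_writes _ (w2 ▸ ha) _
  have f3 : ∀ a, a ∉ [31, 28, 31] → s3 a = s2 a := fun a ha =>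
    Cmd.den_of_not_mem_writes _ (w3 ▸ ha) _
  have f4 : ∀ a, a ∉ [33, 28, 33] → c4.den s3 a = s3 a := fun a ha =>
    Cmd.den_of_not_mem_writes _ (w4 ▸ ha) _
  have i1 : HoldsInput G A s1 := hs.congr fun a ha => f1 a (by revert a; decide)
  have i2 : HoldsInput G A s2 := i1.congr fun a ha => f2 a (by revert a; decide)
  have i3 : HoldsInput G A s3 := i2.congr fun a ha => f3 a (by revert a; decide)
  have v1 := hE.congr (s' := s1) fun a ha =>
    f1 a ((show ∀ a ∈ [24, 23, 22, 21, 20], a ∉ _ by decide) a ha)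
  have v2 := v1.congr (s' := s2) fun a ha =>
    f2 a ((show ∀ a ∈ [24, 23, 22, 21, 20], a ∉ _ by decide) a ha)
  have v3 := v2.congr (s' := s3) fun a ha =>
    f3 a ((show ∀ a ∈ [24, 23, 22, 21, 20], a ∉ _ by decide) a ha)
  have t3 : HoldsTree T s3 := hT.congr (by rw [f3 _ (by simp), f2 _ (by simp), f1 _ (by simp)])
  have c30 : s2 30 0 = {z | z ∈ G.neighborSet x ∩ G.neighborSet y ∧ z ∉ G.neighborSet x'}.ncard := by
    refine den_count_eq i1.size (by decide) (by decide) fun z => ?_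
    rw [Expr.eval_and, Expr.eval_not, labelExpr_eval i1 (show 20 ≠ 28 by decide) (show 21 ≠ 28 by decide)
      (v1 (20, x) (by simp)) (v1 (21, y) (by simp)), entry_eval i1 2 (by decide) (show 22 ≠ 28 by decide)
      (v1 (22, x') (by simp)), i1.adj]
    rfl
  have c31 : s3 31 0 = {z | ¬ (z ∈ G.neighborSet v ∩ G.neighborSet w ↔
      z ∈ G.neighborSet x ∩ G.neighborSet y)}.ncard := by
    refine den_count_eq i2.size (by decide) (by decide) fun z => ?_
    simp only [Expr.eval_and, Expr.eval_not, labelExpr_eval i2 (show 20 ≠ 28 by decide)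
      (show 21 ≠ 28 by decide) (v2 (20, x) (by simp)) (v2 (21, y) (by simp)), labelExpr_eval i2
      (show 23 ≠ 28 by decide) (show 24 ≠ 28 by decide) (v2 (23, v) (by simp)) (v2 (24, w) (by simp))]
    tauto
  have c33 : c4.den s3 33 0 = {z : Fin n | s3 8 (n * x + z) ≠ 0}.ncard := by
    refine den_count_eq i3.size (by decide) (by decide) fun z => ?_
    rw [entry_eval i3 8 (by decide) (show 20 ≠ 28 by decide) (v3 (20, x) (by simp))]
  rw [hden]
  refine ⟨fun a ha => ?_, ?_, ?_, ?_, fun hx => ?_⟩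
  · simp only [List.mem_cons, List.not_mem_nil, or_false, not_or] at ha
    rw [f4 _ (by simp; tauto), f3 _ (by simp; tauto), f2 _ (by simp; tauto), f1 _ (by simp; tauto)]
  · rw [f4 _ (by simp), f3 _ (by simp), f2 _ (by simp)]
  · rw [f4 _ (by simp), f3 _ (by simp), c30, Set.ncard_eq_zero]
    constructor
    · intro h z hz
      by_contra hc
      exact (Set.eq_empty_iff_forall_notMem.mp h) z ⟨hz, hc⟩
    · intro h
      exact Set.eq_empty_iff_forall_notMem.mpr fun z hz => hz.2 (h hz.1)
  · rw [f4 _ (by simp), c31, Set.ncard_eq_zero, Set.eq_empty_iff_forall_notMem, Set.ext_iff]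
    simp only [Set.mem_ofPred_eq, not_not]
  · exact c33.trans (vdeg_eq_ncard t3 ⟨x, hx⟩)

open Classical in
/-- The potential of the state of the search. -/
noncomputable def statePotential (A : Set (Fin n)) (a : SimpleGraph A × (A → ℕ)) : ℕ :=
  pushPotential n a.1 a.2

/-- Heights of leaves remain `0`: only `x` loses an edge end, and with degree at least `3` before
the push it does not become a leaf. -/
theorem RepPush.push {x x' : A} {T' : SimpleGraph A} {h : A → ℕ} (hr : RepPush G A s (T, h))
    {s' : Memory} (hp : IsPush T T' (nbag G A) x x') (hx : 3 ≤ vdeg T x) (hh : h x = h x' + 1)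
    (hT' : HoldsTree T' s') (hs' : ∀ a ∈ [0, 1, 2, 7, 9], s' a = s a) :
    RepPush G A s' (T', h) := by
  classical
  refine ⟨⟨hr.rep.1.congr fun a ha => hs' a ?_, hT', hp.isTree⟩, fun u => ?_, hp.isSupport,
    hp.level h hr.level hh, fun u hu => ?_, hr.le⟩
  · simp only [List.mem_cons, List.not_mem_nil, or_false] at ha ⊢
    tauto
  · rw [hs' 9 (by simp), hr.height]
  · have h1 := hp.vdeg u
    refine hr.leaf u ?_
    have h2 : u ≠ x := by
      rintro rfl
      simp only [if_true] at h1
      have h3 : vdeg T' u ≤ 1 := hu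
      omega
    simp only [if_neg h2] at h1
    have h3 : vdeg T' u ≤ 1 := hu
    change vdeg T u ≤ 1
    omega

/-- The memory holds a state which is the initial one as long as the flag is not set. -/
def RepFlag (G : SimpleGraph (Fin n)) (A : Set (Fin n)) (a₀ : SimpleGraph A × (A → ℕ)) (s : Memory)
    (a : SimpleGraph A × (A → ℕ)) : Prop :=
  RepPush G A s a ∧ (s 34 0 = 0 → a = a₀) ∧
    (s 34 0 ≠ 0 → statePotential A a < statePotential A a₀)

theorem advances_pushStep (a₀ : SimpleGraph A × (A → ℕ)) (x y x' v w : Fin n) :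
    Cmd.Advances (RepFlag G A a₀) (statePotential A)
      (VarsAre [(24, w), (23, v), (22, x'), (21, y), (20, x)]) pushStep
      (fun a => ∀ b c d e f : A, b.1 = x → c.1 = y → d.1 = x' → e.1 = v → f.1 = w →
        ¬ Pushable n a.1 (nbag G A) a.2 b c d e f) := by
  classical
  rintro s ⟨T, h⟩ ⟨hr, hflag1, hflag2⟩ hE
  have hd := den_pushData hr.rep.1 hr.rep.2.1 hE
  set s1 := pushData.den s with hs1
  have v1 := hE.congr (s' := s1) fun a ha =>
    hd.frame a ((show ∀ a ∈ [24, 23, 22, 21, 20], a ∉ _ by decide) a ha)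
  have hr1 : RepPush G A s1 (T, h) := hr.congr fun a ha => hd.frame a (by revert a; decide)
  have e34 : s1 34 = s 34 := hd.frame 34 (by simp)
  have e20 : s1 20 0 = x := v1 (20, x) (by simp)
  have e21 : s1 21 0 = y := v1 (21, y) (by simp)
  have e22 : s1 22 0 = x' := v1 (22, x') (by simp)
  have e23 : s1 23 0 = v := v1 (23, v) (by simp)
  have e24 : s1 24 0 = w := v1 (24, w) (by simp)
  have hi := hr1.rep.1
  have ht := hr1.rep.2.1
  have htree : T.IsTree := hr1.rep.2.2
  have hguard : pushGuard.eval s1 ≠ 0 ↔ ∃ b c d e f : A, (b.1 = x ∧ c.1 = y ∧ d.1 = x' ∧ e.1 = v ∧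
      f.1 = w) ∧ 3 ≤ vdeg T b ∧ h b ≤ n ∧ h b = h d + 1 ∧ T.Adj b c ∧
      nbag G A b ∩ nbag G A c ⊆ nbag G A d := by
    simp only [pushGuard, Expr.eval_and, Expr.eval_not, Expr.eval_lt, Expr.eval_eq, Expr.eval_read,
      Expr.eval_var, Expr.eval_add, Expr.eval_const, hi.eval_entry e20, e20, e21, e22, e23, e24,
      hi.memA, ht x y, not_not, hd.sub, hi.size]
    constructor
    · rintro ⟨h1, h2, h3, ⟨hx, hy, h4⟩, h5, h6, h7, h8⟩
      have e1 := hr1.height ⟨x, hx⟩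
      have e2 := hr1.height ⟨x', h6⟩
      simp only at e1 e2
      rw [hd.deg hx] at h1
      change 2 < vdeg T _ at h1
      exact ⟨⟨x, hx⟩, ⟨y, hy⟩, ⟨x', h6⟩, ⟨v, h7⟩, ⟨w, h8⟩, ⟨rfl, rfl, rfl, rfl, rfl⟩, by omega,
        by omega, by omega, h4, h5⟩
    · rintro ⟨b, c, d, e, f, ⟨rfl, rfl, rfl, rfl, rfl⟩, h1, h2, h3, h4, h5⟩
      have e1 := hr1.height b
      have e2 := hr1.height d
      simp only at e1 e2
      rw [hd.deg b.2]
      exact ⟨h1, by omega, by omega, ⟨b.2, c.2, h4⟩, h5, d.2, e.2, f.2⟩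
  have hden : pushStep.den s = if pushGuard.eval s1 = 0 then s1 else
      if (Expr.read 10 (.var 22)).eval s1 = 0 then
        if pairGuard.eval s1 = 0 then s1 else
          setCell ((swapCmd 23 24 22 24).den ((swapCmd 20 21 23 21).den s1)) 34 0 1
      else setCell ((swapCmd 20 21 22 21).den s1) 34 0 1 := rfl
  have hkeep : RepFlag G A a₀ s1 (T, h) := ⟨hr1, by rwa [e34], by rwa [e34]⟩
  rw [hden]
  split_ifs with hg hm hp
  · refine ⟨_, hkeep, Or.inl ⟨rfl, fun b c d e f hb hc hd' he hf hpu => hguard.mpr ?_ hg⟩⟩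
    exact ⟨b, c, d, e, f, ⟨hb, hc, hd', he, hf⟩, hpu.branch, hpu.le, hpu.height, hpu.adj, hpu.subset⟩
  all_goals
    obtain ⟨b, c, d, e, f, ⟨rfl, rfl, rfl, rfl, rfl⟩, h1, h2, h3, h4, h5⟩ := hguard.mp hg
    have hmark := markSide_iff hr.rep.1 hr.rep.2.1 (x := b) (y := c) (hE (20, b.1) (by simp))
      (hE (21, c.1) (by simp))
    have hmark' : ∀ u : A, s1 10 u.1 ≠ 0 ↔ u ∈ edgeSide T b c := fun u => by
      rw [hd.mark, hmark]
      exact ⟨fun ⟨_, h⟩ => h, fun h => ⟨u.2, h⟩⟩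
    have hpair : pairGuard.eval s1 ≠ 0 ↔ (e ∈ edgeSide T b c ∧ f ∈ edgeSide T b c ∧ T.Adj e f ∧
        nbag G A e ∩ nbag G A f = nbag G A b ∩ nbag G A c) := by
      simp only [pairGuard, Expr.eval_and, Expr.eval_not, Expr.eval_read, Expr.eval_var,
        hi.eval_entry e23, e23, e24, hmark', ht.iff e f, not_not, hd.label]
    simp only [Expr.eval_read, Expr.eval_var, e22] at hm
    have hm' := hmark' d
  · refine ⟨_, hkeep, Or.inl ⟨rfl, ?_⟩⟩
    intro b' c' d' e' f' hb hc hd' he hf hpu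
    obtain rfl := Subtype.ext hb
    obtain rfl := Subtype.ext hc
    obtain rfl := Subtype.ext hd'
    obtain rfl := Subtype.ext he
    obtain rfl := Subtype.ext hf
    rcases hpu.side with h6 | h6
    · exact hm'.mpr h6 hm
    · exact hpair.mpr h6 hp
  · obtain ⟨h6, h7, h8, h9⟩ := hpair.mp hp
    have h10 : d ∉ edgeSide T b c := fun hc => hm'.mpr hc hm
    have hpush := isPush_slide_slide htree hr.isSupport h4 h6 h7 h8 h9 h5 h10
    obtain ⟨hc1, hc2⟩ := canSlide_canSlide htree h4 h6 h7 h8 h9 h5 h10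
    have ht1 := ht.den_swapCmd hi (by decide) (by decide) (by decide) (by decide)
      e20 e21 e23 e21 (hc1.ne htree)
    set s2 := (swapCmd 20 21 23 21).den s1 with hs2
    have g2 : ∀ a, a ≠ 8 → s2 a = s1 a := fun a ha => den_swapCmd_of_ne _ _ _ _ _ ha
    have hi2 : HoldsInput G A s2 := hi.congr fun a ha => g2 a (by revert a; decide)
    have ht2 := HoldsTree.den_swapCmd (i := 23) (j := 24) (i' := 22) (j' := 24) ht1 hi2 (by decide)
      (by decide) (by decide) (by decide)
      (by rw [g2 _ (by decide), e23]) (by rw [g2 _ (by decide), e24])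
      (by rw [g2 _ (by decide), e22]) (by rw [g2 _ (by decide), e24])
      (hc2.ne (hc1.isTree htree))
    have hlt := pushPotential_push n hpush h3
    refine ⟨(_, h), ⟨hr1.push hpush h1 h3 (ht2.setCell (by decide) 0 1) fun a ha => ?_, ?_, ?_⟩,
      Or.inr ⟨hlt, fun hN => hN b c d e f rfl rfl rfl rfl rfl
        ⟨h1, h2, h3, h4, h5, Or.inr ⟨h6, h7, h8, h9⟩⟩⟩⟩
    · rw [setCell_of_ne (by revert a; decide), den_swapCmd_of_ne _ _ _ _ _ (by revert a; decide),
        g2 _ (by revert a; decide)]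
    · rw [setCell_self]
      exact fun h => absurd h one_ne_zero
    -- If the flag was not set, the old state is the reference state `a₀`; otherwise its potential
    -- is already below that of `a₀`.
    · intro _
      by_cases h0 : s 34 0 = 0
      · rw [← hflag1 h0]
        exact hlt
      · exact lt_trans hlt (hflag2 h0)
  · have h6 := hm'.mp hm
    have hc1 : CanSlide T (nbag G A) b c d := ⟨h4, h6, h5⟩
    have hpush := hc1.isPush htree hr.isSupport
    have ht1 := ht.den_swapCmd hi (by decide) (by decide) (by decide) (by decide)
      e20 e21 e22 e21 (hc1.ne htree)
    have hlt := pushPotential_push n hpush h3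
    refine ⟨(_, h), ⟨hr1.push hpush h1 h3 (ht1.setCell (by decide) 0 1) fun a ha => ?_, ?_, ?_⟩,
      Or.inr ⟨hlt, fun hN => hN b c d e f rfl rfl rfl rfl rfl
        ⟨h1, h2, h3, h4, h5, Or.inl h6⟩⟩⟩
    · rw [setCell_of_ne (by revert a; decide), den_swapCmd_of_ne _ _ _ _ _ (by revert a; decide)]
    · rw [setCell_self]
      exact fun h => absurd h one_ne_zero
    · intro _
      by_cases h0 : s 34 0 = 0
      · rw [← hflag1 h0]
        exact hlt
      · exact lt_trans hlt (hflag2 h0)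

/-- Try all pushes from the vertex `20`. -/
def pushLoop : Cmd := .forn 21 (.forn 22 (.forn 23 (.forn 24 pushStep)))

theorem advances_pushLoop (a₀ : SimpleGraph A × (A → ℕ)) (x : Fin n) :
    Cmd.Advances (RepFlag G A a₀) (statePotential A) (VarsAre [(20, x)]) pushLoop
      (fun a => ∀ y < n, ∀ x' < n, ∀ v < n, ∀ w < n, ∀ b c d e f : A, b.1.1 = x → c.1.1 = y →
        d.1.1 = x' → e.1.1 = v → f.1.1 = w → ¬ Pushable n a.1 (nbag G A) a.2 b c d e f) := by
  have h0 : ∀ s a, RepFlag G A a₀ s a → s 0 0 = n := fun s T h => h.1.rep.1.size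
  have hset : ∀ y ∈ [21, 22, 23, 24], ∀ s a v, RepFlag G A a₀ s a →
      RepFlag G A a₀ (setCell s y 0 v) a := by
    rintro y hy s a v ⟨h1, h2, h3⟩
    have e : setCell s y 0 v 34 = s 34 :=
      setCell_of_ne ((show ∀ y ∈ [21, 22, 23, 24], 34 ≠ y by decide) y hy)
    exact ⟨h1.setCell ((show ∀ y ∈ [21, 22, 23, 24], y ∉ _ by decide) y hy) 0 v, by rwa [e],
      by rwa [e]⟩
  refine Cmd.advances_forn_vars (by decide) h0 (hset 21 (by simp))
    (show ∀ y ∈ [20], y ∉ _ by decide) fun y hy => ?_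
  refine Cmd.advances_forn_vars (by decide) h0 (hset 22 (by simp))
    (show ∀ y ∈ [21, 20], y ∉ _ by decide) fun x' hx' => ?_
  refine Cmd.advances_forn_vars (by decide) h0 (hset 23 (by simp))
    (show ∀ y ∈ [22, 21, 20], y ∉ _ by decide) fun v hv => ?_
  refine Cmd.advances_forn_vars (by decide) h0 (hset 24 (by simp))
    (show ∀ y ∈ [23, 22, 21, 20], y ∉ _ by decide) fun w hw => ?_
  have := advances_pushStep (G := G) (A := A) a₀ x ⟨y, hy⟩ ⟨x', hx'⟩ ⟨v, hv⟩ ⟨w, hw⟩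
  simpa only [Fin.ext_iff] using this

/-- Raise the vertex `20` if it is an active branch vertex. -/
def raiseStep : Cmd :=
  .seq (.count 33 28 (.entry 8 20 28))
    (.ite (.and (.lt (.const 2) (.var 33)) (.and (.read 1 (.var 20))
        (.lt (.read 9 (.var 20)) (.add (.var 0) (.const 1)))))
      (.write 9 (.var 20) (.add (.read 9 (.var 20)) (.const 1))) .skip)

/-- Process the vertex `20`: push as long as possible, and raise it if no push was possible. -/
def processVertex : Cmd :=
  .seq (.write 34 (.const 0) (.const 0))
    (.seq pushLoop (.ite (.var 34) .skip raiseStep))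

theorem den_raiseStep {a : SimpleGraph A × (A → ℕ)} (hr : RepPush G A s a) {x : Fin n}
    (hx : s 20 0 = x)
    (hno : ∀ b c d e f : A, b.1 = x → ¬ Pushable n a.1 (nbag G A) a.2 b c d e f) :
    ∃ a', RepPush G A (raiseStep.den s) a' ∧
      ((a' = a ∧ ∀ b : A, b.1 = x → ¬ (3 ≤ vdeg a.1 b ∧ a.2 b ≤ n)) ∨
        (statePotential A a' < statePotential A a ∧
          ¬ ∀ b : A, b.1 = x → ¬ (3 ≤ vdeg a.1 b ∧ a.2 b ≤ n))) := by
  classical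
  obtain ⟨T, h⟩ := a
  set c := Cmd.count 33 28 (.entry 8 20 28) with hc
  set s1 := c.den s with hs1
  have f1 : ∀ a, a ∉ [33, 28, 33] → s1 a = s a := fun a ha =>
    Cmd.den_of_not_mem_writes _ ha _
  have hr1 : RepPush G A s1 (T, h) := hr.congr fun a ha => f1 a (by revert a; decide)
  have c33 : s1 33 0 = {z : Fin n | s 8 (n * x + z) ≠ 0}.ncard := by
    refine den_count_eq hr.rep.1.size (by decide) (by decide) fun z => ?_
    rw [entry_eval hr.rep.1 8 (by decide) (by decide) hx]
  have e20 : s1 20 0 = x := by rw [f1 _ (by simp), hx]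
  set e := Expr.and (.lt (.const 2) (.var 33)) (.and (.read 1 (.var 20))
        (.lt (.read 9 (.var 20)) (.add (.var 0) (.const 1)))) with he
  have hguard : e.eval s1 ≠ 0 ↔ ∃ b : A, b.1 = x ∧ (3 ≤ vdeg T b ∧ h b ≤ n) := by
    simp only [he, Expr.eval_and, Expr.eval_lt, Expr.eval_read, Expr.eval_var, Expr.eval_add,
      Expr.eval_const, e20, hr1.rep.1.memA, hr1.rep.1.size, c33]
    constructor
    · rintro ⟨h1, h2, h3⟩
      have e1 := hr1.height ⟨x, h2⟩
      have e2 := vdeg_eq_ncard hr.rep.2.1 ⟨x, h2⟩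
      simp only at e1 e2
      exact ⟨⟨x, h2⟩, rfl, by omega, by omega⟩
    · rintro ⟨b, rfl, h1, h2⟩
      have e1 := hr1.height b
      have e2 := vdeg_eq_ncard hr.rep.2.1 b
      simp only at e1 e2
      exact ⟨by omega, b.2, by omega⟩
  have hden : raiseStep.den s = if e.eval s1 = 0 then s1 else
    setCell s1 9 (s1 20 0) (s1 9 (s1 20 0) + 1) := rfl
  rw [hden]
  split_ifs with hg
  · exact ⟨_, hr1, Or.inl ⟨rfl, fun b hb h1 => hguard.mpr ⟨b, hb, h1⟩ hg⟩⟩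
  · obtain ⟨b, rfl, h1, h2⟩ := hguard.mp hg
    refine ⟨(T, Function.update h b (h b + 1)), ⟨?_, fun u => ?_, hr1.isSupport,
      hr1.level.raise h1 h2 fun c d e f => hno b c d e f rfl, fun u hu => ?_, fun u => ?_⟩,
      Or.inr ⟨pushPotential_raise (card_subset_le A) h2, fun hN => hN b rfl ⟨h1, h2⟩⟩⟩
    · exact ⟨hr1.rep.1.setCell (by decide) _ _, hr1.rep.2.1.setCell (by decide) _ _, hr1.rep.2.2⟩
    · have e1 := hr1.height b
      have e2 := hr1.height u
      simp only at e1 e2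
      simp only [setCell_apply, e20, Function.update_apply, e1, e2, ← Fin.ext_iff, Subtype.ext_iff]
    · have hne : u ≠ b := by
        rintro rfl
        have : vdeg T u ≤ 1 := hu
        omega
      simp only [Function.update_of_ne hne]
      exact hr1.leaf u hu
    · have e1 := hr1.le u
      simp only [Function.update_apply] at e1 ⊢
      split_ifs <;> omega

/-- The flag `34` records whether `pushLoop` has changed the state. If it has, the potential has
dropped; if not, no push from `x` is available, which is exactly what allows `x` to be raised. -/
theorem advances_processVertex (x : Fin n) :
    Cmd.Advances (RepPush G A) (statePotential A) (VarsAre [(20, x)]) processVertex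
      (fun a => ∀ b : A, b.1 = x → ¬ (3 ≤ vdeg a.1 b ∧ a.2 b ≤ n)) := by
  intro s a₀ hr hE
  set s1 := setCell s 34 0 0 with hs1
  have hr1 : RepFlag G A a₀ s1 a₀ := ⟨hr.setCell (by decide) 0 0, fun _ => rfl, fun h =>
    absurd (setCell_self _ _ _ _) h⟩
  have hE1 : VarsAre [(20, (x : ℕ))] s1 := hE.congr fun a ha =>
    setCell_of_ne ((show ∀ a ∈ [20], a ≠ 34 by decide) a ha)
  obtain ⟨a, ⟨hr2, hf1, hf2⟩, h2⟩ := advances_pushLoop a₀ x s1 a₀ hr1 hE1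
  set s2 := pushLoop.den s1 with hs2
  have hE2 : VarsAre [(20, (x : ℕ))] s2 := hE1.den _ (show ∀ a ∈ [20], a ∉ _ by decide)
  have hden : processVertex.den s = if s2 34 0 = 0 then raiseStep.den s2 else s2 := rfl
  rw [hden]
  rcases h2 with ⟨rfl, h2⟩ | ⟨h2, h3⟩
  · have h34 : s2 34 0 = 0 := by
      by_contra hc
      exact lt_irrefl _ (hf2 hc)
    rw [if_pos h34]
    exact den_raiseStep hr2 (hE2 (20, (x : ℕ)) (by simp)) fun b c d e f hb hp =>
      h2 c c.1.2 d d.1.2 e e.1.2 f f.1.2 b c d e f (congrArg _ hb) rfl rfl rfl rfl hp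
  · have h34 : s2 34 0 ≠ 0 := by
      intro hc
      rw [hf1 hc] at h2
      exact lt_irrefl _ h2
    rw [if_neg h34]
    refine ⟨a, hr2, Or.inr ⟨h2, fun hN => h3 ?_⟩⟩
    intro y _ x' _ v _ w _ b c d e f hb _ _ _ _ hp
    exact hN b (Fin.ext hb) ⟨hp.branch, hp.le⟩

/-- One pass of the search for a support with the fewest leaves. -/
def pushPass : Cmd := .forn 20 processVertex

/-- Turn a support into one with the fewest leaves. -/
def pushCmd : Cmd :=
  .seq (cubeRepeat pushPass) (.seq (cubeRepeat pushPass) (.seq (cubeRepeat pushPass)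
    (.seq (cubeRepeat pushPass) (cubeRepeat pushPass))))

theorem advances_pushPass : Cmd.Advances (RepPush G A) (statePotential A) (fun _ => True) pushPass
    fun a => ∀ x < n, ∀ b : A, b.1.1 = x → ¬ (3 ≤ vdeg a.1 b ∧ a.2 b ≤ n) := by
  have key : Cmd.Advances (RepPush G A) (statePotential A) (VarsAre []) pushPass
      fun a => ∀ x < n, ∀ b : A, b.1.1 = x → ¬ (3 ≤ vdeg a.1 b ∧ a.2 b ≤ n) := by
    refine Cmd.advances_forn_vars (by decide) (fun s a h => h.rep.1.size)
      (fun s a v h => h.setCell (by decide) 0 v) (by simp) fun x hx => ?_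
    have := advances_processVertex (G := G) (A := A) ⟨x, hx⟩
    simpa only [Fin.ext_iff] using this
  intro s T hs _
  exact key s T hs (fun q hq => absurd hq List.not_mem_nil)

/-- All heights start at `0`, where the invariant is trivial. The initial potential is at most `2 *
n * (n * (n + 1)) ≤ 4 * n ^ 3`, so `5 * n ^ 3` passes reach a state in which every branch vertex has
height `n + 1`, and `leafCount_le` applies. -/
theorem den_pushCmd (hn : 1 ≤ n) (h : RepTree G A s T) (hS : IsSupport T (nbag G A))
    (h9 : ∀ v < n, s 9 v = 0) :
    ∃ T' : SimpleGraph A, RepTree G A (pushCmd.den s) T' ∧ IsSupport T' (nbag G A) ∧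
      ∀ H : SimpleGraph A, H.IsTree → IsSupport H (nbag G A) → leafCount T' ≤ leafCount H := by
  classical
  have hR : ∀ x ∈ [40, 41, 42], ∀ s a v, RepPush G A s a →
      RepPush G A (LinMim.setCell s x 0 v) a := fun x hx s a v h =>
    h.setCell (by revert x; decide) 0 v
  have hit := iterates_cubeRepeat hn (by decide) (fun s a h => h.rep.1.size) hR
    (advances_pushPass (G := G) (A := A))
  have h0 : RepPush G A s (T, fun _ => 0) := ⟨h, fun u => h9 u u.1.2, hS,
    fun _ _ _ _ => Nat.zero_le _, fun _ _ => rfl, fun _ => Nat.zero_le _⟩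
  obtain ⟨⟨T', f⟩, h1, h2⟩ := hit.seq (hit.seq (hit.seq (hit.seq hit))) s _ h0
  refine ⟨T', h1.rep, h1.isSupport, fun H hH hHS => ?_⟩
  rcases h2 with h2 | ⟨h2, -⟩
  · refine leafCount_le h1.rep.2.2 h1.isSupport hH hHS (card_subset_le A) h1.level h1.leaf
      fun u hu => ?_
    have h3 := h2 u u.1.2 u rfl
    have h4 := h1.le u
    simp only at h3 h4
    have h5 : ¬ f u ≤ n := fun h => h3 ⟨hu, h⟩
    change f u = n + 1
    omega
  · exfalso
    have h3 : statePotential A (T, fun _ => 0) ≤ 2 * n * (n * (n + 1)) :=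
      pushPotential_zero_le (card_subset_le A)
    have h4 : n * n ≤ n * (n * n) := by nlinarith
    have h5 : 1 ≤ n * (n * n) := Nat.mul_pos hn (Nat.mul_pos hn hn)
    have h6 : 2 * n * (n * (n + 1)) = 2 * (n * (n * n)) + 2 * (n * n) := by ring
    rw [mul_one] at h2
    omega

end Push

/-! ### Computing the elimination order -/

/-- Root the tree at `r` and take a vertex of `U` farthest from `r`: its only possible neighbour in
`U` is its predecessor on the path from `r`. So the elimination never gets stuck. -/
theorem exists_subsingleton_neighbors {α : Type*} [Finite α] {T : SimpleGraph α} (hT : T.IsTree)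
    {U : Set α} (hU : U.Nonempty) : ∃ u ∈ U, {z | T.Adj u z ∧ z ∈ U}.Subsingleton := by
  obtain ⟨r⟩ := hT.connected.nonempty
  obtain ⟨u, hu, hmax⟩ := Set.exists_max_image U (fun u => T.dist r u) (Set.toFinite U) hU
  obtain ⟨p, hp, hpl⟩ := hT.connected.exists_path_of_dist r u
  have key : ∀ z, T.Adj u z → z ∈ U → z = p.penultimate := by
    intro z hz hzU
    obtain ⟨q, hq, hql⟩ := hT.connected.exists_path_of_dist r z
    refine hT.isAcyclic.eq_penultimate_of_adj_end hp hz
      (hT.isAcyclic.mem_support_of_ne_mem_support_of_adj_of_isPath hp hq hz fun huq => ?_)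
    have h1 := congrArg SimpleGraph.Walk.length (hT.isAcyclic.path_concat hp hq hz huq)
    rw [SimpleGraph.Walk.length_concat] at h1
    have h2 := hmax z hzU
    omega
  exact ⟨u, hu, fun z hz w hw => (key z hz.1 hz.2).trans (key w hw.1 hw.2).symm⟩

/-- The vertices in `P` have been placed at the positions `0, …, c - 1`. -/
structure IsPartialElimination {V : Type*} (G : SimpleGraph V) (A : Set V) (T : SimpleGraph A)
    (P : Set V) (pos : V → ℕ) (c : ℕ) : Prop where
  bijOn : Set.BijOn pos P (Set.Iio c)
  before : ∀ b ∉ A, b ∈ P → ∀ a, G.Adj b a → a ∈ P ∧ pos a < pos b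
  up : ∀ a : A, a.1 ∈ P → {z : A | T.Adj a z ∧ (z.1 ∈ P → pos a < pos z)}.Subsingleton
  ready : ∀ a ∈ A, a ∈ P → ∀ b ∉ A, (∀ z, G.Adj b z → z ∈ P ∧ pos z < pos a) →
    b ∈ P ∧ pos b < pos a

/-! ### Extending partial elimination orders -/

namespace IsPartialElimination

variable {V : Type*} {G : SimpleGraph V} {A : Set V} {T : SimpleGraph A} {P : Set V} {pos : V → ℕ}
  {c : ℕ}

theorem empty (pos : V → ℕ) : IsPartialElimination G A T ∅ pos 0 := by
  refine ⟨?_, fun b _ hb => absurd hb (Set.notMem_empty b), fun a ha =>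
    absurd ha (Set.notMem_empty _), fun a _ ha => absurd ha (Set.notMem_empty a)⟩
  rw [show Set.Iio 0 = (∅ : Set ℕ) from Set.eq_empty_iff_forall_notMem.mpr fun x hx =>
    Nat.not_lt_zero x hx]
  exact Set.bijOn_empty _

theorem bijOn_insert [DecidableEq V] (h : IsPartialElimination G A T P pos c) {x : V}
    (hx : x ∉ P) : Set.BijOn (Function.update pos x c) (insert x P) (Set.Iio (c + 1)) := by
  have h1 : Set.EqOn (Function.update pos x c) pos P := fun v hv =>
    Function.update_of_ne (fun he : v = x => hx (he ▸ hv)) _ _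
  have h2 := (h.bijOn.congr h1.symm).insert (a := x) (by
    rw [Function.update_self]
    exact lt_irrefl c)
  rw [Function.update_self] at h2
  have h3 : insert c (Set.Iio c) = Set.Iio (c + 1) := by
    ext i
    simp only [Set.mem_insert_iff, Set.mem_Iio]
    omega
  rwa [h3] at h2

theorem place_not_mem [DecidableEq V] (h : IsPartialElimination G A T P pos c)
    (hG : G.IsBipartiteWith A Aᶜ) {x : V} (hx : x ∉ P) (hxA : x ∉ A)
    (hnb : ∀ z, G.Adj x z → z ∈ P) :
    IsPartialElimination G A T (insert x P) (Function.update pos x c) (c + 1) := by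
  have hne : ∀ {v}, v ∈ P → Function.update pos x c v = pos v := fun {v} hv =>
    Function.update_of_ne (fun he : v = x => hx (he ▸ hv)) _ _
  have hneA : ∀ {v}, v ∈ A → v ≠ x := fun hv he => hxA (he ▸ hv)
  have hmem : ∀ {v}, v ∈ A → v ∈ insert x P → v ∈ P := fun hv h =>
    h.resolve_left (hneA hv)
  have hlt : ∀ {v}, v ∈ P → pos v < c := fun hv => h.bijOn.mapsTo hv
  refine ⟨h.bijOn_insert hx, fun b hb hbP a hba => ?_, fun a ha => ?_, fun a haA haP b hb hz => ?_⟩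
  · rcases hbP with rfl | hbP
    · have ha := hnb a hba
      rw [hne ha, Function.update_self]
      exact ⟨Or.inr ha, hlt ha⟩
    · obtain ⟨h1, h2⟩ := h.before b hb hbP a hba
      rw [hne h1, hne hbP]
      exact ⟨Or.inr h1, h2⟩
  · have ha := hmem a.2 ha
    refine (h.up a ha).anti ?_
    rintro z ⟨h1, h2⟩
    refine ⟨h1, fun hz => ?_⟩
    have := h2 (Or.inr hz)
    rwa [hne ha, hne hz] at this
  · have haP := hmem haA haP
    obtain ⟨h1, h2⟩ := h.ready a haA haP b hb fun z hbz => by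
      have hzA : z ∈ A := by
        rcases hG.mem_of_adj hbz with h | h
        · exact absurd h.1 hb
        · exact h.2
      obtain ⟨h1, h2⟩ := hz z hbz
      have h1 := hmem hzA h1
      rw [hne h1, hne haP] at h2
      exact ⟨h1, h2⟩
    rw [hne h1, hne haP]
    exact ⟨Or.inr h1, h2⟩

/-- `hsub` leaves `x` at most one upper neighbour, as unplaced neighbours come later. `hready` says
that nothing outside `A` is overdue, which is what `ready` demands of the new last element `x`. -/
theorem place_mem [DecidableEq V] (h : IsPartialElimination G A T P pos c) (x : A) (hx : x.1 ∉ P)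
    (hsub : {z : A | T.Adj x z ∧ z.1 ∉ P}.Subsingleton)
    (hready : ∀ b ∉ A, (∀ z, G.Adj b z → z ∈ P) → b ∈ P) :
    IsPartialElimination G A T (insert x.1 P) (Function.update pos x.1 c) (c + 1) := by
  have hne : ∀ {v}, v ∈ P → Function.update pos x.1 c v = pos v := fun {v} hv =>
    Function.update_of_ne (fun he : v = x.1 => hx (he ▸ hv)) _ _
  have hlt : ∀ {v}, v ∈ P → pos v < c := fun hv => h.bijOn.mapsTo hv
  have hneB : ∀ {v}, v ∉ A → v ≠ x.1 := fun hv he => hv (he ▸ x.2)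
  refine ⟨h.bijOn_insert hx, fun b hb hbP a hba => ?_, fun a ha => ?_, fun a haA haP b hb hz => ?_⟩
  · have hbP := hbP.resolve_left (hneB hb)
    obtain ⟨h1, h2⟩ := h.before b hb hbP a hba
    rw [hne h1, hne hbP]
    exact ⟨Or.inr h1, h2⟩
  · by_cases hax : a = x
    · subst hax
      refine hsub.anti ?_
      rintro z ⟨h1, h2⟩
      refine ⟨h1, fun hz => ?_⟩
      have h3 := h2 (Or.inr hz)
      rw [hne hz, Function.update_self] at h3
      have h4 := hlt hz
      omega
    · have ha := ha.resolve_left fun he => hax (Subtype.ext he)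
      refine (h.up a ha).anti ?_
      rintro z ⟨h1, h2⟩
      refine ⟨h1, fun hz => ?_⟩
      have := h2 (Or.inr hz)
      rwa [hne ha, hne hz] at this
  · rcases haP with rfl | haP
    · have hzP : ∀ z, G.Adj b z → z ∈ P := fun z hbz => by
        obtain ⟨h1, h2⟩ := hz z hbz
        exact h1.resolve_left fun he => (ne_of_lt h2) (by rw [he])
      have hbP := hready b hb hzP
      rw [hne hbP, Function.update_self]
      exact ⟨Or.inr hbP, hlt hbP⟩
    · obtain ⟨h1, h2⟩ := h.ready a haA haP b hb fun z hbz => by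
        obtain ⟨h1, h2⟩ := hz z hbz
        rw [hne haP] at h2
        rcases h1 with rfl | h1
        · rw [Function.update_self] at h2
          have := hlt haP
          omega
        · rw [hne h1] at h2
          exact ⟨h1, h2⟩
      rw [hne h1, hne haP]
      exact ⟨Or.inr h1, h2⟩

theorem isEliminationOrder (h : IsPartialElimination G A T P pos c) (hP : ∀ v, v ∈ P) :
    IsEliminationOrder G A T pos := by
  refine ⟨fun u v huv => h.bijOn.injOn (hP u) (hP v) huv,
    fun b hb a hba => (h.before b hb (hP b) a hba).2, fun a => (h.up a (hP a)).anti ?_,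
    fun a ha b hb hz => (h.ready a ha (hP a) b hb fun z hbz => ⟨hP z, hz z hbz⟩).2⟩
  rintro z ⟨h1, h2⟩
  exact ⟨h1, fun _ => h2⟩

end IsPartialElimination

section Order

variable {n : ℕ} {G : SimpleGraph (Fin n)} {A : Set (Fin n)} {T : SimpleGraph A} {s : Memory}

/-- The memory holds the input, a tree and a partial elimination order. -/
structure RepOrder (G : SimpleGraph (Fin n)) (A : Set (Fin n)) (T : SimpleGraph A) (s : Memory) :
    Prop where
  input : HoldsInput G A s
  tree : HoldsTree T s
  order : IsPartialElimination G A T {v : Fin n | s 11 v ≠ 0} (fun v => s 6 v) (s 36 0)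

theorem RepOrder.congr {s' : Memory} (h : RepOrder G A T s)
    (hs : ∀ a ∈ [0, 1, 2, 7, 8, 11, 6, 36], s' a = s a) : RepOrder G A T s' := by
  refine ⟨h.input.congr fun a ha => hs a ?_, h.tree.congr (hs 8 (by simp)), ?_⟩
  · simp only [List.mem_cons, List.not_mem_nil, or_false] at ha ⊢
    tauto
  · rw [hs 11 (by simp), hs 6 (by simp), hs 36 (by simp)]
    exact h.order

/-- Give the vertex `20` the next position. -/
def placeCmd : Cmd :=
  .seq (.write 11 (.var 20) (.const 1))
    (.seq (.write 6 (.var 20) (.var 36)) (.write 36 (.const 0) (.add (.var 36) (.const 1))))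

theorem den_placeCmd (h : RepOrder G A T s) {x : Fin n} (hx : s 20 0 = x)
    (hpl : IsPartialElimination G A T (insert x {v : Fin n | s 11 v ≠ 0})
      (Function.update (fun v : Fin n => s 6 v) x (s 36 0)) (s 36 0 + 1)) :
    RepOrder G A T (placeCmd.den s) ∧
      ∀ v : Fin n, placeCmd.den s 11 v ≠ 0 ↔ v = x ∨ s 11 v ≠ 0 := by
  have h11 : ∀ v : Fin n, placeCmd.den s 11 v ≠ 0 ↔ v = x ∨ s 11 v ≠ 0 := by
    intro v
    have : placeCmd.den s 11 v = if v = x then 1 else s 11 v := by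
      simp only [placeCmd, Cmd.den, Expr.eval_var, Expr.eval_const, Expr.eval_add,
        setCell_of_ne (show 11 ≠ 36 by decide), setCell_of_ne (show 11 ≠ 6 by decide),
        setCell_apply, hx, Fin.ext_iff]
    rw [this]
    split_ifs with hv
    · simp [hv]
    · simp [hv]
  have h6 : (fun v : Fin n => placeCmd.den s 6 v) =
      Function.update (fun v : Fin n => s 6 v) x (s 36 0) := by
    funext v
    simp only [placeCmd, Cmd.den, Expr.eval_var, Expr.eval_const, Expr.eval_add,
      setCell_of_ne (show 6 ≠ 36 by decide), setCell_of_ne (show 6 ≠ 11 by decide),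
      setCell_of_ne (show 36 ≠ 11 by decide), setCell_of_ne (show 20 ≠ 11 by decide),
      setCell_apply, hx, Function.update_apply, Fin.ext_iff]
  have h36 : placeCmd.den s 36 0 = s 36 0 + 1 := by
    simp only [placeCmd, Cmd.den, Expr.eval_var, Expr.eval_const, Expr.eval_add,
      setCell_of_ne (show 36 ≠ 6 by decide), setCell_of_ne (show 36 ≠ 11 by decide), setCell_self]
  refine ⟨⟨h.input.den _ (by decide), h.tree.den _ (by decide), ?_⟩, h11⟩
  rw [h6, h36]
  convert hpl using 1
  ext v
  exact h11 v

/-- Place the vertex `20` if it lies outside `A` and all its neighbours have been placed. -/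
def readyStep : Cmd :=
  .seq (.count 30 28 (.and (.entry 2 20 28) (.not (.read 11 (.var 28)))))
    (.ite (.and (.not (.read 1 (.var 20))) (.and (.not (.read 11 (.var 20))) (.not (.var 30))))
      placeCmd .skip)

/-- Place all vertices outside `A` all whose neighbours have been placed. -/
def readyPass : Cmd := .forn 20 readyStep

theorem den_readyStep (hG : G.IsBipartiteWith A Aᶜ) (h : RepOrder G A T s) {x : Fin n}
    (hx : s 20 0 = x) :
    RepOrder G A T (readyStep.den s) ∧ (∀ v : Fin n, s 11 v ≠ 0 → readyStep.den s 11 v ≠ 0) ∧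
      (∀ a : A, readyStep.den s 11 a.1 ≠ 0 → s 11 a.1 ≠ 0) ∧
      (x ∉ A → (∀ z : Fin n, G.Adj x z → s 11 z ≠ 0) → readyStep.den s 11 x ≠ 0) := by
  set c := Cmd.count 30 28 (.and (.entry 2 20 28) (.not (.read 11 (.var 28)))) with hc
  set s1 := c.den s with hs1
  have f1 : ∀ a, a ∉ [30, 28, 30] → s1 a = s a := fun a ha => Cmd.den_of_not_mem_writes _ ha _
  have h1 : RepOrder G A T s1 := h.congr fun a ha => f1 a (by revert a; decide)
  have e11 : s1 11 = s 11 := f1 _ (by simp)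
  have e20 : s1 20 0 = x := by rw [f1 _ (by simp), hx]
  have c30 : s1 30 0 = {z : Fin n | G.Adj x z ∧ ¬ s 11 z ≠ 0}.ncard := by
    refine den_count_eq h.input.size (by decide) (by decide) fun z => ?_
    rw [Expr.eval_and, Expr.eval_not, entry_eval h.input 2 (by decide) (by decide) hx, h.input.adj,
      Expr.eval_read, Expr.eval_var, setCell_self, setCell_of_ne (by decide)]
  set e := Expr.and (.not (.read 1 (.var 20))) (.and (.not (.read 11 (.var 20))) (.not (.var 30)))
    with he
  have hguard : e.eval s1 ≠ 0 ↔ x ∉ A ∧ ¬ s 11 x ≠ 0 ∧ ∀ z : Fin n, G.Adj x z → s 11 z ≠ 0 := by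
    have hc30 : ¬ s1 30 0 ≠ 0 ↔ ∀ z : Fin n, G.Adj x z → s 11 z ≠ 0 := by
      rw [c30, not_not, Set.ncard_eq_zero, Set.eq_empty_iff_forall_notMem]
      exact forall_congr' fun z => ⟨fun h hz => by_contra fun hc => h ⟨hz, hc⟩, fun h hz => hz.2 (h hz.1)⟩
    rw [he, Expr.eval_and, Expr.eval_and, Expr.eval_not, Expr.eval_not, Expr.eval_not,
      Expr.eval_read, Expr.eval_read, Expr.eval_var, Expr.eval_var, e20, h1.input.memA, e11, hc30]
  have hden : readyStep.den s = if e.eval s1 = 0 then s1 else placeCmd.den s1 := rfl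
  rw [hden]
  split_ifs with hg
  · refine ⟨h1, fun v hv => by rwa [e11], fun a ha => by rwa [e11] at ha, fun hxA hz => ?_⟩
    by_contra hc
    rw [e11] at hc
    exact hguard.mpr ⟨hxA, not_not.mpr hc, hz⟩ hg
  · obtain ⟨hxA, hxP, hz⟩ := hguard.mp hg
    obtain ⟨h2, h3⟩ := den_placeCmd h1 e20 (h1.order.place_not_mem hG (by
      rw [Set.mem_ofPred_eq, e11]
      exact hxP) hxA fun z hxz => by
        rw [Set.mem_ofPred_eq, e11]
        exact hz z hxz)
    rw [e11] at h3
    exact ⟨h2, fun v hv => (h3 v).mpr (Or.inr hv), fun a ha =>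
      ((h3 a).mp ha).resolve_left fun he => hxA (he ▸ a.2), fun _ _ => (h3 x).mpr (Or.inl rfl)⟩

/-- All vertices outside `A` with placed neighbours have been placed. -/
def AllReady (G : SimpleGraph (Fin n)) (A : Set (Fin n)) (s : Memory) : Prop :=
  ∀ b ∉ A, (∀ z : Fin n, G.Adj b z → s 11 z ≠ 0) → s 11 (b : Fin n) ≠ 0

/-- Neighbours of vertices outside `A` lie in `A`, and the pass does not place any vertex of `A`. So
readiness does not change during the pass and one pass is enough. -/
theorem den_readyPass (hG : G.IsBipartiteWith A Aᶜ) (h : RepOrder G A T s) :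
    RepOrder G A T (readyPass.den s) ∧ (∀ a : A, readyPass.den s 11 a.1 ≠ 0 ↔ s 11 a.1 ≠ 0) ∧
      AllReady G A (readyPass.den s) := by
  have hGA : ∀ {b z : Fin n}, b ∉ A → G.Adj b z → z ∈ A := fun hb hbz => by
    rcases hG.mem_of_adj hbz with h | h
    · exact absurd h.1 hb
    · exact h.2
  have key := Cmd.forn_rule (x := 20) (p := readyStep) (by decide) h.input.size
    (fun i s' => RepOrder G A T s' ∧ (∀ a : A, s' 11 a.1 ≠ 0 ↔ s 11 a.1 ≠ 0) ∧
      ∀ b : Fin n, b.1 < i → b ∉ A → (∀ z : Fin n, G.Adj b z → s 11 z ≠ 0) → s' 11 b ≠ 0) ?_ ?_ ?_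
  · obtain ⟨h1, h2, h3⟩ := key
    refine ⟨h1, h2, fun b hb hz => h3 b b.2 hb fun z hbz => ?_⟩
    exact (h2 ⟨z, hGA hb hbz⟩).mp (hz z hbz)
  · rintro i s' v ⟨h1, h2, h3⟩
    have e : setCell s' 20 0 v 11 = s' 11 := setCell_of_ne (by decide)
    exact ⟨h1.congr fun a ha => setCell_of_ne (by revert a; decide), by rwa [e], by rwa [e]⟩
  · exact ⟨h, fun _ => Iff.rfl, fun b hb => absurd hb (Nat.not_lt_zero _)⟩
  · rintro i s' hi ⟨h1, h2, h3⟩ hx -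
    obtain ⟨h4, h5, h6, h7⟩ := den_readyStep hG h1 (x := ⟨i, hi⟩) hx
    refine ⟨h4, fun a => ⟨fun ha => (h2 a).mp (h6 a ha), fun ha => h5 a ((h2 a).mpr ha)⟩, ?_⟩
    intro b hb hbA hz
    rcases Nat.lt_succ_iff_lt_or_eq.mp hb with hb | hb
    · exact h5 b (h3 b hb hbA hz)
    · obtain rfl : b = ⟨i, hi⟩ := Fin.ext hb
      exact h7 hbA fun z hbz => (h2 ⟨z, hGA hbA hbz⟩).mpr (hz z hbz)

/-- Place the vertex `20` if it lies in `A`, has at most one neighbour in the tree that has not been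
placed, and the flag `34` is not set; then set the flag. -/
def eliminateStep : Cmd :=
  .seq (.count 30 28 (.and (.entry 8 20 28) (.not (.read 11 (.var 28)))))
    (.ite (.and (.read 1 (.var 20)) (.and (.not (.read 11 (.var 20)))
        (.and (.lt (.var 30) (.const 2)) (.not (.var 34)))))
      (.seq placeCmd (.write 34 (.const 0) (.const 1))) .skip)

/-- Place one vertex of `A`. -/
def eliminatePass : Cmd := .seq (.write 34 (.const 0) (.const 0)) (.forn 20 eliminateStep)

/-- The flag `34` limits the pass to one vertex of `A`, because after its placement some vertex
outside `A` may have become ready and must come first. By `exists_subsingleton_neighbors` a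
candidate exists while `A` is not exhausted. -/
theorem den_eliminatePass (hT : T.IsTree) (h : RepOrder G A T s) (hready : AllReady G A s) :
    RepOrder G A T (eliminatePass.den s) ∧
      (∀ a : A, s 11 a.1 ≠ 0 → eliminatePass.den s 11 a.1 ≠ 0) ∧
      ((∀ a : A, s 11 a.1 ≠ 0) ∨ ∃ a : A, ¬ s 11 a.1 ≠ 0 ∧ eliminatePass.den s 11 a.1 ≠ 0) := by
  set s0 := setCell s 34 0 0 with hs0
  have hRep0 : RepOrder G A T s0 := h.congr fun a ha => setCell_of_ne (by revert a; decide)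
  have e11 : s0 11 = s 11 := setCell_of_ne (by decide)
  have hden : eliminatePass.den s = (Cmd.forn 20 eliminateStep).den s0 := rfl
  have key := Cmd.forn_rule (x := 20) (p := eliminateStep) (by decide) hRep0.input.size
    (fun i s' => RepOrder G A T s' ∧ (∀ a : A, s 11 a.1 ≠ 0 → s' 11 a.1 ≠ 0) ∧
      (s' 34 0 = 0 → s' 11 = s 11 ∧ ∀ a : A, a.1.1 < i → ¬ s 11 a.1 ≠ 0 →
        ¬ {z : A | T.Adj a z ∧ ¬ s 11 z.1 ≠ 0}.Subsingleton) ∧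
      (s' 34 0 ≠ 0 → ∃ a : A, ¬ s 11 a.1 ≠ 0 ∧ s' 11 a.1 ≠ 0)) ?_ ?_ ?_
  · rw [hden]
    obtain ⟨h1, h2, h3, h4⟩ := key
    refine ⟨h1, h2, ?_⟩
    by_cases hf : (Cmd.forn 20 eliminateStep).den s0 34 0 = 0
    · left
      by_contra hc
      push Not at hc
      obtain ⟨a, ha⟩ := hc
      obtain ⟨u, hu, hsub⟩ := exists_subsingleton_neighbors hT
        (U := {a : A | ¬ s 11 a.1 ≠ 0}) ⟨a, not_not.mpr ha⟩
      exact (h3 hf).2 u u.1.2 hu hsub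
    · exact Or.inr (h4 hf)
  · rintro i s' v ⟨h1, h2, h3, h4⟩
    have e1 : setCell s' 20 0 v 11 = s' 11 := setCell_of_ne (by decide)
    have e2 : setCell s' 20 0 v 34 = s' 34 := setCell_of_ne (by decide)
    exact ⟨h1.congr fun a ha => setCell_of_ne (by revert a; decide), by rwa [e1],
      by rwa [e1, e2], by rwa [e1, e2]⟩
  · refine ⟨hRep0, fun a ha => by rwa [e11], fun _ => ⟨e11, fun a ha => absurd ha (Nat.not_lt_zero _)⟩,
      fun hc => absurd (setCell_self _ _ _ _) hc⟩
  · rintro i s2 hi ⟨h1, h2, h3, h4⟩ hx -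
    set c := Cmd.count 30 28 (.and (.entry 8 20 28) (.not (.read 11 (.var 28)))) with hc
    set s3 := c.den s2 with hs3
    have f1 : ∀ a, a ∉ [30, 28, 30] → s3 a = s2 a := fun a ha => Cmd.den_of_not_mem_writes _ ha _
    have h5 : RepOrder G A T s3 := h1.congr fun a ha => f1 a (by revert a; decide)
    have g11 : s3 11 = s2 11 := f1 _ (by simp)
    have g34 : s3 34 = s2 34 := f1 _ (by simp)
    have e20 : s3 20 0 = (⟨i, hi⟩ : Fin n) := by rw [f1 _ (by simp), hx]
    have c30 : ∀ hA : ⟨i, hi⟩ ∈ A, s3 30 0 < 2 ↔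
        {z : A | T.Adj ⟨⟨i, hi⟩, hA⟩ z ∧ ¬ s2 11 z.1 ≠ 0}.Subsingleton := by
      intro hA
      have : s3 30 0 = {z : Fin n | s2 8 (n * i + z) ≠ 0 ∧ ¬ s2 11 z ≠ 0}.ncard := by
        refine den_count_eq h1.input.size (by decide) (by decide) fun z => ?_
        rw [Expr.eval_and, Expr.eval_not, entry_eval h1.input 8 (by decide) (by decide)
          (x := ⟨i, hi⟩) hx, Expr.eval_read, Expr.eval_var, setCell_self,
          setCell_of_ne (by decide)]
      rw [this, Nat.lt_succ_iff, Set.ncard_le_one_iff_subsingleton]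
      have hT' := fun z => h1.tree ⟨i, hi⟩ z
      simp only at hT'
      constructor
      · intro hs z hz w hw
        exact Subtype.ext (hs ⟨(hT' z).mpr ⟨hA, z.2, hz.1⟩, hz.2⟩ ⟨(hT' w).mpr ⟨hA, w.2, hw.1⟩, hw.2⟩)
      · rintro hs z ⟨hz, hz'⟩ w ⟨hw, hw'⟩
        obtain ⟨_, hzA, hz⟩ := (hT' z).mp hz
        obtain ⟨_, hwA, hw⟩ := (hT' w).mp hw
        exact congrArg Subtype.val (hs (x := ⟨z, hzA⟩) ⟨hz, hz'⟩ (y := ⟨w, hwA⟩) ⟨hw, hw'⟩)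
    set e := Expr.and (.read 1 (.var 20)) (.and (.not (.read 11 (.var 20)))
        (.and (.lt (.var 30) (.const 2)) (.not (.var 34)))) with he
    have hmem : s3 1 i ≠ 0 ↔ ⟨i, hi⟩ ∈ A := h5.input.memA ⟨i, hi⟩
    have hguard : e.eval s3 ≠ 0 ↔ ∃ hA : ⟨i, hi⟩ ∈ A, ¬ s2 11 i ≠ 0 ∧
        {z : A | T.Adj ⟨⟨i, hi⟩, hA⟩ z ∧ ¬ s2 11 z.1 ≠ 0}.Subsingleton ∧ s2 34 0 = 0 := by
      simp only [he, Expr.eval_and, Expr.eval_not, Expr.eval_read, Expr.eval_lt, Expr.eval_var,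
        Expr.eval_const, e20, hmem, g11, g34]
      constructor
      · rintro ⟨h6, h7, h8, h9⟩
        exact ⟨h6, h7, (c30 h6).mp h8, not_not.mp h9⟩
      · rintro ⟨h6, h7, h8, h9⟩
        exact ⟨h6, h7, (c30 h6).mpr h8, not_not.mpr h9⟩
    have hden : eliminateStep.den s2 = if e.eval s3 = 0 then s3 else
      setCell (placeCmd.den s3) 34 0 1 := rfl
    rw [hden]
    split_ifs with hg
    · refine ⟨h5, by rwa [g11], fun hf => ?_, by rwa [g34, g11]⟩
      rw [g34] at hf
      obtain ⟨h6, h7⟩ := h3 hf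
      refine ⟨by rw [g11, h6], fun a ha haP hsub => ?_⟩
      rcases Nat.lt_succ_iff_lt_or_eq.mp ha with ha | ha
      · exact h7 a ha haP hsub
      · obtain ⟨⟨a', ha'⟩, haA⟩ := a
        obtain rfl : a' = i := ha
        refine hguard.mpr ⟨haA, ?_, ?_, hf⟩ hg
        · rw [h6]
          exact haP
        · rw [h6]
          exact hsub
    · obtain ⟨hA, hP, hsub, hf⟩ := hguard.mp hg
      obtain ⟨h6, h7⟩ := h3 hf
      obtain ⟨h8, h9⟩ := den_placeCmd h5 e20 (h5.order.place_mem ⟨⟨i, hi⟩, hA⟩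
        (by rw [Set.mem_ofPred_eq, g11]; exact hP) (by
          simp only [Set.mem_ofPred_eq, g11]
          exact hsub) (by
          simp only [Set.mem_ofPred_eq, g11, h6]
          exact hready))
      set s4 := placeCmd.den s3 with hs4
      have k11 : setCell s4 34 0 1 11 = s4 11 := setCell_of_ne (by decide)
      refine ⟨h8.congr fun a ha => setCell_of_ne (by revert a; decide), fun a ha => ?_, fun hc => ?_,
        fun _ => ⟨⟨⟨i, hi⟩, hA⟩, ?_, ?_⟩⟩
      · rw [k11, h9, g11, h6]
        exact Or.inr ha
      · rw [setCell_self] at hc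
        exact absurd hc one_ne_zero
      · rw [← h6]
        exact hP
      · rw [k11, h9]
        exact Or.inl rfl

/-- Compute an elimination order. -/
def orderCmd : Cmd := .seq (.forn 25 (.seq readyPass eliminatePass)) readyPass

/-- Each round places a new vertex of `A` until none is left, so `n` rounds exhaust `A`. The final
pass places the vertices that became ready with the last one. -/
theorem den_orderCmd (hG : G.IsBipartiteWith A Aᶜ) (hT : T.IsTree) (hs : HoldsInput G A s)
    (hsT : HoldsTree T s) (h11 : ∀ v : Fin n, s 11 v = 0) (h36 : s 36 0 = 0) :
    IsEliminationOrder G A T (fun v => orderCmd.den s 6 v) ∧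
      Set.BijOn (fun v : Fin n => orderCmd.den s 6 v) Set.univ (Set.Iio n) := by
  have h0 : RepOrder G A T s := by
    refine ⟨hs, hsT, ?_⟩
    have : {v : Fin n | s 11 v ≠ 0} = ∅ :=
      Set.eq_empty_iff_forall_notMem.mpr fun v hv => hv (h11 v)
    rw [this, h36]
    exact IsPartialElimination.empty _
  have key := Cmd.forn_rule (x := 25) (p := .seq readyPass eliminatePass) (by decide) hs.size
    (fun i s' => RepOrder G A T s' ∧
      ((∀ a : A, s' 11 a.1 ≠ 0) ∨ i ≤ {a : A | s' 11 a.1 ≠ 0}.ncard)) ?_ ?_ ?_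
  · obtain ⟨h1, h2⟩ := key
    set s1 := (Cmd.forn 25 (.seq readyPass eliminatePass)).den s with hs1
    have hA : ∀ a : A, s1 11 a.1 ≠ 0 := by
      rcases h2 with h2 | h2
      · exact h2
      · intro a
        by_contra hc
        have h3 := Set.ncard_lt_ncard (s := {a : A | s1 11 a.1 ≠ 0}) (t := Set.univ)
          ⟨Set.subset_univ _, fun h => h (Set.mem_univ a) hc⟩
        rw [Set.ncard_univ, Nat.card_coe_set_eq] at h3
        have h4 := Set.ncard_le_ncard (Set.subset_univ A)
        rw [Set.ncard_univ, Nat.card_eq_fintype_card, Fintype.card_fin] at h4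
        omega
    obtain ⟨h3, h4, h5⟩ := den_readyPass hG h1
    have hden : orderCmd.den s = readyPass.den s1 := rfl
    rw [hden]
    have hall : ∀ v : Fin n, v ∈ {v : Fin n | readyPass.den s1 11 v ≠ 0} := by
      intro v
      by_cases hv : v ∈ A
      · exact (h4 ⟨v, hv⟩).mpr (hA ⟨v, hv⟩)
      · refine h5 v hv fun z hz => ?_
        rcases hG.mem_of_adj hz with h | h
        · exact absurd h.1 hv
        · exact (h4 ⟨z, h.2⟩).mpr (hA ⟨z, h.2⟩)
    have hbij := h3.order.bijOn
    rw [Set.eq_univ_of_forall hall] at hbij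
    refine ⟨h3.order.isEliminationOrder hall, ?_⟩
    have hcard : readyPass.den s1 36 0 = n := by
      have h6 := hbij.injOn.ncard_image
      rw [hbij.image_eq, Set.ncard_univ, Nat.card_eq_fintype_card, Fintype.card_fin,
        ← Finset.coe_range, Set.ncard_coe_finset, Finset.card_range] at h6
      exact h6
    rwa [hcard] at hbij
  · rintro i s' v ⟨h1, h2⟩
    have e : setCell s' 25 0 v 11 = s' 11 := setCell_of_ne (by decide)
    exact ⟨h1.congr fun a ha => setCell_of_ne (by revert a; decide), by rwa [e]⟩
  · exact ⟨h0, Or.inr (Nat.zero_le _)⟩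
  · rintro i s' hi ⟨h1, h2⟩ - -
    obtain ⟨h3, h4, h5⟩ := den_readyPass hG h1
    obtain ⟨h6, h7, h8⟩ := den_eliminatePass hT h3 h5
    have hden : (Cmd.seq readyPass eliminatePass).den s' = eliminatePass.den (readyPass.den s') := rfl
    rw [hden]
    refine ⟨h6, ?_⟩
    rcases h2 with h2 | h2
    · exact Or.inl fun a => h7 a ((h4 a).mpr (h2 a))
    · rcases h8 with h8 | ⟨a, h8, h9⟩
      · exact Or.inl fun a => h7 a (h8 a)
      · right
        refine h2.trans_lt (Set.ncard_lt_ncard ⟨fun b hb => h7 b ((h4 b).mpr hb), fun hsub => h8 ?_⟩)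
        exact (h4 a).mpr (hsub h9)

end Order

/-! ### Existence of linear branch decompositions -/

section Existence

variable {V : Type*} {G : SimpleGraph V} {A : Set V} {T : SimpleGraph A}

theorem IsPartialElimination.ncard_eq {P : Set V} {pos : V → ℕ} {c : ℕ}
    (h : IsPartialElimination G A T P pos c) : P.ncard = c := by
  rw [← h.bijOn.injOn.ncard_image, h.bijOn.image_eq, ← Finset.coe_range, Set.ncard_coe_finset,
    Finset.card_range]

/-- A partial elimination of maximal length is complete: otherwise a ready vertex outside `A` or, if
there is none, a vertex of `A` with at most one unplaced neighbour would extend it. -/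
theorem exists_isEliminationOrder [Finite V] (hG : G.IsBipartiteWith A Aᶜ) (hT : T.IsTree) :
    ∃ pos : V → ℕ, IsEliminationOrder G A T pos ∧
      Set.BijOn pos Set.univ (Set.Iio (Nat.card V)) := by
  classical
  let S : Set ℕ := {c | ∃ P pos, IsPartialElimination G A T P pos c}
  have hS : BddAbove S := by
    refine ⟨Nat.card V, ?_⟩
    rintro c ⟨P, pos, h⟩
    rw [← h.ncard_eq, ← Set.ncard_univ]
    exact Set.ncard_le_ncard (Set.subset_univ P)
  obtain ⟨P, pos, h⟩ : sSup S ∈ S := Nat.sSup_mem ⟨0, ∅, fun _ => 0, .empty _⟩ hS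
  have hmax : ∀ Q pos', ¬ IsPartialElimination G A T Q pos' (sSup S + 1) := fun Q pos' h' =>
    Nat.not_succ_le_self _ (le_csSup hS ⟨Q, pos', h'⟩)
  have hready : ∀ b ∉ A, (∀ z, G.Adj b z → z ∈ P) → b ∈ P := fun b hb hz =>
    by_contra fun hbP => hmax _ _ (h.place_not_mem hG hbP hb hz)
  have hA : ∀ a : A, a.1 ∈ P := by
    by_contra hc
    push Not at hc
    obtain ⟨u, hu, hsub⟩ := exists_subsingleton_neighbors hT (U := {a : A | a.1 ∉ P}) hc
    exact hmax _ _ (h.place_mem u hu hsub hready)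
  have hall : ∀ v, v ∈ P := by
    intro v
    by_cases hv : v ∈ A
    · exact hA ⟨v, hv⟩
    · refine hready v hv fun z hz => ?_
      rcases hG.mem_of_adj hz with h | h
      · exact absurd h.1 hv
      · exact hA ⟨z, h.2⟩
  refine ⟨pos, h.isEliminationOrder hall, ?_⟩
  have hbij := h.bijOn
  rwa [← h.ncard_eq, Set.eq_univ_of_forall hall, Set.ncard_univ] at hbij

theorem exists_decomposition [Finite V] {n : ℕ} {pos : V → ℕ} (hG : G.IsBipartiteWith A Aᶜ) (hT : T.IsTree)
    (hS : IsSupport T fun a : A => G.neighborSet a) (hpos : IsEliminationOrder G A T pos)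
    (hbij : Set.BijOn pos Set.univ (Set.Iio n)) :
    ∃ δ : V → Fin (catOrder n), (∀ v, (δ v : ℕ) = pos v) ∧
      IsLinearBranchDecomposition (caterpillar n) δ ∧
      decompositionMimWidth G (caterpillar n) δ ≤ leafCount T := by
  obtain ⟨a⟩ := hT.connected.nonempty
  have hlt : ∀ v, pos v < n := fun v => hbij.mapsTo (Set.mem_univ v)
  have hn : 1 ≤ n := (Nat.zero_le _).trans_lt (hlt a)
  have hle : n ≤ catOrder n := by
    unfold catOrder
    omega
  exact ⟨fun v => ⟨pos v, (hlt v).trans_le hle⟩, fun _ => rfl,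
    caterpillar_isLinearBranchDecomposition hn hbij fun _ => rfl,
    caterpillar_mimWidth_le hn hG hpos hS ⟨a, a.2⟩ (fun _ => rfl) hlt⟩

theorem IsTDTreeConvex.linearMimWidth_le [Finite V] {t Δ : ℕ} (h : IsTDTreeConvex t Δ G A) :
    linearMimWidth G ≤ ((2 + t * (Δ - 2) : ℕ) : ℕ∞) := by
  obtain ⟨hG, H, hH, hconn⟩ := h
  obtain ⟨pos, hpos, hbij⟩ := exists_isEliminationOrder hG hH.isTree
  obtain ⟨δ, -, hδ, hle⟩ := exists_decomposition hG hH.isTree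
    (isSupport_of_preconnected hG hconn) hpos hbij
  have hle' := hle.trans (Nat.cast_le.mpr hH.leafCount_le)
  exact iInf_le_of_le _ (iInf_le_of_le _ (iInf_le_of_le δ (iInf_le_of_le hδ hle')))

end Existence

theorem mimWidth_le_linearMimWidth {V : Type*} (G : SimpleGraph V) :
    mimWidth G ≤ linearMimWidth G :=
  iInf_mono fun _ => iInf_mono fun _ => iInf_mono fun _ =>
    le_iInf fun h => iInf_le_of_le h.isBranchDecomposition le_rfl

/-! ### The complete program -/

section Complete

variable {n : ℕ} {G : SimpleGraph (Fin n)} {A : Set (Fin n)} {T : SimpleGraph A} {s : Memory}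

theorem inputMemory_size : inputMemory G A 0 0 = n := by simp [inputMemory]

theorem inputMemory_memA (v : Fin n) : inputMemory G A 1 v ≠ 0 ↔ v ∈ A := by
  have h : (∃ w : Fin n, (v : ℕ) = w ∧ w ∈ A) ↔ v ∈ A :=
    ⟨fun ⟨w, h1, h2⟩ => by rwa [Fin.ext h1], fun h => ⟨v, rfl, h⟩⟩
  simp [inputMemory, h]

theorem inputMemory_adj (u v : Fin n) : inputMemory G A 2 (n * u + v) ≠ 0 ↔ G.Adj u v := by
  have h : (∃ u' v' : Fin n, n * (u : ℕ) + v = n * u' + v' ∧ G.Adj u' v') ↔ G.Adj u v := by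
    constructor
    · rintro ⟨u', v', h1, h2⟩
      obtain ⟨rfl, rfl⟩ := (index_inj u v u' v').mp h1
      exact h2
    · exact fun h => ⟨u, v, rfl, h⟩
  simp [inputMemory, h]

theorem inputMemory_of_le {a : ℕ} (ha : 3 ≤ a) (i : ℕ) : inputMemory G A a i = 0 := by
  have h0 : a ≠ 0 := by omega
  have h1 : a ≠ 1 := by omega
  have h2 : a ≠ 2 := by omega
  simp [inputMemory, h0, h1, h2]

/-- Store the multiples of `n` in array `7`. -/
def multiplesCmd : Cmd :=
  .seq (.write 37 (.const 0) (.const 0))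
    (.forn 20 (.seq (.write 7 (.var 20) (.var 37)) (.write 37 (.const 0) (.add (.var 37) (.var 0)))))

/-- The machine cannot multiply, so the row offsets of the matrices are obtained by repeated
addition. -/
theorem den_multiplesCmd (hs : s 0 0 = n) (u : Fin n) : multiplesCmd.den s 7 u = n * u := by
  have key := Cmd.forn_rule (x := 20)
    (p := .seq (.write 7 (.var 20) (.var 37)) (.write 37 (.const 0) (.add (.var 37) (.var 0))))
    (s := setCell s 37 0 0) (by decide) (by rw [setCell_of_ne (by decide), hs])
    (fun i s' => s' 37 0 = n * i ∧ ∀ u < i, s' 7 u = n * u) ?_ ?_ ?_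
  · exact key.2 u u.2
  · rintro i s' v ⟨h1, h2⟩
    rw [setCell_of_ne (show 37 ≠ 20 by decide), setCell_of_ne (show 7 ≠ 20 by decide)]
    exact ⟨h1, h2⟩
  · exact ⟨by rw [setCell_self, Nat.mul_zero], fun u hu => absurd hu (Nat.not_lt_zero u)⟩
  · rintro i s' hi ⟨h1, h2⟩ h3 h4
    simp only [Cmd.den, Expr.eval_var, Expr.eval_const, Expr.eval_add, h3, h1]
    refine ⟨?_, fun u hu => ?_⟩
    · rw [setCell_self, setCell_of_ne (by decide), setCell_of_ne (by decide), h1, h4, Nat.mul_succ]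
    · rw [setCell_of_ne (by decide), setCell_apply]
      split_ifs with h
      · rw [h]
      · exact h2 u (by omega)

/-- Store an element of `A` in the variable `35`. -/
def centerCmd : Cmd := .forn 20 (.ite (.read 1 (.var 20)) (.write 35 (.const 0) (.var 20)) .skip)

theorem den_centerCmd (hs : s 0 0 = n) (hA : ∀ v : Fin n, s 1 v ≠ 0 ↔ v ∈ A) (hne : A.Nonempty) :
    ∃ r : A, centerCmd.den s 35 0 = r.1 := by
  have key := Cmd.forn_rule (x := 20)
    (p := .ite (.read 1 (.var 20)) (.write 35 (.const 0) (.var 20)) .skip)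
    (s := s) (by decide) hs
    (fun i s' => s' 1 = s 1 ∧ ((∃ a : A, a.1.1 < i) → ∃ r : A, s' 35 0 = r.1)) ?_ ?_ ?_
  · obtain ⟨a, ha⟩ := hne
    exact key.2 ⟨⟨a, ha⟩, a.2⟩
  · rintro i s' v ⟨h1, h2⟩
    rw [setCell_of_ne (show 1 ≠ 20 by decide), setCell_of_ne (show 35 ≠ 20 by decide)]
    exact ⟨h1, h2⟩
  · exact ⟨rfl, fun ⟨a, ha⟩ => absurd ha (Nat.not_lt_zero _)⟩
  · rintro i s' hi ⟨h1, h2⟩ h3 h4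
    have hiA := hA ⟨i, hi⟩
    have hden : (Cmd.ite (.read 1 (.var 20)) (.write 35 (.const 0) (.var 20)) .skip).den s' =
        if s' 1 (s' 20 0) = 0 then s' else setCell s' 35 0 (s' 20 0) := rfl
    rw [hden, h3, h1]
    split_ifs with h
    · refine ⟨h1, fun ⟨a, ha⟩ => h2 ⟨a, ?_⟩⟩
      rcases Nat.lt_succ_iff_lt_or_eq.mp ha with ha | ha
      · exact ha
      · exact absurd h (ha ▸ (hA a).mpr a.2)
    · rw [setCell_self, setCell_of_ne (by decide)]
      exact ⟨h1, fun _ => ⟨⟨⟨i, hi⟩, hiA.mp h⟩, rfl⟩⟩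

/-- Join the vertices `20` and `35`. -/
def starStep : Cmd :=
  .ite (.and (.read 1 (.var 20)) (.not (.eq (.var 20) (.var 35))))
    (.seq (.write 8 (.add (.read 7 (.var 20)) (.var 35)) (.const 1))
      (.write 8 (.add (.read 7 (.var 35)) (.var 20)) (.const 1))) .skip

/-- Store the star with the center `35` in array `8`. -/
def starCmd : Cmd := .forn 20 starStep

/-- A star is a tree on `A` that can be written down without any knowledge of `G`; it is the start
of the local search. -/
theorem den_starCmd (hs : HoldsInput G A s) {r : A} (hr : s 35 0 = r.1)
    (h8 : ∀ i, s 8 i = 0) : HoldsTree (SimpleGraph.starGraph r) (starCmd.den s) := by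
  have key := Cmd.forn_rule (x := 20) (p := starStep) (by decide) hs.size
    (fun i s' => HoldsInput G A s' ∧ s' 35 0 = r.1 ∧ ∀ u v : Fin n, s' 8 (n * u + v) ≠ 0 ↔
      u ≠ v ∧ ((u ∈ A ∧ u.1 < i ∧ v = r.1) ∨ (v ∈ A ∧ v.1 < i ∧ u = r.1))) ?_ ?_ ?_
  · intro u v
    refine (key.2.2 u v).trans ?_
    simp only [SimpleGraph.starGraph_adj, u.2, v.2, true_and, Subtype.ext_iff, ne_eq]
    constructor
    · rintro ⟨h1, ⟨h2, rfl⟩ | ⟨h2, rfl⟩⟩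
      · exact ⟨h2, r.2, h1, Or.inr rfl⟩
      · exact ⟨r.2, h2, h1, Or.inl rfl⟩
    · rintro ⟨hu, hv, h1, h2 | h2⟩
      · exact ⟨h1, Or.inr ⟨hv, h2⟩⟩
      · exact ⟨h1, Or.inl ⟨hu, h2⟩⟩
  · rintro i s' v ⟨h1, h2, h3⟩
    rw [setCell_of_ne (show 35 ≠ 20 by decide), setCell_of_ne (show 8 ≠ 20 by decide)]
    exact ⟨h1.setCell (by decide) _ _, h2, h3⟩
  · refine ⟨hs, hr, fun u v => ?_⟩
    simp [h8]
  · rintro i s' hi ⟨h1, h2, h3⟩ hx -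
    have hguard : (Expr.and (.read 1 (.var 20)) (.not (.eq (.var 20) (.var 35)))).eval s' ≠ 0 ↔
        ⟨i, hi⟩ ∈ A ∧ (⟨i, hi⟩ : Fin n) ≠ r.1 := by
      have := h1.memA ⟨i, hi⟩
      simp only at this
      simp only [Expr.eval_and, Expr.eval_not, Expr.eval_eq, Expr.eval_read, Expr.eval_var, hx, h2,
        this, ne_eq, Fin.ext_iff]
    have hden : starStep.den s' =
      if (Expr.and (.read 1 (.var 20)) (.not (.eq (.var 20) (.var 35)))).eval s' = 0 then s' else
        (Cmd.seq (.write 8 (.add (.read 7 (.var 20)) (.var 35)) (.const 1))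
          (.write 8 (.add (.read 7 (.var 35)) (.var 20)) (.const 1))).den s' := rfl
    rw [hden]
    split_ifs with hg
    · refine ⟨h1, h2, fun u v => (h3 u v).trans (and_congr_right fun huv => ?_)⟩
      have hno : ∀ w : Fin n, w ∈ A → w ≠ r.1 → w.1 ≠ i := by
        rintro w hw hwr rfl
        exact hguard.mpr ⟨hw, hwr⟩ hg
      constructor
      · rintro (⟨h4, h5, h6⟩ | ⟨h4, h5, h6⟩)
        · exact Or.inl ⟨h4, by omega, h6⟩
        · exact Or.inr ⟨h4, by omega, h6⟩
      · rintro (⟨h4, h5, h6⟩ | ⟨h4, h5, h6⟩)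
        · have := hno u h4 (h6 ▸ huv)
          exact Or.inl ⟨h4, by omega, h6⟩
        · have := hno v h4 (h6 ▸ huv.symm)
          exact Or.inr ⟨h4, by omega, h6⟩
    · obtain ⟨hi', hir⟩ := hguard.mp hg
      have hval : ∀ u v : Fin n, (Cmd.seq (.write 8 (.add (.read 7 (.var 20)) (.var 35)) (.const 1))
          (.write 8 (.add (.read 7 (.var 35)) (.var 20)) (.const 1))).den s' 8 (n * u + v) =
          if u = r.1 ∧ v = ⟨i, hi⟩ then 1 else if u = ⟨i, hi⟩ ∧ v = r.1 then 1
            else s' 8 (n * u + v) := by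
        intro u v
        have hm := h1.mul ⟨i, hi⟩
        simp only at hm
        simp only [Cmd.den, Expr.eval_add, Expr.eval_read, Expr.eval_var, Expr.eval_const,
          setCell_apply, setCell_of_ne (show 7 ≠ 8 by decide), setCell_of_ne (show 20 ≠ 8 by decide),
          setCell_of_ne (show 35 ≠ 8 by decide), hx, h2, hm, h1.mul,
          index_inj (u := u) (v := v) (u' := ⟨i, hi⟩) (v' := r.1),
          index_inj (u := u) (v := v) (u' := r.1) (v' := ⟨i, hi⟩)]
      refine ⟨h1.den _ (by decide), ?_, fun u v => ?_⟩
      · rw [Cmd.den_of_not_mem_writes _ (by decide), h2]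
      · rw [hval]
        split_ifs with h4 h5
        · obtain ⟨rfl, rfl⟩ := h4
          simp only [ne_eq, one_ne_zero, not_false_eq_true, true_iff]
          exact ⟨Ne.symm hir, Or.inr ⟨hi', Nat.lt_succ_self i, trivial⟩⟩
        · obtain ⟨rfl, rfl⟩ := h5
          simp only [ne_eq, one_ne_zero, not_false_eq_true, true_iff]
          exact ⟨hir, Or.inl ⟨hi', Nat.lt_succ_self i, trivial⟩⟩
        · refine (h3 u v).trans (and_congr_right fun huv => ?_)
          constructor
          · rintro (⟨h6, h7, h8⟩ | ⟨h6, h7, h8⟩)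
            · exact Or.inl ⟨h6, by omega, h8⟩
            · exact Or.inr ⟨h6, by omega, h8⟩
          · rintro (⟨h6, h7, h8⟩ | ⟨h6, h7, h8⟩)
            · have : u.1 ≠ i := fun he => h5 ⟨Fin.ext he, h8⟩
              exact Or.inl ⟨h6, by omega, h8⟩
            · have : v.1 ≠ i := fun he => h4 ⟨h8, Fin.ext he⟩
              exact Or.inr ⟨h6, by omega, h8⟩

/-- Store the multiples of `n` and a star. -/
def setupCmd : Cmd := .seq multiplesCmd (.seq centerCmd starCmd)

theorem den_setupCmd (hA : A.Nonempty) :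
    ∃ T : SimpleGraph A, RepTree G A (setupCmd.den (inputMemory G A)) T := by
  set s1 := multiplesCmd.den (inputMemory G A) with hs1
  have h1 : HoldsInput G A s1 := by
    refine ⟨?_, fun v => ?_, fun u v => ?_, fun u => den_multiplesCmd inputMemory_size u⟩
    · rw [hs1, Cmd.den_of_not_mem_writes _ (by decide), inputMemory_size]
    · rw [hs1, Cmd.den_of_not_mem_writes _ (by decide), inputMemory_memA]
    · rw [hs1, Cmd.den_of_not_mem_writes _ (by decide), inputMemory_adj]
  obtain ⟨r, hr⟩ := den_centerCmd h1.size h1.memA hA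
  have h2 : HoldsInput G A (centerCmd.den s1) := h1.den _ (by decide)
  refine ⟨SimpleGraph.starGraph r, h2.den starCmd (by decide), den_starCmd h2 hr fun i => ?_,
    SimpleGraph.isTree_starGraph r⟩
  rw [Cmd.den_of_not_mem_writes _ (by decide), hs1, Cmd.den_of_not_mem_writes _ (by decide),
    inputMemory_of_le (by decide)]

/-- Write the caterpillar. -/
def outputCmd : Cmd :=
  .seq (.write 3 (.const 0) (.sub (.add (.var 0) (.var 0)) (.sub (.const 2) (.var 0))))
    (.seq (.write 3 (.const 1) (.sub (.var 3) (.const 1)))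
      (.forn 20
        (.seq (.seq (.write 4 (.var 20) (.var 20)) (.write 5 (.var 20) (.add (.var 0) (.var 20))))
          (.seq (.write 4 (.add (.var 0) (.var 20)) (.add (.var 0) (.var 20)))
            (.write 5 (.add (.var 0) (.var 20)) (.add (.add (.var 0) (.var 20)) (.const 1)))))))

theorem den_outputCmd (hs : s 0 0 = n) {δ : Fin n → Fin (catOrder n)}
    (hδ : ∀ v : Fin n, (δ v : ℕ) = s 6 v) : IsOutput (outputCmd.den s) (caterpillar n) δ := by
  set s1 := setCell s 3 0 (n + n - (2 - n)) with hs1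
  set s2 := setCell s1 3 1 (n + n - (2 - n) - 1) with hs2
  have hm : catOrder n = 2 * n - (2 - n) := rfl
  have h2 : s2 0 0 = n := by rw [hs2, setCell_of_ne (by decide), hs1, setCell_of_ne (by decide), hs]
  set p : Cmd := (.seq (.seq (.write 4 (.var 20) (.var 20))
      (.write 5 (.var 20) (.add (.var 0) (.var 20))))
    (.seq (.write 4 (.add (.var 0) (.var 20)) (.add (.var 0) (.var 20)))
      (.write 5 (.add (.var 0) (.var 20)) (.add (.add (.var 0) (.var 20)) (.const 1))))) with hp
  have hden : outputCmd.den s = (Cmd.forn 20 p).den s2 := by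
    have h1 : setCell s 3 0 (s 0 0 + s 0 0 - (2 - s 0 0)) = s1 := by rw [hs1, hs]
    have h3 : setCell s1 3 1 (s1 3 0 - 1) = s2 := by rw [hs2, hs1, setCell_self]
    rw [← h3, ← h1]
    rfl
  have key := Cmd.forn_rule (x := 20) (p := p) (by decide) h2
    (fun i s' => ∀ k, (k < i ∨ (n ≤ k ∧ k < n + i)) → s' 4 k = k ∧ s' 5 k = catParent n k) ?_ ?_ ?_
  · rw [← hden] at key
    have h30 : outputCmd.den s 3 0 = catOrder n := by
      rw [hden, Cmd.den_of_not_mem_writes _ (by decide), hs2, setCell_apply, if_neg (by decide), hs1,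
        setCell_self, hm]
      omega
    have h31 : outputCmd.den s 3 1 = catOrder n - 1 := by
      rw [hden, Cmd.den_of_not_mem_writes _ (by decide), hs2, setCell_self, hm]
      omega
    have h6 : ∀ v, outputCmd.den s 6 v = s 6 v := fun v => by
      rw [Cmd.den_of_not_mem_writes _ (by decide)]
    -- The loop also writes an entry for the last spine vertex, which has no parent; it is not among
    -- the `catOrder n - 1` listed edges.
    have h45 : ∀ k < catOrder n - 1, outputCmd.den s 4 k = k ∧
        outputCmd.den s 5 k = catParent n k := fun k hk => key k (by omega)
    refine ⟨h30, fun k hk => ?_, fun x y => ?_, fun v => by rw [h6, hδ]⟩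
    · rw [h31] at hk
      obtain ⟨h7, h8⟩ := h45 k hk
      rw [h7, h8]
      exact ⟨by omega, (catParent_bound n k (by omega)).2⟩
    · rw [h31]
      change (x ≠ y ∧ ((x.1 + 1 < catOrder n ∧ catParent n x = y) ∨
        (y.1 + 1 < catOrder n ∧ catParent n y = x))) ↔ _
      constructor
      · rintro ⟨-, ⟨h7, h8⟩ | ⟨h7, h8⟩⟩
        · refine ⟨x, by omega, Or.inl ?_⟩
          rw [(h45 x (by omega)).1, (h45 x (by omega)).2]
          exact ⟨rfl, h8⟩
        · refine ⟨y, by omega, Or.inr ?_⟩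
          rw [(h45 y (by omega)).1, (h45 y (by omega)).2]
          exact ⟨rfl, h8⟩
      · rintro ⟨k, hk, h7⟩
        have h8 := (catParent_bound n k (by omega)).1
        rw [(h45 k hk).1, (h45 k hk).2] at h7
        rcases h7 with ⟨rfl, h7⟩ | ⟨rfl, h7⟩
        · exact ⟨fun he => by rw [he] at h8 h7; omega, Or.inl ⟨by omega, h7⟩⟩
        · exact ⟨fun he => by rw [he] at h7; omega, Or.inr ⟨by omega, h7⟩⟩
  · intro i s' v h k hk
    rw [setCell_of_ne (by decide), setCell_of_ne (by decide)]
    exact h k hk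
  · intro k hk
    omega
  · intro i s' hi h h3 h4 k hk
    have e4 : p.den s' 4 k = if k = n + i then n + i else if k = i then i else s' 4 k := by
      simp only [hp, Cmd.den, Expr.eval_add, Expr.eval_var, Expr.eval_const, setCell_apply,
        setCell_of_ne (show 4 ≠ 5 by decide), setCell_of_ne (show 0 ≠ 5 by decide),
        setCell_of_ne (show 0 ≠ 4 by decide), setCell_of_ne (show 20 ≠ 5 by decide),
        setCell_of_ne (show 20 ≠ 4 by decide), h3, h4]
    have e5 : p.den s' 5 k = if k = n + i then n + i + 1 else if k = i then n + i else s' 5 k := by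
      simp only [hp, Cmd.den, Expr.eval_add, Expr.eval_var, Expr.eval_const, setCell_apply,
        setCell_of_ne (show 5 ≠ 4 by decide), setCell_of_ne (show 0 ≠ 5 by decide),
        setCell_of_ne (show 0 ≠ 4 by decide), setCell_of_ne (show 20 ≠ 5 by decide),
        setCell_of_ne (show 20 ≠ 4 by decide), h3, h4]
    rw [e4, e5, catParent]
    by_cases h5 : k = n + i
    · rw [if_pos h5, if_pos h5, if_neg (by omega)]
      omega
    · rw [if_neg h5, if_neg h5]
      by_cases h6 : k = i
      · rw [if_pos h6, if_pos h6, if_pos (by omega)]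
        omega
      · rw [if_neg h6, if_neg h6]
        exact h k (by omega)

/-- Compute a linear branch decomposition. -/
def decomposeCmd : Cmd :=
  .seq setupCmd (.seq improveCmd (.seq pushCmd (.seq orderCmd outputCmd)))

theorem decomposeCmd_wellFormed : decomposeCmd.WellFormed := by decide

/-- The tree `H` enters only through its existence: it makes the searches succeed, and its number of
leaves bounds that of the computed support. -/
theorem den_decomposeCmd {t Δ : ℕ} (h : IsTDTreeConvex t Δ G A) :
    ∃ δ : Fin n → Fin (catOrder n),
      IsOutput (decomposeCmd.den (inputMemory G A)) (caterpillar n) δ ∧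
      IsLinearBranchDecomposition (caterpillar n) δ ∧
      decompositionMimWidth G (caterpillar n) δ ≤ ((2 + t * (Δ - 2) : ℕ) : ℕ∞) := by
  obtain ⟨hG, H, hH, hconn⟩ := h
  have hHS : IsSupport H (nbag G A) := isSupport_of_preconnected hG hconn
  obtain ⟨a⟩ := hH.isTree.connected.nonempty
  have hn : 1 ≤ n := (Nat.zero_le _).trans_lt a.1.2
  obtain ⟨T₁, h1⟩ := den_setupCmd (G := G) ⟨a.1, a.2⟩
  set s1 := setupCmd.den (inputMemory G A) with hs1
  obtain ⟨T₂, h2, hS2⟩ := den_improveCmd hn h1 hH.isTree hHS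
  set s2 := improveCmd.den s1 with hs2
  -- The heights, the marks of placed vertices and the position counter have not been written so far
  -- and still have their initial value `0`.
  have hzero2 : ∀ b ∈ [9, 11, 36], ∀ i, s2 b i = 0 := by
    intro b hb i
    rw [hs2, Cmd.den_of_not_mem_writes _
      ((show ∀ b ∈ [9, 11, 36], b ∉ improveCmd.writes by decide) b hb), hs1,
      Cmd.den_of_not_mem_writes _ ((show ∀ b ∈ [9, 11, 36], b ∉ setupCmd.writes by decide) b hb),
      inputMemory_of_le ((show ∀ b ∈ [9, 11, 36], 3 ≤ b by decide) b hb)]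
  obtain ⟨T, h3, hS3, hmin⟩ := den_pushCmd hn h2 hS2 fun v _ => hzero2 9 (by simp) v
  set s3 := pushCmd.den s2 with hs3
  have hzero3 : ∀ b ∈ [11, 36], ∀ i, s3 b i = 0 := by
    intro b hb i
    rw [hs3, Cmd.den_of_not_mem_writes _
      ((show ∀ b ∈ [11, 36], b ∉ pushCmd.writes by decide) b hb),
      hzero2 b (List.mem_cons_of_mem _ hb)]
  obtain ⟨hpos, hbij⟩ := den_orderCmd hG h3.2.2 h3.1 h3.2.1 (fun v => hzero3 11 (by simp) v)
    (hzero3 36 (by simp) 0)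
  obtain ⟨δ, hδ, hlin, hle⟩ := exists_decomposition hG h3.2.2 hS3 hpos hbij
  refine ⟨δ, den_outputCmd ?_ hδ, hlin,
    hle.trans (Nat.cast_le.mpr ((hmin H hH.isTree hHS).trans hH.leafCount_le))⟩
  rw [Cmd.den_of_not_mem_writes _ (by decide)]
  exact h3.1.size

end Complete

end LinMim

theorem mainTheorem7 (t Δ : ℕ) (ht : 1 ≤ t) (hΔ : 3 ≤ Δ) :
    (∀ (V : Type*) [Finite V] (G : SimpleGraph V) (A : Set V),
      LinMim.IsTDTreeConvex t Δ G A →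
        LinMim.linearMimWidth G ≤ ((2 + t * (Δ - 2) : ℕ) : ℕ∞) ∧
        LinMim.mimWidth G ≤ ((2 + t * (Δ - 2) : ℕ) : ℕ∞)) ∧
    ∃ (p : LinMim.Program) (P : Polynomial ℕ),
      ∀ (n : ℕ) (G : SimpleGraph (Fin n)) (A : Set (Fin n)),
        LinMim.IsTDTreeConvex t Δ G A →
          ∃ (k : ℕ) (s : LinMim.Memory),
            LinMim.Run p (LinMim.inputMemory G A) k s ∧ k ≤ P.eval n ∧
            ∃ (m : ℕ) (T : SimpleGraph (Fin m)) (δ : Fin n → Fin m),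
              LinMim.IsOutput s T δ ∧
              LinMim.IsLinearBranchDecomposition T δ ∧
              LinMim.decompositionMimWidth G T δ ≤ ((2 + t * (Δ - 2) : ℕ) : ℕ∞) := by
  refine ⟨fun V _ G A h => ⟨h.linearMimWidth_le,
    (LinMim.mimWidth_le_linearMimWidth G).trans h.linearMimWidth_le⟩,
    LinMim.decomposeCmd.compile, LinMim.decomposeCmd.time, fun n G A h => ?_⟩
  obtain ⟨k, hk, hrun⟩ := LinMim.Cmd.run_compile LinMim.decomposeCmd_wellFormed
    (LinMim.inputMemory G A)
  rw [LinMim.inputMemory_size] at hk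
  obtain ⟨δ, h1, h2, h3⟩ := LinMim.den_decomposeCmd h
  exact ⟨k, _, hrun, hk, _, _, δ, h1, h2, h3⟩
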